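/- **Theorem.** Over $\mathsf{RCA}_0$, Cousin's lemma for continuous functions on $[0,1]$ implies weak König's lemma. That is, every model of $\mathsf{RCA}_0$ (with an arbitrary, possibly nonstandard, first-order part) in which Cousin's lemma for continuous functions holds is a model of $\mathsf{WKL}_0$. Here $\mathsf{RCA}_0$ is the theory in the two-sorted language of second-order arithmetic consisting of the basic axioms of arithmetic, $\Sigma^0_1$ induction and $\Delta^0_1$ comprehension, and $\mathsf{WKL}_0$ is $\mathsf{RCA}_0$ together with weak König's lemma: every infinite tree $T\subseteq 2^{<\mathbb N}$ has a path, i.e. there is $X\in 2^{\mathbb N}$ with $X{\restriction}k\in T$ for all $k$. Cousin's lemma for continuous functions is the following statement of second-order arithmetic. Let $\delta$ be a continuous gauge, that is, a (coded) continuous function $\delta\colon[0,1]\to\mathbb R$ that is defined and positive at every $x\in[0,1]$. Then $\delta$ has a $\delta$-fine cover: there are finitely many points $p_i\in[0,1]$ and real radii $r_i>0$ ($i<l$) such that $r_i\le\delta(p_i)$ for all $i<l$, and every $x\in[0,1]$ satisfies $|x-p_i|<r_i$ for some $i<l$. Reals and continuous functions are coded in the usual way. A real is a sequence of rationals $(q_k)$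 with $|q_k-q_{k+i}|\le\frac1{k+1}$ for all $k,i$. A continuous function is coded by a set $\Phi$ enumerating quadruples $(a,r)\,\Phi\,(b,s)$, with $a\in\mathbb Q\cap[0,1]$, $b\in\mathbb Q$ and $r,s\in\mathbb Q^+$, such that: if $(a,r)\Phi(b,s)$ and $(a,r)\Phi(b',s')$, then $|b-b'|\le s+s'$; if $(a,r)\Phi(b,s)$ and $|a-a'|+r'<r$, then $(a',r')\Phi(b,s)$; and if $(a,r)\Phi(b,s)$ and $|b-b'|+s<s'$, then $(a,r)\Phi(b',s')$. The function is defined at $x$ if for every rational $\varepsilon>0$ there is $(a,r)\Phi(b,s)$ with $|x-a|<r$ and $s<\varepsilon$; its value there is then the real $y$ such that $|y-b|\le s$ whenever $(a,r)\Phi(b,s)$ and $|x-a|<r$. -/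

import Mathlib

universe u

/-- A structure for the two-sorted language of second-order arithmetic: a first-order part `Num`
(possibly nonstandard) and a nonempty collection `sets` of subsets of it, over which the set
variables range. -/
structure L2Structure where
  Num : Type u
  zero : Num
  one : Num
  add : Num → Num → Num
  mul : Num → Num → Num
  lt : Num → Num → Prop
  sets : Set (Set Num)
  sets_nonempty : sets.Nonempty

/-- Numerical terms; number variables are de Bruijn indices. -/
inductive NumTerm : Type
  | var (i : ℕ) : NumTerm
  | zero : NumTerm
  | one : NumTerm
  | add (s t : NumTerm) : NumTerm
  | mul (s t : NumTerm) : NumTerm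

/-- Bounded-quantifier (`Σ⁰₀`) formulas of second-order arithmetic, with free number variables and
free set variables. The remaining connectives and the bounded existential quantifier are the usual
classical abbreviations. `ball t φ` is `∀ x < t, φ`; the variable `x` has index `0` in `φ`, and `t`
lives outside the scope of the quantifier. -/
inductive BddFormula : Type
  | eq (s t : NumTerm) : BddFormula
  | lt (s t : NumTerm) : BddFormula
  | mem (t : NumTerm) (j : ℕ) : BddFormula
  | neg (φ : BddFormula) : BddFormula
  | and (φ ψ : BddFormula) : BddFormula
  | ball (t : NumTerm) (φ : BddFormula) : BddFormula

/-- Extend an assignment by a value for the variable with index `0`. -/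
def pushVal {α : Type u} (a : α) (e : ℕ → α) : ℕ → α
  | 0 => a
  | i + 1 => e i

namespace L2Structure

variable (M : L2Structure.{u})

instance : Zero M.Num := ⟨M.zero⟩
instance : One M.Num := ⟨M.one⟩
instance : Add M.Num := ⟨M.add⟩
instance : Mul M.Num := ⟨M.mul⟩
instance : LT M.Num := ⟨M.lt⟩

/-! ### The theory `RCA₀` -/

def termVal (e : ℕ → M.Num) : NumTerm → M.Num
  | .var i => e i
  | .zero => 0
  | .one => 1
  | .add s t => termVal e s + termVal e t
  | .mul s t => termVal e s * termVal e t

/-- Satisfaction of a bounded-quantifier formula; `e` assigns numbers to the number variables and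
`E` assigns sets to the set variables. -/
def Holds (E : ℕ → Set M.Num) : (ℕ → M.Num) → BddFormula → Prop
  | e, .eq s t => M.termVal e s = M.termVal e t
  | e, .lt s t => M.termVal e s < M.termVal e t
  | e, .mem t j => M.termVal e t ∈ E j
  | e, .neg φ => ¬ Holds E e φ
  | e, .and φ ψ => Holds E e φ ∧ Holds E e ψ
  | e, .ball t φ => ∀ a : M.Num, a < M.termVal e t → Holds E (pushVal a e) φ

/-- The `Σ⁰₁` formula `∃ m, θ(m, n)` at `n`, with parameters given by `e` and `E`. -/
def HoldsSigma (E : ℕ → Set M.Num) (e : ℕ → M.Num) (θ : BddFormula) (n : M.Num) : Prop :=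
  ∃ m : M.Num, M.Holds E (pushVal m (pushVal n e)) θ

/-- The `Π⁰₁` formula `∀ m, θ(m, n)` at `n`, with parameters given by `e` and `E`. -/
def HoldsPi (E : ℕ → Set M.Num) (e : ℕ → M.Num) (θ : BddFormula) (n : M.Num) : Prop :=
  ∀ m : M.Num, M.Holds E (pushVal m (pushVal n e)) θ

structure BasicAxioms : Prop where
  succ_ne_zero : ∀ n : M.Num, n + 1 ≠ 0
  succ_inj : ∀ m n : M.Num, m + 1 = n + 1 → m = n
  add_zero : ∀ m : M.Num, m + 0 = m
  add_succ : ∀ m n : M.Num, m + (n + 1) = (m + n) + 1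
  mul_zero : ∀ m : M.Num, m * 0 = 0
  mul_succ : ∀ m n : M.Num, m * (n + 1) = m * n + m
  not_lt_zero : ∀ m : M.Num, ¬ m < 0
  lt_succ : ∀ m n : M.Num, m < n + 1 ↔ (m < n ∨ m = n)

def SigmaInduction : Prop :=
  ∀ (θ : BddFormula) (e : ℕ → M.Num) (E : ℕ → Set M.Num), (∀ j, E j ∈ M.sets) →
    M.HoldsSigma E e θ 0 →
    (∀ n : M.Num, M.HoldsSigma E e θ n → M.HoldsSigma E e θ (n + 1)) →
    ∀ n : M.Num, M.HoldsSigma E e θ n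

def DeltaComprehension : Prop :=
  ∀ (θ η : BddFormula) (e : ℕ → M.Num) (E : ℕ → Set M.Num), (∀ j, E j ∈ M.sets) →
    (∀ n : M.Num, M.HoldsSigma E e θ n ↔ M.HoldsPi E e η n) →
    ∃ X ∈ M.sets, ∀ n : M.Num, n ∈ X ↔ M.HoldsSigma E e θ n

/-- `M` is a model of `RCA₀`. -/
structure ModelsRCA0 : Prop where
  basic : M.BasicAxioms
  induction : M.SigmaInduction
  comprehension : M.DeltaComprehension

/-! ### Pairs, functions, rational numbers -/

variable {M}

/-- The pairing function `(i, j) ↦ (i + j)² + i`. -/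
def pair (i j : M.Num) : M.Num := (i + j) * (i + j) + i

/-- `F` is (the graph of) a function from numbers to numbers. -/
def IsFun (F : Set M.Num) : Prop :=
  (∀ z ∈ F, ∃ i j : M.Num, z = pair i j) ∧ ∀ i : M.Num, ∃! j : M.Num, pair i j ∈ F

/-- The `i`-th entry of the sequence of sets coded by `Z`. -/
def row (Z : Set M.Num) (i : M.Num) : Set M.Num := {n | pair i n ∈ Z}

variable (M) in
/-- Names for the rational numbers of `M`: the triple `(p, n, d)` names `(p - n) / (d + 1)`.
A rational number has many names. -/
structure Frac where
  pos : M.Num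
  neg : M.Num
  den : M.Num

namespace Frac

def code (q : M.Frac) : M.Num := pair q.pos (pair q.neg q.den)

def zero : M.Frac := ⟨0, 0, 0⟩

def one : M.Frac := ⟨1, 0, 0⟩

/-- `1 / (k + 1)` -/
def invSucc (k : M.Num) : M.Frac := ⟨1, 0, k⟩

def add (q r : M.Frac) : M.Frac :=
  ⟨q.pos * (r.den + 1) + r.pos * (q.den + 1), q.neg * (r.den + 1) + r.neg * (q.den + 1),
    q.den * r.den + q.den + r.den⟩

def sub (q r : M.Frac) : M.Frac := q.add ⟨r.neg, r.pos, r.den⟩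

def Lt (q r : M.Frac) : Prop :=
  q.pos * (r.den + 1) + r.neg * (q.den + 1) < r.pos * (q.den + 1) + q.neg * (r.den + 1)

def Le (q r : M.Frac) : Prop := ¬ r.Lt q

/-- `|q - r| < s` -/
def DistLt (q r s : M.Frac) : Prop := q.Lt (r.add s) ∧ r.Lt (q.add s)

/-- `|q - r| ≤ s` -/
def DistLe (q r s : M.Frac) : Prop := q.Le (r.add s) ∧ r.Le (q.add s)

/-- `q` lies in `[0, 1]`. -/
def InUnit (q : M.Frac) : Prop := zero.Le q ∧ q.Le one

end Frac

/-! ### Real numbers -/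

/-- The `k`-th term of the sequence of rationals `x` is `q`. -/
def Term (x : Set M.Num) (k : M.Num) (q : M.Frac) : Prop := pair k q.code ∈ x

/-- `x` is a real number: a sequence of rationals with `|x_k - x_{k+i}| ≤ 1 / (k + 1)`. -/
def IsReal (x : Set M.Num) : Prop :=
  (∀ z ∈ x, ∃ (k : M.Num) (q : M.Frac), z = pair k q.code) ∧
  (∀ k : M.Num, ∃! q : M.Frac, Term x k q) ∧
  ∀ (k i : M.Num) (q r : M.Frac), Term x k q → Term x (k + i) r → q.DistLe r (.invSucc k)

/-- `x > 0`, for a real `x`. -/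
def RealPos (x : Set M.Num) : Prop :=
  ∃ (k : M.Num) (q : M.Frac), Term x k q ∧ (Frac.invSucc k).Lt q

/-- `x ≤ y`, for reals `x`, `y`: `x_k ≤ y_k + 2 / (k + 1)` for all `k`. -/
def RealLe (x y : Set M.Num) : Prop :=
  ∀ (k : M.Num) (q r : M.Frac), Term x k q → Term y k r →
    q.Le (r.add ((Frac.invSucc k).add (.invSucc k)))

/-- `x` is a real with `0 ≤ x ≤ 1`. -/
def InUnitInterval (x : Set M.Num) : Prop :=
  IsReal x ∧ ∀ (k : M.Num) (q : M.Frac), Term x k q →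
    Frac.zero.Le (q.add (.invSucc k)) ∧ q.Le (Frac.one.add (.invSucc k))

/-- `|x - a| < r`, for a real `x` and rationals `a`, `r`. -/
def RealRatDistLt (x : Set M.Num) (a r : M.Frac) : Prop :=
  ∃ (k : M.Num) (q : M.Frac), Term x k q ∧ q.DistLt a (r.sub (.invSucc k))

/-- `|x - a| ≤ r`, for a real `x` and rationals `a`, `r`. -/
def RealRatDistLe (x : Set M.Num) (a r : M.Frac) : Prop :=
  ∀ (k : M.Num) (q : M.Frac), Term x k q → q.DistLe a (r.add (.invSucc k))

/-- `|x - p| < r`, for reals `x`, `p`, `r`: `|x_k - p_k| < r_k - 3 / (k + 1)` for some `k`. -/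
def RealDistLt (x p r : Set M.Num) : Prop :=
  ∃ (k : M.Num) (q a s : M.Frac), Term x k q ∧ Term p k a ∧ Term r k s ∧
    q.DistLt a (((s.sub (.invSucc k)).sub (.invSucc k)).sub (.invSucc k))

/-! ### Continuous functions from `[0, 1]` to the reals -/

/-- The number coding the quintuple `(n, a, r, b, s)`. -/
def quint (n : M.Num) (a r b s : M.Frac) : M.Num :=
  pair n (pair a.code (pair r.code (pair b.code s.code)))

/-- `(a, r) Φ (b, s)`: the code `Φ` enumerates that the ball `B(a, r)` is mapped into the closed
ball of radius `s` around `b`. -/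
def CodeRel (Φ : Set M.Num) (a r b s : M.Frac) : Prop := ∃ n : M.Num, quint n a r b s ∈ Φ

/-- `Φ` is a code for a (partial) continuous function from `[0, 1]` to the reals. The dense sets
are the rationals of `[0, 1]` and the rationals. -/
structure IsContCode (Φ : Set M.Num) : Prop where
  subset : ∀ z ∈ Φ, ∃ (n : M.Num) (a r b s : M.Frac), z = quint n a r b s ∧
    a.InUnit ∧ Frac.zero.Lt r ∧ Frac.zero.Lt s
  consistent : ∀ a r b s b' s' : M.Frac, CodeRel Φ a r b s → CodeRel Φ a r b' s' →
    b.DistLe b' (s.add s')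
  mono_left : ∀ a r b s a' r' : M.Frac, CodeRel Φ a r b s → a'.InUnit → Frac.zero.Lt r' →
    a.DistLt a' (r.sub r') → CodeRel Φ a' r' b s
  mono_right : ∀ a r b s b' s' : M.Frac, CodeRel Φ a r b s → Frac.zero.Lt s' →
    b.DistLt b' (s'.sub s) → CodeRel Φ a r b' s'

/-- `x` is in the domain of the function coded by `Φ`. -/
def InDomain (Φ x : Set M.Num) : Prop :=
  ∀ ε : M.Frac, Frac.zero.Lt ε →
    ∃ a r b s : M.Frac, CodeRel Φ a r b s ∧ RealRatDistLt x a r ∧ s.Lt ε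

/-- The function coded by `Φ` is defined at `x` and has the real `y` as its value there. -/
def HasValue (Φ x y : Set M.Num) : Prop :=
  InDomain Φ x ∧ IsReal y ∧
    ∀ a r b s : M.Frac, CodeRel Φ a r b s → RealRatDistLt x a r → RealRatDistLe y b s

variable (M)

/-- `Φ` is a code in `M` for a continuous gauge: a continuous function that is defined and positive
at every real of `M` in `[0, 1]`. -/
def IsContGauge (Φ : Set M.Num) : Prop :=
  Φ ∈ M.sets ∧ IsContCode Φ ∧
    ∀ x ∈ M.sets, InUnitInterval x → ∃ y ∈ M.sets, HasValue Φ x y ∧ RealPos y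

/-- The finite families of reals `(P)_i`, `(R)_i`, `i < l` (the length `l` is a number of `M`), are
a `δ`-fine cover of `[0, 1]`, where `δ` is the function coded by `Φ`. -/
structure IsFineCover (Φ P R : Set M.Num) (l : M.Num) : Prop where
  mem_unit : ∀ i < l, InUnitInterval (row P i)
  radius : ∀ i < l, IsReal (row R i) ∧ RealPos (row R i)
  covers : ∀ x ∈ M.sets, InUnitInterval x → ∃ i < l, RealDistLt x (row P i) (row R i)
  fine : ∀ i < l, ∃ y ∈ M.sets, HasValue Φ (row P i) y ∧ RealLe (row R i) y

/-- Cousin's lemma for continuous functions on `[0, 1]`, as a sentence evaluated in `M`. -/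
def CousinContinuous : Prop :=
  ∀ Φ : Set M.Num, M.IsContGauge Φ → ∃ P ∈ M.sets, ∃ R ∈ M.sets, ∃ l : M.Num, M.IsFineCover Φ P R l

/-! ### Weak König's lemma -/

variable {M}

/-- `T` is a tree of finite binary strings. The string `σ` is coded by the positive number with
binary expansion `1σ`: the empty string by `1`, and the children `σ0`, `σ1` of the string coded by
`n` by `2n` and `2n + 1`. -/
def IsBinTree (T : Set M.Num) : Prop :=
  ∀ n ∈ T, n ≠ 0 ∧
    ∀ m : M.Num, m ≠ 0 → (n = (1 + 1) * m ∨ n = (1 + 1) * m + 1) → m ∈ T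

def IsInfinite (T : Set M.Num) : Prop := ∀ m : M.Num, ∃ n ∈ T, m < n

/-- `F` is the sequence of the initial segments of (the characteristic function of) `X`:
`F(k)` is the code of the binary string `X ↾ k`. -/
def IsInitSegSeq (X F : Set M.Num) : Prop :=
  IsFun F ∧ pair 0 1 ∈ F ∧ ∀ k n : M.Num, pair k n ∈ F →
    (k ∉ X → pair (k + 1) ((1 + 1) * n) ∈ F) ∧ (k ∈ X → pair (k + 1) ((1 + 1) * n + 1) ∈ F)

variable (M)

/-- `X` is a path through `T`: every initial segment of `X` is in `T`. -/
def IsPath (T X : Set M.Num) : Prop :=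
  ∃ F ∈ M.sets, IsInitSegSeq X F ∧ ∀ k n : M.Num, pair k n ∈ F → n ∈ T

/-- Weak König's lemma: every infinite binary tree has a path. -/
def WeakKoenig : Prop :=
  ∀ T ∈ M.sets, IsBinTree T → IsInfinite T → ∃ X ∈ M.sets, M.IsPath T X

/-- `M` is a model of `WKL₀`. -/
structure ModelsWKL0 : Prop where
  rca0 : M.ModelsRCA0
  weakKoenig : M.WeakKoenig

end L2Structure

/-! Suppose that `T` is an infinite binary tree of the model without a path. A node `n` of level `u
= 2 ^ k`, `u ≤ n < 2u`, stands for the dyadic interval `[n/u - 1, (n+1)/u - 1]`; let `K_u` be the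
union of the intervals of the nodes of `T` of level `u`. The sets `K_u` are nonempty and decrease as
`u` grows. The gauge is `δ(x) = sup_u min(1/u, d(x, K_u))`.

`δ` is 1-Lipschitz, and it is positive at `x` once `x` has positive distance from some `K_u`. This
happens at every real: a real close to every `K_u` would have a binary expansion that is a path, the
unique expansion if the real is not dyadic and one of the two expansions if it is
(`exists_not_near`). So `δ` is a continuous gauge (`isContGauge_gaugeCode`).

`δ` has no fine cover (`not_isFineCover_gaugeCode`). Given centres `p_i` and radii `r_i ≤ δ(p_i)`,
take a level `w` with `2/w < r_i` for all `i`, and let `x` be the left end point of the interval of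
a node of level `w`. Levels above `w` contribute less than `1/w` to `δ(p_i)`, and levels `v ≤ w`
contribute at most `d(p_i, K_v) ≤ |p_i - x|`. Hence `r_i ≤ δ(p_i) ≤ |p_i - x|` for every `i`, and
`x` is not covered (`radius_le_dist`).

The code of `δ` exists in the model because finite information decides its bounds: `δ(a) ≤ q`
follows from one level `u` with `1/(2u) ≤ q` and `d(a, K_u) ≤ q`, and `δ(a) > q` from one level `v`
with `1/v > q` and `d(a, K_v) > q`.

As the first-order part is arbitrary, arithmetic is developed inside the model. Definability is
tracked semantically by `Tm`, `Bdd` and `Sig`; numbers are embedded in an ordered field `RatField`,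
where inequalities between rationals are proved; and `2 ^ k` is defined through codes of finite sets
by divisibility, in the style of Gödel's beta function. -/

namespace NumTerm

/-! ### Renaming of variables in terms and formulas -/

/-- Rename the variables of a term. -/
def ren (g : ℕ → ℕ) : NumTerm → NumTerm
  | .var i => .var (g i)
  | .zero => .zero
  | .one => .one
  | .add s t => .add (ren g s) (ren g t)
  | .mul s t => .mul (ren g s) (ren g t)

end NumTerm

namespace BddFormula

/-- Lift a renaming of variables under a quantifier. -/
def liftRen (g : ℕ → ℕ) : ℕ → ℕ
  | 0 => 0
  | i + 1 => g i + 1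

/-- Rename the number variables and the set variables of a formula. -/
def ren (h : ℕ → ℕ) : (ℕ → ℕ) → BddFormula → BddFormula
  | g, .eq s t => .eq (s.ren g) (t.ren g)
  | g, .lt s t => .lt (s.ren g) (t.ren g)
  | g, .mem t j => .mem (t.ren g) (h j)
  | g, .neg φ => .neg (ren h g φ)
  | g, .and φ ψ => .and (ren h g φ) (ren h g ψ)
  | g, .ball t φ => .ball (t.ren g) (ren h (liftRen g) φ)

end BddFormula

/-- Interleave two assignments. -/
def interleave {α : Type u} (e p : ℕ → α) (i : ℕ) : α :=
  if i % 2 = 0 then e (i / 2) else p (i / 2)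

@[simp] theorem interleave_even {α : Type u} (e p : ℕ → α) (i : ℕ) :
    interleave e p (2 * i) = e i := by
  simp [interleave]

@[simp] theorem interleave_odd {α : Type u} (e p : ℕ → α) (i : ℕ) :
    interleave e p (2 * i + 1) = p i := by
  have h : (2 * i + 1) / 2 = i := by omega
  simp [interleave, Nat.add_mod, h]

namespace L2Structure

variable {M : L2Structure.{u}}

theorem termVal_ren (g : ℕ → ℕ) (e : ℕ → M.Num) (t : NumTerm) :
    M.termVal e (t.ren g) = M.termVal (fun i => e (g i)) t := by
  induction t with
  | var i => rfl
  | zero => rfl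
  | one => rfl
  | add s t hs ht => simp only [NumTerm.ren, termVal, hs, ht]
  | mul s t hs ht => simp only [NumTerm.ren, termVal, hs, ht]

theorem pushVal_liftRen (g : ℕ → ℕ) (a : M.Num) (e : ℕ → M.Num) :
    (fun i => pushVal a e (BddFormula.liftRen g i)) = pushVal a (fun i => e (g i)) := by
  funext i
  cases i <;> rfl

theorem holds_ren (E : ℕ → Set M.Num) (h : ℕ → ℕ) (φ : BddFormula) :
    ∀ (g : ℕ → ℕ) (e : ℕ → M.Num),
      M.Holds E e (φ.ren h g) ↔ M.Holds (fun j => E (h j)) (fun i => e (g i)) φ := by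
  induction φ with
  | eq s t => intro g e; simp only [BddFormula.ren, Holds, termVal_ren]
  | lt s t => intro g e; simp only [BddFormula.ren, Holds, termVal_ren]
  | mem t j => intro g e; simp only [BddFormula.ren, Holds, termVal_ren]
  | neg φ ih => intro g e; simp only [BddFormula.ren, Holds, ih]
  | and φ ψ ih₁ ih₂ => intro g e; simp only [BddFormula.ren, Holds, ih₁, ih₂]
  | ball t φ ih =>
    intro g e
    simp only [BddFormula.ren, Holds, termVal_ren, ih, pushVal_liftRen]

/-! ### Semantic definability -/

variable (M) in
/-- Assignments of numbers to the number variables. -/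
abbrev Env := ℕ → M.Num

/-- Functions of the assignment that are given by a term with parameters. -/
class inductive Tm : (M.Env → M.Num) → Prop
  | var (i : ℕ) : Tm fun e => e i
  | const (c : M.Num) : Tm fun _ => c
  | add (f g : M.Env → M.Num) (hf : Tm f) (hg : Tm g) : Tm fun e => f e + g e
  | mul (f g : M.Env → M.Num) (hf : Tm f) (hg : Tm g) : Tm fun e => f e * g e

/-- The set `X` belongs to the second-order part of `M`. -/
class InSets (X : Set M.Num) : Prop where
  mem : X ∈ M.sets

/-- Predicates of the assignment that are given by a bounded formula with parameters. -/
class inductive Bdd : (M.Env → Prop) → Prop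
  | eq (f g : M.Env → M.Num) (hf : Tm f) (hg : Tm g) : Bdd fun e => f e = g e
  | lt (f g : M.Env → M.Num) (hf : Tm f) (hg : Tm g) : Bdd fun e => f e < g e
  | mem (f : M.Env → M.Num) (X : Set M.Num) (hf : Tm f) (hX : X ∈ M.sets) : Bdd fun e => f e ∈ X
  | not (P : M.Env → Prop) (hP : Bdd P) : Bdd fun e => ¬ P e
  | and (P Q : M.Env → Prop) (hP : Bdd P) (hQ : Bdd Q) : Bdd fun e => P e ∧ Q e
  | ball (f : M.Env → M.Num) (P : M.Num → M.Env → Prop) (hf : Tm f)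
      (hP : Bdd fun e => P (e 0) fun i => e (i + 1)) : Bdd fun e => ∀ a, a < f e → P a e

-- Definability is left to instance search: once a predicate is displayed as a formula,
-- `inferInstance` shows that it is bounded or `Σ⁰₁`.
attribute [instance] Tm.var Tm.const

section

variable (f g : M.Env → M.Num) [hf : Tm f] [hg : Tm g] (P Q : M.Env → Prop) [hP : Bdd P]
  [hQ : Bdd Q]

instance Tm.instAdd : Tm fun e => f e + g e := Tm.add f g hf hg

instance Tm.instMul : Tm fun e => f e * g e := Tm.mul f g hf hg

instance Bdd.instEq : Bdd fun e => f e = g e := Bdd.eq f g hf hg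

instance Bdd.instLt : Bdd fun e => f e < g e := Bdd.lt f g hf hg

instance Bdd.instNot : Bdd fun e => ¬ P e := Bdd.not P hP

instance Bdd.instAnd : Bdd fun e => P e ∧ Q e := Bdd.and P Q hP hQ

instance Bdd.instBall (R : M.Num → M.Env → Prop) [hR : Bdd fun e => R (e 0) fun i => e (i + 1)] :
    Bdd fun e => ∀ a, a < f e → R a e :=
  Bdd.ball f R hf hR

end

instance Tm.zero : Tm fun _ : M.Env => (0 : M.Num) := Tm.const 0

instance Tm.one : Tm fun _ : M.Env => (1 : M.Num) := Tm.const 1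

instance Bdd.instMem (f : M.Env → M.Num) (X : Set M.Num) [hf : Tm f] [hX : InSets X] :
    Bdd fun e => f e ∈ X :=
  Bdd.mem f X hf hX.mem

/-! Merging of parameters. -/

/-- In `interleave e (interleave p q)` the variables keep their even indices, while `p j` has index
`2 * (2 * j) + 1` and `q j` has index `2 * (2 * j + 1) + 1`. -/
def renLeft (i : ℕ) : ℕ := if i % 2 = 0 then i else 2 * (2 * (i / 2)) + 1

def renRight (i : ℕ) : ℕ := if i % 2 = 0 then i else 2 * (2 * (i / 2) + 1) + 1

theorem interleave_renLeft {α : Type u} (e p q : ℕ → α) :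
    (fun i => interleave e (interleave p q) (renLeft i)) = interleave e p := by
  funext i
  by_cases hi : i % 2 = 0
  · simp [renLeft, hi, interleave]
  · rw [renLeft, if_neg hi, interleave_odd, interleave_even]
    simp [interleave, hi]

theorem interleave_renRight {α : Type u} (e p q : ℕ → α) :
    (fun i => interleave e (interleave p q) (renRight i)) = interleave e q := by
  funext i
  by_cases hi : i % 2 = 0
  · simp [renRight, hi, interleave]
  · rw [renRight, if_neg hi, interleave_odd, interleave_odd]
    simp [interleave, hi]

/-- Exchange the order of interleaving and pushing a value. -/
def renPush (i : ℕ) : ℕ := if i = 0 then 0 else if i % 2 = 0 then i - 1 else i + 1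

theorem pushVal_renPush {α : Type u} (a : α) (e p : ℕ → α) :
    (fun i => pushVal a (interleave e p) (renPush i)) = interleave (pushVal a e) p := by
  funext i
  rcases Nat.even_or_odd' i with ⟨j, rfl | rfl⟩
  · cases j with
    | zero => rfl
    | succ j =>
      have h : renPush (2 * (j + 1)) = 2 * j + 1 := by
        simp only [renPush]
        rw [if_neg (by omega), if_pos (by omega)]
        omega
      rw [h, interleave_even]
      exact interleave_even e p j
  · have h : renPush (2 * j + 1) = (2 * j + 1) + 1 := by
      simp only [renPush]
      rw [if_neg (by omega), if_neg (by omega)]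
    rw [h, interleave_odd]
    exact interleave_odd e p j

theorem Tm.exists_term {f : M.Env → M.Num} (hf : Tm f) :
    ∃ (t : NumTerm) (p : M.Env), ∀ e : M.Env, M.termVal (interleave e p) t = f e := by
  induction hf with
  | var i => exact ⟨.var (2 * i), fun _ => 0, fun e => by simp [termVal]⟩
  | const c => exact ⟨.var 1, fun _ => c, fun e => by simp [termVal, interleave]⟩
  | add f g _ _ hf hg =>
    obtain ⟨s, p, hs⟩ := hf
    obtain ⟨t, q, ht⟩ := hg
    refine ⟨.add (s.ren renLeft) (t.ren renRight), interleave p q, fun e => ?_⟩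
    simp only [termVal, termVal_ren, interleave_renLeft, interleave_renRight, hs, ht]
  | mul f g _ _ hf hg =>
    obtain ⟨s, p, hs⟩ := hf
    obtain ⟨t, q, ht⟩ := hg
    refine ⟨.mul (s.ren renLeft) (t.ren renRight), interleave p q, fun e => ?_⟩
    simp only [termVal, termVal_ren, interleave_renLeft, interleave_renRight, hs, ht]

/-- Variables sit at even indices and parameters at odd ones, so subformulas with different
parameters are combined by interleaving the two parameter lists. -/
theorem Bdd.exists_formula {P : M.Env → Prop} (hP : Bdd P) :
    ∃ (θ : BddFormula) (p : M.Env) (E : ℕ → Set M.Num), (∀ j, E j ∈ M.sets) ∧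
      ∀ e : M.Env, M.Holds E (interleave e p) θ ↔ P e := by
  obtain ⟨X₀, hX₀⟩ := M.sets_nonempty
  induction hP with
  | eq f g hf hg =>
    obtain ⟨s, p, hs⟩ := hf.exists_term
    obtain ⟨t, q, ht⟩ := hg.exists_term
    refine ⟨.eq (s.ren renLeft) (t.ren renRight), interleave p q, fun _ => X₀, fun _ => hX₀,
      fun e => ?_⟩
    simp only [Holds, termVal_ren, interleave_renLeft, interleave_renRight, hs, ht]
  | lt f g hf hg =>
    obtain ⟨s, p, hs⟩ := hf.exists_term
    obtain ⟨t, q, ht⟩ := hg.exists_term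
    refine ⟨.lt (s.ren renLeft) (t.ren renRight), interleave p q, fun _ => X₀, fun _ => hX₀,
      fun e => ?_⟩
    simp only [Holds, termVal_ren, interleave_renLeft, interleave_renRight, hs, ht]
  | mem f X hf hX =>
    obtain ⟨s, p, hs⟩ := hf.exists_term
    refine ⟨.mem s 0, p, fun _ => X, fun _ => hX, fun e => ?_⟩
    simp only [Holds, hs]
  | not P _ ih =>
    obtain ⟨θ, p, E, hE, h⟩ := ih
    exact ⟨.neg θ, p, E, hE, fun e => not_congr (h e)⟩
  | and P Q _ _ ihP ihQ =>
    obtain ⟨θ, p, E, hE, hθ⟩ := ihP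
    obtain ⟨η, q, F, hF, hη⟩ := ihQ
    refine ⟨.and (θ.ren (fun j => 2 * j) renLeft) (η.ren (fun j => 2 * j + 1) renRight),
      interleave p q, interleave E F, fun j => ?_, fun e => ?_⟩
    · unfold interleave
      split_ifs
      exacts [hE _, hF _]
    · simp only [Holds, holds_ren, interleave_renLeft, interleave_renRight, interleave_even,
        interleave_odd]
      exact and_congr (hθ e) (hη e)
  | ball f P hf _ ih =>
    obtain ⟨s, p, hs⟩ := hf.exists_term
    obtain ⟨θ, q, E, hE, hθ⟩ := ih
    -- The quantifier pushes its value in front of the interleaved list, whereas `θ` expects it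
    -- among the variables; `renPush` corrects this before the parameters are merged.
    refine ⟨.ball (s.ren renLeft) ((θ.ren id renPush).ren id (BddFormula.liftRen renRight)),
      interleave p q, E, hE, fun e => ?_⟩
    simp only [Holds, holds_ren, termVal_ren, interleave_renLeft, hs]
    refine forall₂_congr fun a _ => ?_
    refine Iff.trans ?_ (hθ (pushVal a e))
    have h : (fun i => pushVal a (interleave e (interleave p q))
        (BddFormula.liftRen renRight (renPush i))) = interleave (pushVal a e) q := by
      rw [← pushVal_renPush]
      funext i
      have := congrFun (pushVal_liftRen renRight a (interleave e (interleave p q))) (renPush i)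
      rwa [interleave_renRight] at this
    rw [h]
    exact Iff.rfl

/-! ### Closure properties -/

theorem Bdd.congr {P Q : M.Env → Prop} (hP : Bdd P) (h : ∀ e, P e ↔ Q e) : Bdd Q := by
  have : P = Q := funext fun e => propext (h e)
  exact this ▸ hP

theorem Tm.subst {f : M.Env → M.Num} (hf : Tm f) (σ : M.Env → M.Env)
    (hσ : ∀ i, Tm fun e => σ e i) : Tm fun e => f (σ e) := by
  induction hf with
  | var i => exact hσ i
  | const c => exact Tm.const c
  | add f g _ _ hf hg => exact Tm.add _ _ hf hg
  | mul f g _ _ hf hg => exact Tm.mul _ _ hf hg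

theorem Tm.shift {f : M.Env → M.Num} (hf : Tm f) : Tm fun e => f fun i => e (i + 1) :=
  hf.subst (fun e i => e (i + 1)) fun i => Tm.var (i + 1)

theorem Bdd.subst {P : M.Env → Prop} (hP : Bdd P) :
    ∀ (σ : M.Env → M.Env), (∀ i, Tm fun e => σ e i) → Bdd fun e => P (σ e) := by
  induction hP with
  | eq f g hf hg => exact fun σ hσ => Bdd.eq _ _ (hf.subst σ hσ) (hg.subst σ hσ)
  | lt f g hf hg => exact fun σ hσ => Bdd.lt _ _ (hf.subst σ hσ) (hg.subst σ hσ)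
  | mem f X hf hX => exact fun σ hσ => Bdd.mem _ X (hf.subst σ hσ) hX
  | not P _ ih => exact fun σ hσ => Bdd.not _ (ih σ hσ)
  | and P Q _ _ ihP ihQ => exact fun σ hσ => Bdd.and _ _ (ihP σ hσ) (ihQ σ hσ)
  | ball f P hf _ ih =>
    intro σ hσ
    refine Bdd.ball _ (fun a e => P a (σ e)) (hf.subst σ hσ) ?_
    refine ih (fun e => pushVal (e 0) (σ fun i => e (i + 1))) fun i => ?_
    cases i with
    | zero => exact Tm.var 0
    | succ i => exact (hσ i).shift

theorem Bdd.shift {P : M.Env → Prop} (hP : Bdd P) : Bdd fun e => P fun i => e (i + 1) :=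
  hP.subst (fun e i => e (i + 1)) fun i => Tm.var (i + 1)

theorem Tm.pushVal {f : M.Env → M.Num} {σ : M.Env → M.Env} (hf : Tm f)
    (hσ : ∀ i, Tm fun e => σ e i) (i : ℕ) : Tm fun e => pushVal (f e) (σ e) i := by
  cases i with
  | zero => exact hf
  | succ i => exact hσ i

instance Bdd.or (P Q : M.Env → Prop) [hP : Bdd P] [hQ : Bdd Q] : Bdd fun e => P e ∨ Q e :=
  (inferInstance : Bdd fun e => ¬ (¬ P e ∧ ¬ Q e)).congr fun e => by tauto

instance Bdd.imp (P Q : M.Env → Prop) [hP : Bdd P] [hQ : Bdd Q] : Bdd fun e => P e → Q e :=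
  (inferInstance : Bdd fun e => ¬ (P e ∧ ¬ Q e)).congr fun e => by tauto

instance Bdd.bex (f : M.Env → M.Num) (P : M.Num → M.Env → Prop) [hf : Tm f]
    [hP : Bdd fun e => P (e 0) fun i => e (i + 1)] : Bdd fun e => ∃ a, a < f e ∧ P a e :=
  (inferInstance : Bdd fun e => ¬ ∀ a, a < f e → ¬ P a e).congr fun e => by push Not; rfl

instance Bdd.const (p : Prop) : Bdd fun _ : M.Env => p := by
  by_cases hp : p
  · exact (inferInstance : Bdd fun _ : M.Env => (0 : M.Num) = 0).congr fun e => by simp [hp]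
  · exact (inferInstance : Bdd fun _ : M.Env => ¬ (0 : M.Num) = 0).congr fun e => by simp [hp]

/-- Predicates of the assignment that are given by a `Σ⁰₁` formula with parameters. -/
class Sig (P : M.Env → Prop) : Prop where
  exists_bdd : ∃ Q : M.Num → M.Env → Prop, (Bdd fun e => Q (e 0) fun i => e (i + 1)) ∧
    ∀ e, P e ↔ ∃ m, Q m e

theorem Sig.congr {P Q : M.Env → Prop} (hP : Sig P) (h : ∀ e, P e ↔ Q e) : Sig Q := by
  have : P = Q := funext fun e => propext (h e)
  exact this ▸ hP

instance (priority := 50) Sig.of_bdd (P : M.Env → Prop) [hP : Bdd P] : Sig P :=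
  ⟨fun _ e => P e, hP.shift, fun e => by simp⟩

theorem Sig.subst {P : M.Env → Prop} (hP : Sig P) (σ : M.Env → M.Env)
    (hσ : ∀ i, Tm fun e => σ e i) : Sig fun e => P (σ e) := by
  obtain ⟨Q, hQ, h⟩ := hP
  refine ⟨fun m e => Q m (σ e), ?_, fun e => h (σ e)⟩
  exact hQ.subst (fun e => _root_.pushVal (e 0) (σ fun i => e (i + 1)))
    fun i => Tm.pushVal (Tm.var 0) (fun j => (hσ j).shift) i

theorem Bdd.comp₁ {R : M.Num → Prop} (hR : Bdd fun e : M.Env => R (e 0)) (f : M.Env → M.Num)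
    [hf : Tm f] : Bdd fun e => R (f e) :=
  hR.subst (fun e => pushVal (f e) e) (Tm.pushVal hf Tm.var)

theorem Bdd.comp₂ {R : M.Num → M.Num → Prop} (hR : Bdd fun e : M.Env => R (e 0) (e 1))
    (f g : M.Env → M.Num) [hf : Tm f] [hg : Tm g] : Bdd fun e => R (f e) (g e) :=
  hR.subst (fun e => pushVal (f e) (pushVal (g e) e)) (Tm.pushVal hf (Tm.pushVal hg Tm.var))

theorem Bdd.comp₃ {R : M.Num → M.Num → M.Num → Prop}
    (hR : Bdd fun e : M.Env => R (e 0) (e 1) (e 2))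
    (f g h : M.Env → M.Num) [hf : Tm f] [hg : Tm g] [hh : Tm h] :
    Bdd fun e => R (f e) (g e) (h e) :=
  hR.subst (fun e => pushVal (f e) (pushVal (g e) (pushVal (h e) e)))
    (Tm.pushVal hf (Tm.pushVal hg (Tm.pushVal hh Tm.var)))

theorem Sig.comp₂ {R : M.Num → M.Num → Prop} (hR : Sig fun e : M.Env => R (e 0) (e 1))
    (f g : M.Env → M.Num) [hf : Tm f] [hg : Tm g] : Sig fun e => R (f e) (g e) :=
  hR.subst (fun e => pushVal (f e) (pushVal (g e) e)) (Tm.pushVal hf (Tm.pushVal hg Tm.var))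

/-- A curried presentation of a `Σ⁰₁` predicate with a bounded matrix. -/
theorem Sig.exists_matrix (P : M.Num → M.Env → Prop)
    (hP : Sig fun e => P (e 0) fun i => e (i + 1)) :
    ∃ Q : M.Num → M.Num → M.Env → Prop,
      (Bdd fun e => Q (e 0) (e 1) fun i => e (i + 2)) ∧ ∀ a e, P a e ↔ ∃ m, Q m a e := by
  obtain ⟨Q, hQ, h⟩ := hP
  exact ⟨fun m a e => Q m (pushVal a e), hQ.congr fun e => by
    refine iff_of_eq (congrArg (Q (e 0)) ?_)
    funext i
    cases i <;> rfl, fun a e => h (pushVal a e)⟩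

/-- Turn parameters interleaved with a constant assignment into parameters that follow two number
variables. -/
def renParam (i : ℕ) : ℕ := if i = 0 then 0 else if i % 2 = 0 then 1 else i / 2 + 2

theorem pushVal_renParam {α : Type u} (m n : α) (p : ℕ → α) :
    (fun i => pushVal m (pushVal n p) (renParam i)) = interleave (pushVal m fun _ => n) p := by
  funext i
  rcases Nat.even_or_odd' i with ⟨j, rfl | rfl⟩
  · rw [interleave_even]
    cases j with
    | zero => rfl
    | succ j =>
      have h : renParam (2 * (j + 1)) = 1 := by
        simp only [renParam]
        rw [if_neg (by omega), if_pos (by omega)]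
      rw [h]
      rfl
  · have h : renParam (2 * j + 1) = j + 2 := by
      simp only [renParam]
      rw [if_neg (by omega), if_neg (by omega)]
      omega
    rw [h, interleave_odd]
    rfl

theorem Sig.exists_holdsSigma {P : M.Num → Prop} (hP : Sig fun e : M.Env => P (e 0)) :
    ∃ (θ : BddFormula) (p : M.Env) (E : ℕ → Set M.Num), (∀ j, E j ∈ M.sets) ∧
      ∀ n, M.HoldsSigma E p θ n ↔ P n := by
  obtain ⟨Q, hQ, h⟩ := hP
  obtain ⟨θ, p, E, hE, hθ⟩ := hQ.exists_formula
  refine ⟨θ.ren id renParam, p, E, hE, fun n => Iff.trans ?_ (h fun _ => n).symm⟩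
  refine exists_congr fun m => ?_
  rw [holds_ren, pushVal_renParam]
  exact hθ (pushVal m fun _ => n)

/-! ### Induction and comprehension for semantically definable predicates -/

theorem sig_induction (hM : M.ModelsRCA0) {P : M.Num → Prop} (hP : Sig fun e : M.Env => P (e 0))
    (h0 : P 0) (hs : ∀ n, P n → P (n + 1)) (n : M.Num) : P n := by
  obtain ⟨θ, p, E, hE, h⟩ := hP.exists_holdsSigma
  exact (h n).1 (hM.induction θ p E hE ((h 0).2 h0) (fun n hn => (h _).2 (hs n ((h n).1 hn))) n)

/-- The negated matrix of a `Σ⁰₁` definition of the complement gives the `Π⁰₁` definition. The axiom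
allows only one list of parameters for both formulas, so the two lists are interleaved. -/
theorem exists_set (hM : M.ModelsRCA0) {P : M.Num → Prop} (hP : Sig fun e : M.Env => P (e 0))
    (hP' : Sig fun e : M.Env => ¬ P (e 0)) : ∃ X ∈ M.sets, ∀ n, n ∈ X ↔ P n := by
  obtain ⟨θ, p, E, hE, hθ⟩ := hP.exists_holdsSigma
  obtain ⟨η, q, F, hF, hη⟩ := Sig.exists_holdsSigma (P := fun n => ¬ P n) hP'
  have hl : ∀ m n : M.Num, (fun i => pushVal m (pushVal n (interleave p q))
      (BddFormula.liftRen (BddFormula.liftRen fun i => 2 * i) i)) = pushVal m (pushVal n p) := by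
    intro m n
    simp only [pushVal_liftRen, interleave_even]
  have hr : ∀ m n : M.Num, (fun i => pushVal m (pushVal n (interleave p q))
      (BddFormula.liftRen (BddFormula.liftRen fun i => 2 * i + 1) i)) =
        pushVal m (pushVal n q) := by
    intro m n
    simp only [pushVal_liftRen, interleave_odd]
  have hEF : ∀ j, interleave E F j ∈ M.sets := by
    intro j
    unfold interleave
    split_ifs
    exacts [hE _, hF _]
  have hθη : ∀ n, M.HoldsSigma (interleave E F) (interleave p q)
      (θ.ren (fun j => 2 * j) (BddFormula.liftRen (BddFormula.liftRen fun i => 2 * i))) n ↔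
      M.HoldsSigma E p θ n := by
    intro n
    refine exists_congr fun m => ?_
    simp only [holds_ren, hl, interleave_even]
  obtain ⟨X, hX, h⟩ := hM.comprehension _
    (.neg (η.ren (fun j => 2 * j + 1) (BddFormula.liftRen (BddFormula.liftRen fun i => 2 * i + 1))))
    (interleave p q) (interleave E F) hEF fun n => by
      have h₂ := hη n
      rw [hθη, hθ]
      simp only [HoldsSigma, HoldsPi, Holds, holds_ren, hr, interleave_odd] at h₂ ⊢
      rw [← not_exists, h₂, not_not]
  exact ⟨X, hX, fun n => by rw [h, hθη, hθ]⟩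

end L2Structure

namespace L2Structure

/-! ### Arithmetic in a model of `RCA₀` -/

section

variable {M : L2Structure.{u}} [hM : Fact M.ModelsRCA0]

theorem num_induction {P : M.Num → Prop} [hP : Sig fun e : M.Env => P (e 0)]
    (h0 : P 0) (hs : ∀ n, P n → P (n + 1)) (n : M.Num) : P n :=
  sig_induction hM.out hP h0 hs n

namespace Arith

theorem add_zero (a : M.Num) : a + 0 = a := hM.out.basic.add_zero a

theorem add_succ (a b : M.Num) : a + (b + 1) = a + b + 1 := hM.out.basic.add_succ a b

theorem mul_zero (a : M.Num) : a * 0 = 0 := hM.out.basic.mul_zero a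

theorem mul_succ (a b : M.Num) : a * (b + 1) = a * b + a := hM.out.basic.mul_succ a b

theorem zero_add (a : M.Num) : 0 + a = a :=
  num_induction (P := fun a => 0 + a = a) (add_zero 0) (fun n h => by rw [add_succ, h]) a

theorem add_assoc (a b c : M.Num) : a + b + c = a + (b + c) :=
  num_induction (P := fun c => a + b + c = a + (b + c)) (by rw [add_zero, add_zero])
    (fun n h => by rw [add_succ, h, add_succ, add_succ]) c

theorem succ_add (a b : M.Num) : a + 1 + b = a + b + 1 :=
  num_induction (P := fun b => a + 1 + b = a + b + 1) (by rw [add_zero, add_zero])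
    (fun n h => by rw [add_succ, h, add_succ]) b

theorem add_comm (a b : M.Num) : a + b = b + a :=
  num_induction (P := fun b => a + b = b + a) (by rw [add_zero, zero_add])
    (fun n h => by rw [add_succ, h, succ_add]) b

theorem mul_add (a b c : M.Num) : a * (b + c) = a * b + a * c :=
  num_induction (P := fun c => a * (b + c) = a * b + a * c) (by rw [add_zero, mul_zero, add_zero])
    (fun n h => by rw [add_succ, mul_succ, h, mul_succ, add_assoc]) c

theorem mul_assoc (a b c : M.Num) : a * b * c = a * (b * c) :=
  num_induction (P := fun c => a * b * c = a * (b * c)) (by rw [mul_zero, mul_zero, mul_zero])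
    (fun n h => by rw [mul_succ, h, mul_succ, mul_add]) c

theorem zero_mul (a : M.Num) : 0 * a = 0 :=
  num_induction (P := fun a => 0 * a = 0) (mul_zero 0)
    (fun n h => by rw [mul_succ, h, add_zero]) a

theorem succ_mul (a b : M.Num) : (a + 1) * b = a * b + b :=
  num_induction (P := fun b => (a + 1) * b = a * b + b) (by rw [mul_zero, mul_zero, add_zero])
    (fun n h => by
      rw [mul_succ, h, mul_succ, add_assoc, add_assoc, add_succ n a, add_succ, add_comm n a,
        add_succ a n, add_succ (a * n)]) b

theorem mul_comm (a b : M.Num) : a * b = b * a :=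
  num_induction (P := fun b => a * b = b * a) (by rw [mul_zero, zero_mul])
    (fun n h => by rw [mul_succ, h, succ_mul]) b

theorem mul_one (a : M.Num) : a * 1 = a := by
  rw [← zero_add 1, mul_succ, mul_zero, zero_add]

theorem add_right_cancel (a b c : M.Num) (h : a + c = b + c) : a = b :=
  num_induction (P := fun c => a + c = b + c → a = b)
    (by rw [add_zero, add_zero]; exact id)
    (fun n ih h => ih (hM.out.basic.succ_inj _ _ (by rwa [add_succ, add_succ] at h))) c h

theorem not_lt_zero (a : M.Num) : ¬ a < 0 := hM.out.basic.not_lt_zero a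

theorem lt_succ (a b : M.Num) : a < b + 1 ↔ a < b ∨ a = b := hM.out.basic.lt_succ a b

/-- A single unbounded quantifier suffices until the order is available; contracting several
quantifiers needs a common bound. -/
instance sig_exists_bdd (P : M.Num → M.Env → Prop) [hP : Bdd fun e => P (e 0) fun i => e (i + 1)] :
    Sig fun e => ∃ a, P a e :=
  ⟨P, hP, fun _ => Iff.rfl⟩

theorem exists_of_lt (a b : M.Num) (h : a < b) : ∃ c, a + (c + 1) = b := by
  -- The hypothesis is moved under the quantifier to make the induction formula `Σ⁰₁`.
  have key : ∃ c, a < b → a + (c + 1) = b := by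
    refine num_induction (P := fun b => ∃ c, a < b → a + (c + 1) = b) ?_ ?_ b
    · exact ⟨0, fun h => (not_lt_zero _ h).elim⟩
    · rintro n ⟨c, hc⟩
      by_cases h : a < n
      · exact ⟨c + 1, fun _ => by rw [add_succ, hc h]⟩
      · refine ⟨0, fun h' => ?_⟩
        rw [add_succ, add_zero, ((lt_succ _ _).1 h').resolve_left h]
  exact key.imp fun c hc => hc h

theorem lt_add_succ (a c : M.Num) : a < a + (c + 1) :=
  num_induction (P := fun c => a < a + (c + 1))
    (by rw [add_succ, add_zero, lt_succ]; exact Or.inr rfl)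
    (fun n h => by rw [add_succ, lt_succ]; exact Or.inl h) c

theorem eq_zero_or_succ (a : M.Num) : a = 0 ∨ ∃ b, a = b + 1 := by
  have key : ∃ b, a = 0 ∨ a = b + 1 :=
    num_induction (P := fun a => ∃ b, a = 0 ∨ a = b + 1) ⟨0, Or.inl rfl⟩
      (fun n _ => ⟨n, Or.inr rfl⟩) a
  obtain ⟨b, h | h⟩ := key
  exacts [Or.inl h, Or.inr ⟨b, h⟩]

theorem lt_trichotomy (a b : M.Num) : a < b ∨ a = b ∨ b < a := by
  refine num_induction (P := fun b => a < b ∨ a = b ∨ b < a) ?_ ?_ b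
  · rcases eq_zero_or_succ a with h | ⟨c, rfl⟩
    · exact Or.inr (Or.inl h)
    · refine Or.inr (Or.inr ?_)
      have := lt_add_succ 0 c
      rwa [zero_add] at this
  · rintro n (h | rfl | h)
    · exact Or.inl ((lt_succ _ _).2 (Or.inl h))
    · exact Or.inl ((lt_succ _ _).2 (Or.inr rfl))
    · obtain ⟨c, rfl⟩ := exists_of_lt _ _ h
      rcases eq_zero_or_succ c with rfl | ⟨d, rfl⟩
      · exact Or.inr (Or.inl (by rw [zero_add]))
      · refine Or.inr (Or.inr ?_)
        have := lt_add_succ (n + 1) d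
        rwa [add_assoc, add_comm 1] at this

theorem lt_irrefl (a : M.Num) : ¬ a < a := by
  intro h
  obtain ⟨c, hc⟩ := exists_of_lt _ _ h
  refine hM.out.basic.succ_ne_zero c (add_right_cancel _ _ a ?_)
  rw [add_comm, hc, zero_add]

theorem lt_trans (a b c : M.Num) (h : a < b) (h' : b < c) : a < c := by
  obtain ⟨d, rfl⟩ := exists_of_lt _ _ h
  obtain ⟨d', rfl⟩ := exists_of_lt _ _ h'
  rw [add_assoc, add_succ]
  exact lt_add_succ _ _

end Arith

/-! ### The numbers of the model as an ordered commutative semiring -/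

open Arith in
noncomputable instance : CommSemiring M.Num where
  add_assoc := add_assoc
  zero_add := zero_add
  add_zero := add_zero
  add_comm := add_comm
  left_distrib := mul_add
  right_distrib a b c := by
    rw [Arith.mul_comm, Arith.mul_add, Arith.mul_comm c, Arith.mul_comm c]
  zero_mul := zero_mul
  mul_zero := mul_zero
  mul_assoc := mul_assoc
  one_mul a := by rw [Arith.mul_comm, Arith.mul_one]
  mul_one := mul_one
  mul_comm := mul_comm
  nsmul := nsmulRec
  npow n a := npowRec n a
  natCast := Nat.unaryCast

open Arith in
open scoped Classical in
noncomputable instance : LinearOrder M.Num where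
  le a b := a < b ∨ a = b
  lt := (· < ·)
  le_refl a := Or.inr rfl
  le_trans a b c := by
    rintro (h | rfl) (h' | rfl)
    exacts [Or.inl (lt_trans _ _ _ h h'), Or.inl h, Or.inl h', Or.inr rfl]
  lt_iff_le_not_ge a b := by
    constructor
    · refine fun h => ⟨Or.inl h, ?_⟩
      rintro (h' | rfl)
      exacts [lt_irrefl _ (lt_trans _ _ _ h h'), lt_irrefl _ h]
    · rintro ⟨h | rfl, h'⟩
      exacts [h, (h' (Or.inr rfl)).elim]
  le_antisymm a b := by
    rintro (h | rfl) (h' | h')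
    exacts [(lt_irrefl _ (lt_trans _ _ _ h h')).elim, h'.symm, rfl, rfl]
  le_total a b := by
    rcases lt_trichotomy a b with h | h | h
    exacts [Or.inl (Or.inl h), Or.inl (Or.inr h), Or.inr (Or.inl h)]
  toDecidableLE := inferInstance

theorem Num.lt_iff_exists {a b : M.Num} : a < b ↔ ∃ c, b = a + (c + 1) :=
  ⟨fun h => (Arith.exists_of_lt a b h).imp fun _ h => h.symm,
    fun ⟨c, h⟩ => h ▸ Arith.lt_add_succ a c⟩

theorem Num.lt_add_one_iff {a b : M.Num} : a < b + 1 ↔ a ≤ b := Arith.lt_succ a b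

theorem Num.add_one_le_iff {a b : M.Num} : a + 1 ≤ b ↔ a < b := by
  rw [← not_lt, Num.lt_add_one_iff, not_le]

theorem Num.zero_le (a : M.Num) : 0 ≤ a := not_lt.1 (Arith.not_lt_zero a)

instance : Nontrivial M.Num := ⟨0 + 1, 0, hM.out.basic.succ_ne_zero 0⟩

instance : IsOrderedCancelAddMonoid M.Num where
  add_le_add_left a b h c := by
    rcases h.eq_or_lt with rfl | h
    · exact le_rfl
    · obtain ⟨d, rfl⟩ := Num.lt_iff_exists.1 h
      exact (Num.lt_iff_exists.2 ⟨d, by ring⟩).le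
  le_of_add_le_add_left a b c h := by
    by_contra! h'
    obtain ⟨d, rfl⟩ := Num.lt_iff_exists.1 h'
    exact not_lt.2 h (Num.lt_iff_exists.2 ⟨d, by ring⟩)

instance : IsStrictOrderedRing M.Num where
  zero_le_one := Num.zero_le 1
  mul_lt_mul_of_pos_left a ha b c h := by
    obtain ⟨d, rfl⟩ := Num.lt_iff_exists.1 ha
    obtain ⟨d', rfl⟩ := Num.lt_iff_exists.1 h
    exact Num.lt_iff_exists.2 ⟨d * d' + d + d', by ring⟩
  mul_lt_mul_of_pos_right a ha b c h := by
    obtain ⟨d, rfl⟩ := Num.lt_iff_exists.1 ha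
    obtain ⟨d', rfl⟩ := Num.lt_iff_exists.1 h
    exact Num.lt_iff_exists.2 ⟨d * d' + d + d', by ring⟩

instance : CanonicallyOrderedAdd M.Num where
  exists_add_of_le {a b} h := by
    rcases h.eq_or_lt with rfl | h
    · exact ⟨0, by ring⟩
    · exact (Num.lt_iff_exists.1 h).imp' (· + 1) fun _ h => h
  le_add_self a b := by
    rw [add_comm]
    exact le_add_of_nonneg_right (Num.zero_le _)
  le_self_add a b := le_add_of_nonneg_right (Num.zero_le _)

end

end L2Structure

/-! ### The ordered field of fractions of an ordered semiring -/

section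

variable (N : Type u) [CommSemiring N] [LinearOrder N] [IsStrictOrderedRing N]

/-- Formal differences `(a, b)` and `(c, d)` are equivalent when `a - b = c - d`. -/
def diffSetoid : Setoid (N × N) where
  r x y := x.1 + y.2 = y.1 + x.2
  iseqv := by
    refine ⟨fun x => rfl, fun h => h.symm, fun {x y z} h h' => ?_⟩
    refine add_right_cancel (b := y.2) ?_
    calc x.1 + z.2 + y.2 = (x.1 + y.2) + z.2 := by ring
      _ = (y.1 + z.2) + x.2 := by rw [h]; ring
      _ = z.1 + x.2 + y.2 := by rw [h']; ring

/-- The ring of differences of an ordered semiring. -/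
def DiffRing : Type u := Quotient (diffSetoid N)

namespace DiffRing

variable {N}

/-- The difference `a - b`. -/
def mk (a b : N) : DiffRing N := Quotient.mk (diffSetoid N) (a, b)

theorem mk_eq_mk {a b c d : N} : mk a b = mk c d ↔ a + d = c + b :=
  ⟨fun h => Quotient.exact h, fun h => Quotient.sound (s := diffSetoid N) h⟩

theorem ind {P : DiffRing N → Prop} (h : ∀ a b, P (mk a b)) (x : DiffRing N) : P x :=
  Quotient.ind (fun p => h p.1 p.2) x

def add : DiffRing N → DiffRing N → DiffRing N :=
  Quotient.lift₂ (fun x y => mk (x.1 + y.1) (x.2 + y.2)) fun x y x' y' h h' => by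
    rw [mk_eq_mk]
    calc x.1 + y.1 + (x'.2 + y'.2) = (x.1 + x'.2) + (y.1 + y'.2) := by ring
      _ = (x'.1 + x.2) + (y'.1 + y.2) := by rw [show x.1 + x'.2 = _ from h, show y.1 + y'.2 = _ from h']
      _ = x'.1 + y'.1 + (x.2 + y.2) := by ring

def mul : DiffRing N → DiffRing N → DiffRing N :=
  Quotient.lift₂ (fun x y => mk (x.1 * y.1 + x.2 * y.2) (x.1 * y.2 + x.2 * y.1))
    fun x y x' y' h h' => by
    have e : x.1 + x'.2 = x'.1 + x.2 := h
    have e' : y.1 + y'.2 = y'.1 + y.2 := h'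
    rw [mk_eq_mk]
    refine add_right_cancel (b := x'.1 * y.2 + x'.2 * y.1) ?_
    calc x.1 * y.1 + x.2 * y.2 + (x'.1 * y'.2 + x'.2 * y'.1) + (x'.1 * y.2 + x'.2 * y.1)
        = (x.1 + x'.2) * y.1 + (x'.1 + x.2) * y.2 + (x'.1 * y'.2 + x'.2 * y'.1) := by ring
      _ = (x'.1 + x.2) * y.1 + (x.1 + x'.2) * y.2 + (x'.1 * y'.2 + x'.2 * y'.1) := by rw [e]
      _ = x.2 * y.1 + x.1 * y.2 + (x'.1 * (y.1 + y'.2) + x'.2 * (y'.1 + y.2)) := by ring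
      _ = x.2 * y.1 + x.1 * y.2 + (x'.1 * (y'.1 + y.2) + x'.2 * (y.1 + y'.2)) := by rw [e']
      _ = x'.1 * y'.1 + x'.2 * y'.2 + (x.1 * y.2 + x.2 * y.1) + (x'.1 * y.2 + x'.2 * y.1) := by
        ring

def neg : DiffRing N → DiffRing N :=
  Quotient.lift (fun x => mk x.2 x.1) fun x x' h => by
    have e : x.1 + x'.2 = x'.1 + x.2 := h
    rw [mk_eq_mk, add_comm, ← e, add_comm]

instance : Zero (DiffRing N) := ⟨mk 0 0⟩
instance : One (DiffRing N) := ⟨mk 1 0⟩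
instance : Add (DiffRing N) := ⟨add⟩
instance : Mul (DiffRing N) := ⟨mul⟩
instance : Neg (DiffRing N) := ⟨neg⟩

theorem zero_def : (0 : DiffRing N) = mk 0 0 := rfl
theorem one_def : (1 : DiffRing N) = mk 1 0 := rfl
theorem mk_add (a b c d : N) : mk a b + mk c d = mk (a + c) (b + d) := rfl
theorem mk_mul (a b c d : N) : mk a b * mk c d = mk (a * c + b * d) (a * d + b * c) := rfl
theorem neg_mk (a b : N) : -mk a b = mk b a := rfl

instance : CommRing (DiffRing N) where
  add_assoc x y z := by
    induction x using ind; induction y using ind; induction z using ind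
    simp only [mk_add, mk_eq_mk]; ring
  zero_add x := by
    induction x using ind
    simp only [zero_def, mk_add, mk_eq_mk]; ring
  add_zero x := by
    induction x using ind
    simp only [zero_def, mk_add, mk_eq_mk]; ring
  add_comm x y := by
    induction x using ind; induction y using ind
    simp only [mk_add, mk_eq_mk]; ring
  left_distrib x y z := by
    induction x using ind; induction y using ind; induction z using ind
    simp only [mk_add, mk_mul, mk_eq_mk]; ring
  right_distrib x y z := by
    induction x using ind; induction y using ind; induction z using ind
    simp only [mk_add, mk_mul, mk_eq_mk]; ring
  zero_mul x := by
    induction x using ind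
    simp only [zero_def, mk_mul, mk_eq_mk]; ring
  mul_zero x := by
    induction x using ind
    simp only [zero_def, mk_mul, mk_eq_mk]; ring
  mul_assoc x y z := by
    induction x using ind; induction y using ind; induction z using ind
    simp only [mk_mul, mk_eq_mk]; ring
  one_mul x := by
    induction x using ind
    simp only [one_def, mk_mul, mk_eq_mk]; ring
  mul_one x := by
    induction x using ind
    simp only [one_def, mk_mul, mk_eq_mk]; ring
  mul_comm x y := by
    induction x using ind; induction y using ind
    simp only [mk_mul, mk_eq_mk]; ring
  neg_add_cancel x := by
    induction x using ind
    simp only [neg_mk, zero_def, mk_add, mk_eq_mk]; ring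
  nsmul := nsmulRec
  zsmul := zsmulRec

variable (N) in
/-- The embedding of the semiring. -/
def ofNum : N →+* DiffRing N where
  toFun a := mk a 0
  map_zero' := rfl
  map_one' := rfl
  map_add' a b := by simp only [mk_add, mk_eq_mk]; ring
  map_mul' a b := by simp only [mk_mul, mk_eq_mk]; ring

theorem ofNum_injective : Function.Injective (ofNum N) := fun a b h => by
  have := mk_eq_mk.1 (show mk a 0 = mk b 0 from h)
  simpa using this

theorem ofNum_apply (a : N) : ofNum N a = mk a 0 := rfl

variable [CanonicallyOrderedAdd N]

theorem eq_or_neg (x : DiffRing N) : ∃ a : N, x = ofNum N a ∨ x = -ofNum N a := by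
  induction x using ind with
  | h a b =>
    rcases le_total a b with h | h
    · obtain ⟨c, rfl⟩ := exists_add_of_le h
      refine ⟨c, Or.inr ?_⟩
      rw [ofNum_apply, neg_mk, mk_eq_mk]
      ring
    · obtain ⟨c, rfl⟩ := exists_add_of_le h
      refine ⟨c, Or.inl ?_⟩
      rw [ofNum_apply, mk_eq_mk]
      ring

instance : Nontrivial (DiffRing N) :=
  ⟨0, 1, fun h => zero_ne_one (ofNum_injective (h : ofNum N 0 = ofNum N 1))⟩

instance : NoZeroDivisors (DiffRing N) where
  eq_zero_or_eq_zero_of_mul_eq_zero {x y} h := by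
    obtain ⟨a, ha⟩ := eq_or_neg x
    obtain ⟨b, hb⟩ := eq_or_neg y
    have key : ofNum N (a * b) = ofNum N 0 := by
      rw [map_mul, map_zero]
      rcases ha with rfl | rfl <;> rcases hb with rfl | rfl <;> simpa using h
    rcases mul_eq_zero.1 (ofNum_injective key) with rfl | rfl
    · exact Or.inl (by simpa using ha)
    · exact Or.inr (by simpa using hb)

instance : IsDomain (DiffRing N) := NoZeroDivisors.to_isDomain _

end DiffRing

variable [CanonicallyOrderedAdd N]

/-- The field of fractions of an ordered semiring. -/
def FracField : Type u := FractionRing (DiffRing N)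

namespace FracField

noncomputable instance : Field (FracField N) := inferInstanceAs (Field (FractionRing (DiffRing N)))

/-- The embedding of the semiring. -/
noncomputable def ofNum : N →+* FracField N :=
  (algebraMap (DiffRing N) (FractionRing (DiffRing N))).comp (DiffRing.ofNum N)

variable {N}

theorem ofNum_injective : Function.Injective (ofNum N) :=
  (IsFractionRing.injective (DiffRing N) (FractionRing (DiffRing N))).comp
    DiffRing.ofNum_injective

theorem exists_frac (x : FracField N) : ∃ a d : N, d ≠ 0 ∧
    (x = ofNum N a / ofNum N d ∨ x = -(ofNum N a / ofNum N d)) := by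
  obtain ⟨p, q, hq, rfl⟩ := IsFractionRing.div_surjective (A := DiffRing N)
    (K := FractionRing (DiffRing N)) x
  obtain ⟨a, ha⟩ := DiffRing.eq_or_neg p
  obtain ⟨d, hd⟩ := DiffRing.eq_or_neg q
  refine ⟨a, d, ?_, ?_⟩
  · rintro rfl
    exact nonZeroDivisors.ne_zero hq (by simpa using hd)
  · rcases ha with rfl | rfl <;> rcases hd with rfl | rfl <;>
    simp only [ofNum, map_neg, neg_div, div_neg, neg_neg]
    exacts [Or.inl rfl, Or.inr rfl, Or.inr rfl, Or.inl rfl]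

variable (N) in
/-- The cone of nonnegative elements. -/
noncomputable def cone : RingCone (FracField N) where
  carrier := {x | ∃ a d : N, d ≠ 0 ∧ x = ofNum N a / ofNum N d}
  zero_mem' := ⟨0, 1, one_ne_zero, by simp⟩
  one_mem' := ⟨1, 1, one_ne_zero, by simp⟩
  add_mem' := by
    rintro _ _ ⟨a, d, hd, rfl⟩ ⟨b, c, hc, rfl⟩
    have hd' : ofNum N d ≠ 0 := by rwa [Ne, map_eq_zero_iff _ ofNum_injective]
    have hc' : ofNum N c ≠ 0 := by rwa [Ne, map_eq_zero_iff _ ofNum_injective]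
    refine ⟨a * c + d * b, d * c, mul_ne_zero hd hc, ?_⟩
    simp only [map_add, map_mul]
    field_simp
  mul_mem' := by
    rintro _ _ ⟨a, d, hd, rfl⟩ ⟨b, c, hc, rfl⟩
    refine ⟨a * b, d * c, mul_ne_zero hd hc, ?_⟩
    simp only [map_mul, div_mul_div_comm]
  eq_zero_of_mem_of_neg_mem' := by
    rintro _ ⟨a, d, hd, rfl⟩ ⟨b, c, hc, h⟩
    have hd' : ofNum N d ≠ 0 := by rwa [Ne, map_eq_zero_iff _ ofNum_injective]
    have hc' : ofNum N c ≠ 0 := by rwa [Ne, map_eq_zero_iff _ ofNum_injective]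
    have key : ofNum N (a * c + b * d) = ofNum N 0 := by
      simp only [map_add, map_mul, map_zero]
      field_simp at h
      linear_combination -h
    have h0 := ofNum_injective key
    rw [add_eq_zero] at h0
    have : a = 0 := (mul_eq_zero.1 h0.1).resolve_right hc
    simp [this]

noncomputable instance : HasMemOrNegMem (cone N) where
  mem_or_neg_mem x := by
    obtain ⟨a, d, hd, h | h⟩ := exists_frac x
    · exact Or.inl ⟨a, d, hd, h⟩
    · exact Or.inr ⟨a, d, hd, by rw [h, neg_neg]⟩

open scoped Classical in
noncomputable instance : LinearOrder (FracField N) := .mkOfAddGroupCone (cone N)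

instance : IsOrderedRing (FracField N) := .mkOfCone (cone N)

instance : IsStrictOrderedRing (FracField N) := inferInstance

theorem ofNum_nonneg (a : N) : 0 ≤ ofNum N a := by
  have : ofNum N a - 0 ∈ cone N := ⟨a, 1, one_ne_zero, by simp⟩
  exact this

theorem ofNum_le_ofNum {a b : N} : ofNum N a ≤ ofNum N b ↔ a ≤ b := by
  have key : ∀ {a b : N}, a ≤ b → ofNum N a ≤ ofNum N b := by
    intro a b h
    obtain ⟨c, rfl⟩ := exists_add_of_le h
    rw [map_add]
    exact le_add_of_nonneg_right (ofNum_nonneg c)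
  refine ⟨fun h => ?_, key⟩
  by_contra! h'
  exact h'.ne (ofNum_injective ((key h'.le).antisymm h))

end FracField

end

namespace L2Structure

section

variable {M : L2Structure.{u}} [hM : Fact M.ModelsRCA0]

/-! ### The rational field of a model -/

variable (M) in
/-- The field of fractions of the numbers of `M`. -/
abbrev RatField : Type u := FracField M.Num

/-- The number `n` as a rational. -/
@[coe]
noncomputable def Num.toRat (n : M.Num) : M.RatField := FracField.ofNum M.Num n

noncomputable instance : Coe M.Num M.RatField := ⟨Num.toRat⟩

@[simp, norm_cast]
theorem Num.coe_zero : ((0 : M.Num) : M.RatField) = 0 := map_zero (FracField.ofNum M.Num)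

@[simp, norm_cast]
theorem Num.coe_one : ((1 : M.Num) : M.RatField) = 1 := map_one (FracField.ofNum M.Num)

@[simp, norm_cast]
theorem Num.coe_add (a b : M.Num) : ((a + b : M.Num) : M.RatField) = a + b :=
  map_add (FracField.ofNum M.Num) a b

@[simp, norm_cast]
theorem Num.coe_mul (a b : M.Num) : ((a * b : M.Num) : M.RatField) = a * b :=
  map_mul (FracField.ofNum M.Num) a b

@[simp, norm_cast]
theorem Num.coe_le {a b : M.Num} : (a : M.RatField) ≤ b ↔ a ≤ b := FracField.ofNum_le_ofNum

@[simp, norm_cast]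
theorem Num.coe_lt {a b : M.Num} : (a : M.RatField) < b ↔ a < b := by
  rw [← not_le, Num.coe_le, not_le]

theorem Num.coe_nonneg (a : M.Num) : (0 : M.RatField) ≤ a := FracField.ofNum_nonneg a

theorem Num.coe_add_one_le {a b : M.Num} (h : a < b) : (a : M.RatField) + 1 ≤ b := by
  exact_mod_cast Num.add_one_le_iff.2 h

theorem Num.coe_add_one_pos (a : M.Num) : (0 : M.RatField) < a + 1 := by
  have := Num.coe_nonneg a
  linarith

theorem Num.pos_of_ne_zero {a : M.Num} (h : a ≠ 0) : 0 < a := (Num.zero_le a).lt_of_ne' h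

theorem Num.lt_add_one (a : M.Num) : a < a + 1 := Num.lt_add_one_iff.2 le_rfl

theorem Num.one_le_coe {a : M.Num} (h : a ≠ 0) : (1 : M.RatField) ≤ a := by
  have := Num.coe_add_one_le (Num.pos_of_ne_zero h)
  rwa [Num.coe_zero, zero_add] at this

theorem Num.exists_gt (x : M.RatField) : ∃ n : M.Num, x < n := by
  obtain ⟨a, d, hd, h⟩ := FracField.exists_frac x
  refine ⟨a + 1, ?_⟩
  have hd' : (1 : M.RatField) ≤ d := Num.one_le_coe hd
  have ha : (0 : M.RatField) ≤ a := Num.coe_nonneg a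
  have h0 : (0 : M.RatField) ≤ a / d := by positivity
  have h1 : (a : M.RatField) / d ≤ a := div_le_self ha hd'
  have : x ≤ a / d := by
    rcases h with h | h
    · exact h.le
    · have : x = -((a : M.RatField) / d) := h
      linarith
  push_cast
  linarith

theorem Num.exists_inv_lt {x : M.RatField} (hx : 0 < x) : ∃ n : M.Num, 1 / ((n : M.RatField) + 1) < x := by
  obtain ⟨n, hn⟩ := Num.exists_gt (1 / x)
  refine ⟨n, ?_⟩
  rw [div_lt_iff₀ hx] at hn
  rw [div_lt_iff₀ (Num.coe_add_one_pos n)]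
  linarith

/-! ### Values of fractions -/

namespace Frac

/-- The rational named by a triple. -/
noncomputable def val (q : M.Frac) : M.RatField := ((q.pos : M.RatField) - q.neg) / (q.den + 1)

@[simp] theorem val_zero : (zero : M.Frac).val = 0 := by simp [val, zero]

@[simp] theorem val_one : (one : M.Frac).val = 1 := by simp [val, one]

@[simp] theorem val_invSucc (k : M.Num) : (invSucc k).val = 1 / ((k : M.RatField) + 1) := by
  simp [val, invSucc]

@[simp] theorem val_add (q r : M.Frac) : (q.add r).val = q.val + r.val := by
  have hq := (Num.coe_add_one_pos q.den).ne'
  have hr := (Num.coe_add_one_pos r.den).ne'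
  have h : (q.den : M.RatField) * r.den + q.den + r.den + 1 = (q.den + 1) * (r.den + 1) := by ring
  simp only [val, add, Num.coe_add, Num.coe_mul, Num.coe_one, h]
  field_simp
  ring

@[simp] theorem val_sub (q r : M.Frac) : (q.sub r).val = q.val - r.val := by
  rw [sub, val_add, sub_eq_add_neg]
  congr 1
  simp only [val, ← neg_div, neg_sub]

theorem lt_iff {q r : M.Frac} : q.Lt r ↔ q.val < r.val := by
  have hq := Num.coe_add_one_pos q.den
  have hr := Num.coe_add_one_pos r.den
  rw [Lt, ← Num.coe_lt, val, val, div_lt_div_iff₀ hq hr]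
  push_cast
  constructor <;> intro h <;> linarith

theorem le_iff {q r : M.Frac} : q.Le r ↔ q.val ≤ r.val := by
  rw [Le, lt_iff, not_lt]

theorem distLt_iff {q r s : M.Frac} : q.DistLt r s ↔ |q.val - r.val| < s.val := by
  rw [DistLt, lt_iff, lt_iff, val_add, val_add, abs_lt]
  constructor <;> rintro ⟨h, h'⟩ <;> constructor <;> linarith

theorem distLe_iff {q r s : M.Frac} : q.DistLe r s ↔ |q.val - r.val| ≤ s.val := by
  rw [DistLe, le_iff, le_iff, val_add, val_add, abs_le]
  constructor <;> rintro ⟨h, h'⟩ <;> constructor <;> linarith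

theorem inUnit_iff {q : M.Frac} : q.InUnit ↔ 0 ≤ q.val ∧ q.val ≤ 1 := by
  rw [InUnit, le_iff, le_iff, val_zero, val_one]

theorem exists_val (x : M.RatField) : ∃ q : M.Frac, q.val = x := by
  obtain ⟨a, d, hd, h⟩ := FracField.exists_frac x
  obtain ⟨c, hc⟩ := Num.lt_iff_exists.1 (Num.pos_of_ne_zero hd)
  rw [zero_add] at hc
  subst hc
  rcases h with h | h
  · refine ⟨⟨a, 0, c⟩, ?_⟩
    rw [h, val, Num.coe_zero, sub_zero, ← Num.coe_one, ← Num.coe_add]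
    rfl
  · refine ⟨⟨0, a, c⟩, ?_⟩
    rw [h, val, Num.coe_zero, zero_sub, ← Num.coe_one, ← Num.coe_add, neg_div]
    rfl

end Frac

/-! ### Pairing -/

theorem left_le_pair (i j : M.Num) : i ≤ pair i j := le_add_self

theorem right_le_pair (i j : M.Num) : j ≤ pair i j := by
  rw [← Num.coe_le, pair]
  have hi := Num.coe_nonneg i
  rcases eq_or_ne j 0 with rfl | hj
  · push_cast
    positivity
  · have hj' : (1 : M.RatField) ≤ j := Num.one_le_coe hj
    push_cast
    nlinarith

theorem pair_injective {i j i' j' : M.Num} (h : pair i j = pair i' j') : i = i' ∧ j = j' := by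
  -- With `s = i + j`, the code lies between `s ^ 2` and `(s + 1) ^ 2 - 1`, so it determines `s`.
  have key : ∀ {i j i' j' : M.Num}, pair i j = pair i' j' → ¬ i + j < i' + j' := by
    intro i j i' j' h hlt
    have h1 := Num.coe_add_one_le hlt
    have h2 := congrArg (fun n : M.Num => (n : M.RatField)) h
    simp only [pair] at h2
    push_cast at h1 h2
    have hi := Num.coe_nonneg i
    have hi' := Num.coe_nonneg i'
    have hj := Num.coe_nonneg j
    nlinarith
  have hs : i + j = i' + j' := le_antisymm (not_lt.1 (key h.symm)) (not_lt.1 (key h))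
  have hi : i = i' := by
    unfold pair at h
    rw [hs] at h
    exact add_left_cancel h
  subst hi
  exact ⟨rfl, add_left_cancel hs⟩

theorem Frac.code_injective {q r : M.Frac} (h : q.code = r.code) : q = r := by
  obtain ⟨h1, h2⟩ := pair_injective h
  obtain ⟨h2, h3⟩ := pair_injective h2
  cases q
  cases r
  simp_all

/-! ### Definability: further closure properties -/

instance Tm.instPair (f g : M.Env → M.Num) [hf : Tm f] [hg : Tm g] : Tm fun e => pair (f e) (g e) :=
  inferInstanceAs (Tm fun e => (f e + g e) * (f e + g e) + f e)

instance Bdd.instLe (f g : M.Env → M.Num) [hf : Tm f] [hg : Tm g] : Bdd fun e => f e ≤ g e :=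
  (inferInstance : Bdd fun e => f e < g e + 1).congr fun _ => Num.lt_add_one_iff

instance Bdd.instBallLe (f : M.Env → M.Num) (P : M.Num → M.Env → Prop) [hf : Tm f]
    [hP : Bdd fun e => P (e 0) fun i => e (i + 1)] : Bdd fun e => ∀ a, a ≤ f e → P a e :=
  (inferInstance : Bdd fun e => ∀ a, a < f e + 1 → P a e).congr fun _ => by
    simp only [Num.lt_add_one_iff]

instance Bdd.instBexLe (f : M.Env → M.Num) (P : M.Num → M.Env → Prop) [hf : Tm f]
    [hP : Bdd fun e => P (e 0) fun i => e (i + 1)] : Bdd fun e => ∃ a, a ≤ f e ∧ P a e :=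
  (inferInstance : Bdd fun e => ∃ a, a < f e + 1 ∧ P a e).congr fun _ => by
    simp only [Num.lt_add_one_iff]

/-- The new quantifier and the old one are replaced by a single unbounded one, over a common strict
bound of both witnesses. -/
instance (priority := 900) Sig.instEx (P : M.Num → M.Env → Prop)
    [hP : Sig fun e => P (e 0) fun i => e (i + 1)] : Sig fun e => ∃ a, P a e := by
  obtain ⟨Q, hQ, h⟩ := Sig.exists_matrix P hP
  refine ⟨fun b e => ∃ a, a < b ∧ ∃ m, m < b ∧ Q m a e, ?_, fun e => ?_⟩
  · have : Bdd fun e : M.Env => Q (e 0) (e 1) fun i => e (i + 3) :=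
      hQ.subst (fun e => pushVal (e 0) (pushVal (e 1) fun i => e (i + 3)))
        (Tm.pushVal (Tm.var 0) (Tm.pushVal (Tm.var 1) fun i => Tm.var _))
    infer_instance
  · simp only [h]
    constructor
    · rintro ⟨a, m, hm⟩
      exact ⟨a + m + 1, a, Num.lt_add_one_iff.2 le_self_add, m, Num.lt_add_one_iff.2 le_add_self, hm⟩
    · rintro ⟨b, a, -, m, -, hm⟩
      exact ⟨a, m, hm⟩

instance Sig.instAnd (P Q : M.Env → Prop) [hP : Sig P] [hQ : Sig Q] : Sig fun e => P e ∧ Q e := by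
  obtain ⟨P', hP', h⟩ := hP
  obtain ⟨Q', hQ', h'⟩ := hQ
  have : Sig fun e => ∃ a b, P' a e ∧ Q' b e := by
    have h1 : Bdd fun e : M.Env => P' (e 1) fun i => e (i + 2) :=
      hP'.subst (fun e => pushVal (e 1) fun i => e (i + 2))
        (Tm.pushVal (Tm.var 1) fun i => Tm.var _)
    have h2 : Bdd fun e : M.Env => Q' (e 0) fun i => e (i + 2) :=
      hQ'.subst (fun e => pushVal (e 0) fun i => e (i + 2))
        (Tm.pushVal (Tm.var 0) fun i => Tm.var _)
    infer_instance
  exact this.congr fun e => by rw [h, h']; exact exists_and_exists_comm.symm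

instance Sig.instOr (P Q : M.Env → Prop) [hP : Sig P] [hQ : Sig Q] : Sig fun e => P e ∨ Q e := by
  obtain ⟨P', hP', h⟩ := hP
  obtain ⟨Q', hQ', h'⟩ := hQ
  exact ⟨fun m e => P' m e ∨ Q' m e, inferInstance, fun e => by rw [h, h', exists_or]⟩

/-- Bounding for bounded predicates. -/
theorem exists_bound {R : M.Num → M.Num → Prop} (hR : Bdd fun e : M.Env => R (e 0) (e 1))
    (n : M.Num) (h : ∀ a, a < n → ∃ m, R a m) : ∃ b, ∀ a, a < n → ∃ m, m < b ∧ R a m := by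
  have : Bdd fun e : M.Env => R (e 1) (e 0) := hR.comp₂ (fun e => e 1) fun e => e 0
  -- Witnesses exist only for `a < n`, so the induction runs over a separate cut-off `k`.
  have key : ∀ k, ∃ b, ∀ a, a < k → a < n → ∃ m, m < b ∧ R a m := by
    refine num_induction ⟨0, fun a ha => (Arith.not_lt_zero _ ha).elim⟩ fun k ⟨b, hb⟩ => ?_
    by_cases hk : k < n
    · obtain ⟨m, hm⟩ := h k hk
      refine ⟨b + (m + 1), fun a ha han => ?_⟩
      rcases (Num.lt_add_one_iff.1 ha).lt_or_eq with ha | rfl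
      · obtain ⟨m', h1, h2⟩ := hb a ha han
        exact ⟨m', h1.trans_le le_self_add, h2⟩
      · exact ⟨m, (Num.lt_add_one m).trans_le le_add_self, hm⟩
    · refine ⟨b, fun a ha han => hb a ?_ han⟩
      exact (Num.lt_add_one_iff.1 ha).lt_of_ne fun h => hk (h ▸ han)
  obtain ⟨b, hb⟩ := key n
  exact ⟨b, fun a ha => hb a ha ha⟩

/-- By `Σ⁰₁` bounding, the witnesses for all `a < f e` have a common bound, and the unbounded
quantifier moves to the front. -/
instance Sig.instBall (f : M.Env → M.Num) (P : M.Num → M.Env → Prop) [hf : Tm f]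
    [hP : Sig fun e => P (e 0) fun i => e (i + 1)] : Sig fun e => ∀ a, a < f e → P a e := by
  obtain ⟨Q, hQ, h⟩ := Sig.exists_matrix P hP
  refine ⟨fun b e => ∀ a, a < f e → ∃ m, m < b ∧ Q m a e, ?_, fun e => ?_⟩
  · have h1 : Bdd fun e : M.Env => Q (e 0) (e 1) fun i => e (i + 3) :=
      hQ.subst (fun e => pushVal (e 0) (pushVal (e 1) fun i => e (i + 3)))
        (Tm.pushVal (Tm.var 0) (Tm.pushVal (Tm.var 1) fun i => Tm.var _))
    have h2 := hf.shift
    infer_instance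
  · simp only [h]
    constructor
    · refine fun H => exists_bound (R := fun a m => Q m a e) ?_ (f e) H
      exact hQ.subst (fun e' => pushVal (e' 1) (pushVal (e' 0) e))
        (Tm.pushVal (Tm.var 1) (Tm.pushVal (Tm.var 0) fun i => Tm.const _))
    · rintro ⟨b, hb⟩ a ha
      obtain ⟨m, -, hm⟩ := hb a ha
      exact ⟨m, hm⟩

end

end L2Structure

namespace L2Structure

section

variable {M : L2Structure.{u}} [hM : Fact M.ModelsRCA0]

instance Sig.instBallLe (f : M.Env → M.Num) (P : M.Num → M.Env → Prop) [hf : Tm f]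
    [hP : Sig fun e => P (e 0) fun i => e (i + 1)] : Sig fun e => ∀ a, a ≤ f e → P a e :=
  (inferInstance : Sig fun e => ∀ a, a < f e + 1 → P a e).congr fun _ => by
    simp only [Num.lt_add_one_iff]

/-! ### Induction and minimization -/

/-- A failure at `n` descends: by `Σ⁰₁` induction on `k` there is a failure at some `j` with `j + k
= n`, which is absurd for `k = n + 1`. -/
theorem pi_induction {P : M.Num → Prop} [hP : Sig fun e : M.Env => ¬ P (e 0)]
    (h0 : P 0) (hs : ∀ n, P n → P (n + 1)) (n : M.Num) : P n := by
  by_contra hn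
  have : Sig fun e : M.Env => ∃ j, j + e 0 = n ∧ ¬ P j := by
    have : Sig fun e : M.Env => ¬ P (e 0) := hP
    infer_instance
  have key : ∀ k, ∃ j, j + k = n ∧ ¬ P j := by
    refine num_induction ⟨n, add_zero n, hn⟩ fun k ⟨j, hj, hPj⟩ => ?_
    rcases Arith.eq_zero_or_succ j with rfl | ⟨i, rfl⟩
    · exact (hPj h0).elim
    · exact ⟨i, by rw [← hj]; ring, fun h => hPj (hs i h)⟩
  obtain ⟨j, hj, -⟩ := key (n + 1)
  refine absurd hj (ne_of_gt ?_)
  exact (Num.lt_add_one n).trans_le le_add_self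

theorem exists_least_of_sig {P : M.Num → Prop} (hP : Sig fun e : M.Env => P (e 0))
    (h : ∃ n, P n) : ∃ n, P n ∧ ∀ m, m < n → ¬ P m := by
  by_contra! H
  have hS : Sig fun e : M.Env => ∃ m, m < e 0 ∧ P m := by
    have : Sig fun e : M.Env => P (e 0) := hP
    infer_instance
  have : Sig fun e : M.Env => ¬ ∀ m, m < e 0 → ¬ P m := hS.congr fun e => by push Not; rfl
  have key : ∀ n, ∀ m, m < n → ¬ P m := by
    refine pi_induction (fun m hm => (Arith.not_lt_zero _ hm).elim) fun n ih m hm hPm => ?_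
    rcases (Num.lt_add_one_iff.1 hm).lt_or_eq with hm | rfl
    · exact ih m hm hPm
    · obtain ⟨k, hk, hPk⟩ := H m hPm
      exact ih k hk hPk
  obtain ⟨n, hn⟩ := h
  exact key (n + 1) n (Num.lt_add_one n) hn

/-! ### Functions with a `Σ⁰₁` graph -/

/-- A function with a `Σ⁰₁` graph. -/
class SigFun (F : M.Num → M.Num) : Prop where
  sig : Sig fun e : M.Env => F (e 0) = e 1

instance SigFun.instSig (F : M.Num → M.Num) (f g : M.Env → M.Num) [hF : SigFun F] [hf : Tm f]
    [hg : Tm g] : Sig fun e => F (f e) = g e :=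
  hF.sig.comp₂ (R := fun a b => F a = b) f g

/-- Uniformization of `Σ⁰₁` relations. -/
theorem exists_sigFun {R : M.Num → M.Num → Prop} (hR : Sig fun e : M.Env => R (e 0) (e 1))
    (h : ∀ k, ∃ c, R k c) : ∃ F : M.Num → M.Num, SigFun F ∧ ∀ k, R k (F k) := by
  obtain ⟨Q, hQ, hRQ⟩ := hR
  obtain ⟨S, hS, hRS⟩ : ∃ S : M.Num → M.Num → M.Num → Prop,
      (Bdd fun e : M.Env => S (e 0) (e 1) (e 2)) ∧ ∀ k c, R k c ↔ ∃ m, S m k c :=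
    ⟨fun m k c => Q m (pushVal k (pushVal c fun _ => 0)),
      hQ.subst (fun e => pushVal (e 0) (pushVal (e 1) (pushVal (e 2) fun _ => 0)))
        (Tm.pushVal (Tm.var 0) (Tm.pushVal (Tm.var 1) (Tm.pushVal (Tm.var 2) fun _ => Tm.const 0))),
      fun k c => hRQ (pushVal k (pushVal c fun _ => 0))⟩
  have hS' : ∀ f g h : M.Env → M.Num, Tm f → Tm g → Tm h → Bdd fun e => S (f e) (g e) (h e) :=
    fun f g h _ _ _ => hS.comp₃ f g h
  let A : M.Num → M.Num → M.Num → Prop := fun k b c => c < b ∧ ∃ m, m < b ∧ S m k c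
  have hA : Bdd fun e : M.Env => A (e 0) (e 1) (e 2) := by
    have := hS' (fun e : M.Env => e 0) (fun e => e 1) (fun e => e 3) inferInstance inferInstance
      inferInstance
    exact (inferInstance : Bdd fun e : M.Env => e 2 < e 1 ∧ ∃ m, m < e 1 ∧ S m (e 0) (e 2))
  have hA' : ∀ f g h : M.Env → M.Num, [Tm f] → [Tm g] → [Tm h] →
    Bdd fun e => A (f e) (g e) (h e) := fun f g h => hA.comp₃ f g h
  let B : M.Num → M.Num → Prop := fun k b => ∃ c, c < b ∧ A k b c
  have hB : Bdd fun e : M.Env => B (e 0) (e 1) :=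
    (inferInstance : Bdd fun e : M.Env => ∃ c, c < e 1 ∧ A (e 0) (e 1) c)
  have hB' : ∀ f g : M.Env → M.Num, [Tm f] → [Tm g] → Bdd fun e => B (f e) (g e) :=
    fun f g => hB.comp₂ f g
  -- The least `c` with `R k c` need not have a `Σ⁰₁` definition. Instead take the least `b`
  -- bounding some value together with its witness, and then the least value verified below `b`;
  -- both minimality conditions are bounded.
  let C : M.Num → M.Num → Prop := fun k c => ∃ b, B k b ∧ (∀ b', b' < b → ¬ B k b') ∧
    A k b c ∧ ∀ c', c' < c → ¬ A k b c'
  have hC : Sig fun e : M.Env => C (e 0) (e 1) :=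
    (inferInstance : Sig fun e : M.Env => ∃ b, B (e 0) b ∧ (∀ b', b' < b → ¬ B (e 0) b') ∧
      A (e 0) b (e 1) ∧ ∀ c', c' < e 1 → ¬ A (e 0) b c')
  have hCR : ∀ k c, C k c → R k c := by
    rintro k c ⟨b, -, -, ⟨-, m, -, hm⟩, -⟩
    exact (hRS k c).2 ⟨m, hm⟩
  have hex : ∀ k, ∃ c, C k c := by
    intro k
    have h1 : ∃ b, B k b := by
      obtain ⟨c, hc⟩ := h k
      obtain ⟨m, hm⟩ := (hRS k c).1 hc
      have h1 : c < c + m + 1 := Num.lt_add_one_iff.2 le_self_add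
      exact ⟨c + m + 1, c, h1, h1, m, Num.lt_add_one_iff.2 le_add_self, hm⟩
    obtain ⟨b, hb, hb'⟩ := exists_least_of_sig (P := B k) inferInstance h1
    obtain ⟨c, hc, hc'⟩ := exists_least_of_sig (P := A k b) inferInstance
      (hb.imp fun c hc => hc.2)
    exact ⟨c, b, hb, hb', hc, hc'⟩
  have huniq : ∀ k c c', C k c → C k c' → c = c' := by
    rintro k c c' ⟨b, h1, h2, h3, h4⟩ ⟨b', h1', h2', h3', h4'⟩
    have hb : b = b' := le_antisymm (not_lt.1 fun h => h2 b' h h1') (not_lt.1 fun h => h2' b h h1)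
    subst hb
    exact le_antisymm (not_lt.1 fun h => h4 c' h h3') (not_lt.1 fun h => h4' c h h3)
  choose F hF using hex
  refine ⟨F, ⟨hC.congr fun e => ?_⟩, fun k => hCR k _ (hF k)⟩
  exact ⟨fun h => huniq _ _ _ (hF _) h, fun h => h ▸ hF _⟩

theorem graph_mem_sets (F : M.Num → M.Num) [hF : SigFun F] :
    {z | ∃ k, z = pair k (F k)} ∈ M.sets := by
  obtain ⟨X, hX, h⟩ := exists_set hM.out (P := fun z => ∃ k, z = pair k (F k))
    ((inferInstance : Sig fun e : M.Env => ∃ k c, F k = c ∧ e 0 = pair k c).congr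
      fun e => by simp)
    -- As `F` is total, a pair outside the graph is recognized by a different value of `F`.
    ((inferInstance : Sig fun e : M.Env => (∀ i, i ≤ e 0 → ∀ j, j ≤ e 0 → ¬ e 0 = pair i j) ∨
      ∃ k c c', F k = c ∧ ¬ c' = c ∧ e 0 = pair k c').congr fun e => by
        constructor
        · rintro (h | ⟨k, c, c', rfl, hc, hz⟩) ⟨k', hk'⟩
          · exact h k' (hk' ▸ left_le_pair _ _) _ (hk' ▸ right_le_pair _ _) hk'
          · obtain ⟨rfl, h⟩ := pair_injective (hz.symm.trans hk')
            exact hc h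
        · intro h
          by_cases h' : ∃ i j, e 0 = pair i j
          · obtain ⟨i, j, hij⟩ := h'
            exact Or.inr ⟨i, F i, j, rfl, fun hj => h ⟨i, hj ▸ hij⟩, hij⟩
          · push Not at h'
            exact Or.inl fun i _ j _ => h' i j)
  convert hX
  ext z
  exact (h z).symm

/-! ### Codes of bounded sets -/

/-- The number `i` belongs to the finite set coded by `(c, d)`. -/
def InCode (c d i : M.Num) : Prop := ∃ q, q ≤ c ∧ c = (1 + (i + 1) * d) * q

instance InCode.instBdd (f g h : M.Env → M.Num) [hf : Tm f] [hg : Tm g] [hh : Tm h] :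
    Bdd fun e => InCode (f e) (g e) (h e) :=
  Bdd.comp₃ (R := InCode) (inferInstance : Bdd fun e : M.Env =>
    ∃ q, q ≤ e 0 ∧ e 0 = (1 + (e 2 + 1) * e 1) * q) f g h

theorem inCode_iff {c d i : M.Num} : InCode c d i ↔ 1 + (i + 1) * d ∣ c := by
  constructor
  · rintro ⟨q, -, h⟩
    exact ⟨q, h⟩
  · rintro ⟨q, h⟩
    refine ⟨q, ?_, h⟩
    rw [h]
    exact le_mul_of_one_le_left (Num.zero_le q) le_self_add

/-- Bezout's relation, written without subtraction. -/
def Coprime (a b : M.Num) : Prop := ∃ x y z w, x * a + y * b = z * a + w * b + 1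

/-- The form without subtraction is `Σ⁰₁` and can occur in inductions; the form in the ring of
differences has the usual calculus of `IsCoprime`. -/
theorem coprime_iff {a b : M.Num} :
    Coprime a b ↔ IsCoprime (DiffRing.ofNum M.Num a) (DiffRing.ofNum M.Num b) := by
  constructor
  · rintro ⟨x, y, z, w, h⟩
    have := congrArg (DiffRing.ofNum M.Num) h
    simp only [map_add, map_mul, map_one] at this
    exact ⟨DiffRing.ofNum M.Num x - DiffRing.ofNum M.Num z,
      DiffRing.ofNum M.Num y - DiffRing.ofNum M.Num w, by linear_combination this⟩
  · have key : ∀ x : DiffRing M.Num, ∃ s t, x = DiffRing.ofNum M.Num s - DiffRing.ofNum M.Num t := by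
      intro x
      obtain ⟨s, h | h⟩ := DiffRing.eq_or_neg x
      exacts [⟨s, 0, by simp [h]⟩, ⟨0, s, by simp [h]⟩]
    rintro ⟨x, y, h⟩
    obtain ⟨x, z, rfl⟩ := key x
    obtain ⟨y, w, rfl⟩ := key y
    refine ⟨x, y, z, w, DiffRing.ofNum_injective ?_⟩
    simp only [map_add, map_mul, map_one]
    linear_combination h

theorem exists_common_multiple (n : M.Num) :
    ∃ d, d ≠ 0 ∧ ∀ j, j < n → ∃ q, q ≤ d ∧ d = (j + 1) * q := by
  refine num_induction (P := fun n => ∃ d, d ≠ 0 ∧ ∀ j, j < n → ∃ q, q ≤ d ∧ d = (j + 1) * q)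
    ⟨1, one_ne_zero, fun j hj => (Arith.not_lt_zero _ hj).elim⟩ (fun n ⟨d, hd, h⟩ => ?_) n
  have hle : ∀ a b : M.Num, a ≤ (b + 1) * a := fun a b =>
    le_mul_of_one_le_left (Num.zero_le a) le_add_self
  refine ⟨(n + 1) * d, mul_ne_zero (by simp) hd, fun j hj => ?_⟩
  rcases (Num.lt_add_one_iff.1 hj).lt_or_eq with hj | rfl
  · obtain ⟨q, -, hq⟩ := h j hj
    have : (n + 1) * d = (j + 1) * ((n + 1) * q) := by rw [hq]; ring
    exact ⟨(n + 1) * q, this ▸ hle _ _, this⟩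
  · exact ⟨d, hle _ _, rfl⟩

/-- For `j = i + (k + 1)` the moduli differ by `(k + 1) * d`. The first one is coprime to `d`, hence
to the divisor `k + 1` of `d`, hence to this difference. -/
theorem coprime_moduli {n d : M.Num} (hd : ∀ j, j < n → ∃ q, q ≤ d ∧ d = (j + 1) * q) {i j : M.Num}
    (hij : i < j) (hj : j < n) : Coprime (1 + (i + 1) * d) (1 + (j + 1) * d) := by
  obtain ⟨k, rfl⟩ := Num.lt_iff_exists.1 hij
  obtain ⟨q, -, hq⟩ := hd k (lt_of_le_of_lt ((Num.lt_add_one k).le.trans le_add_self) hj)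
  rw [coprime_iff]
  have h1 : IsCoprime (DiffRing.ofNum M.Num (1 + (i + 1) * d)) (DiffRing.ofNum M.Num d) :=
    ⟨1, -DiffRing.ofNum M.Num (i + 1), by simp only [map_add, map_mul, map_one]; ring⟩
  have h2 : IsCoprime (DiffRing.ofNum M.Num (1 + (i + 1) * d)) (DiffRing.ofNum M.Num (k + 1)) := by
    rw [hq, map_mul] at h1
    rw [hq]
    exact h1.of_mul_right_left
  have h3 := h2.mul_right h1
  have h4 := h3.add_mul_left_right 1
  convert h4 using 1
  simp only [map_add, map_mul, map_one]
  ring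

theorem Coprime.symm {a b : M.Num} (h : Coprime a b) : Coprime b a :=
  coprime_iff.2 (coprime_iff.1 h).symm

theorem Coprime.mul_left {a b c : M.Num} (h : Coprime a c) (h' : Coprime b c) :
    Coprime (a * b) c := by
  rw [coprime_iff, map_mul]
  exact (coprime_iff.1 h).mul_left (coprime_iff.1 h')

theorem Coprime.not_dvd {c m : M.Num} (h : Coprime c m) (hm : 1 < m) : ¬ m ∣ c := by
  rintro ⟨q, rfl⟩
  obtain ⟨x, y, z, w, h⟩ := h
  have h1 : (m : M.RatField) * (x * q + y) = m * (z * q + w) + 1 := by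
    have := congrArg (fun n : M.Num => (n : M.RatField)) h
    push_cast at this
    linear_combination this
  have hm' : (1 : M.RatField) < m := by exact_mod_cast hm
  rcases lt_or_ge (z * q + w) (x * q + y) with h2 | h2
  · have h3 := Num.coe_add_one_le h2
    push_cast at h3
    nlinarith
  · have h3 : ((x * q + y : M.Num) : M.RatField) ≤ (z * q + w : M.Num) := by exact_mod_cast h2
    push_cast at h3
    nlinarith

/-- Every bounded initial part of a set with a bounded definition has a code. -/
theorem exists_inCode_iff {A : M.Num → Prop} (hA : Bdd fun e : M.Env => A (e 0)) (n : M.Num) :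
    ∃ c d, ∀ i, i < n → (InCode c d i ↔ A i) := by
  obtain ⟨d, hd0, hd⟩ := exists_common_multiple n
  have hA' : ∀ f : M.Env → M.Num, [Tm f] → Bdd fun e => A (f e) := fun f => hA.comp₁ f
  have hsig : Sig fun e : M.Env => ∃ c, ∀ i, i < n → (i < e 0 ∧ A i → InCode c d i) ∧
      ((i < e 0 ∧ A i) ∨ ∃ x y z w, x * c + y * (1 + (i + 1) * d) =
        z * c + w * (1 + (i + 1) * d) + 1) := inferInstance
  -- `c` is built as the product of the moduli of the elements below `k`. Coprimality to the other
  -- moduli, unlike mere non-divisibility, survives multiplication by a further coprime modulus.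
  have key : ∀ k, ∃ c, ∀ i, i < n → (i < k ∧ A i → InCode c d i) ∧
      ((i < k ∧ A i) ∨ Coprime c (1 + (i + 1) * d)) := by
    refine sig_induction hM.out hsig ⟨1, fun i _ => ⟨fun h => (Arith.not_lt_zero _ h.1).elim,
      Or.inr ⟨1, 0, 0, 0, by ring⟩⟩⟩ fun k ⟨c, hc⟩ => ?_
    by_cases hk : k < n ∧ A k
    · refine ⟨c * (1 + (k + 1) * d), fun i hi => ⟨fun ⟨hik, hAi⟩ => ?_, ?_⟩⟩
      · rw [inCode_iff]
        rcases (Num.lt_add_one_iff.1 hik).lt_or_eq with hik | rfl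
        · exact Dvd.dvd.mul_right (inCode_iff.1 ((hc i hi).1 ⟨hik, hAi⟩)) _
        · exact Dvd.intro_left c rfl
      · rcases (hc i hi).2 with h | h
        · exact Or.inl ⟨h.1.trans (Num.lt_add_one k), h.2⟩
        · rcases lt_trichotomy i k with h' | rfl | h'
          · exact Or.inr (h.mul_left (coprime_moduli hd h' hk.1).symm)
          · exact Or.inl ⟨Num.lt_add_one i, hk.2⟩
          · exact Or.inr (h.mul_left (coprime_moduli hd h' hi))
    · refine ⟨c, fun i hi => ⟨fun ⟨hik, hAi⟩ => (hc i hi).1 ⟨?_, hAi⟩, ?_⟩⟩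
      · exact (Num.lt_add_one_iff.1 hik).lt_of_ne fun h => hk ⟨h ▸ hi, h ▸ hAi⟩
      · exact (hc i hi).2.imp_left fun h => ⟨h.1.trans (Num.lt_add_one k), h.2⟩
  obtain ⟨c, hc⟩ := key n
  refine ⟨c, d, fun i hi => ⟨fun h => ?_, fun h => (hc i hi).1 ⟨hi, h⟩⟩⟩
  rcases (hc i hi).2 with h' | h'
  · exact h'.2
  · refine (h'.not_dvd ?_ (inCode_iff.1 h)).elim
    exact lt_add_of_pos_right _ (mul_pos (Num.zero_le i |>.trans_lt (Num.lt_add_one i))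
      (Num.pos_of_ne_zero hd0))

/-! ### Powers of two -/

theorem pair_le_pair {i j i' j' : M.Num} (h : i ≤ i') (h' : j ≤ j') : pair i j ≤ pair i' j' := by
  unfold pair
  gcongr

/-- `y = 2 ^ k`. -/
def IsPow (k y : M.Num) : Prop := ∃ c d, InCode c d (pair k y) ∧
  -- The coded set is a history of repeated doubling: each entry is the initial pair or comes from
  -- an earlier entry.
  ∀ z, z ≤ pair k y → InCode c d z → z = pair 0 1 ∨
    ∃ i, i ≤ z ∧ ∃ w, w ≤ z ∧ z = pair (i + 1) (2 * w) ∧ InCode c d (pair i w)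

instance IsPow.instSig (f g : M.Env → M.Num) [hf : Tm f] [hg : Tm g] :
    Sig fun e => IsPow (f e) (g e) :=
  Sig.comp₂ (R := IsPow) (inferInstance : Sig fun e : M.Env =>
    ∃ c d, InCode c d (pair (e 0) (e 1)) ∧
    ∀ z, z ≤ pair (e 0) (e 1) → InCode c d z → z = pair 0 1 ∨
      ∃ i, i ≤ z ∧ ∃ w, w ≤ z ∧ z = pair (i + 1) (2 * w) ∧ InCode c d (pair i w)) f g

theorem isPow_zero : IsPow (0 : M.Num) 1 := by
  obtain ⟨c, d, h⟩ := exists_inCode_iff (M := M) (A := fun z => z = pair 0 1) inferInstance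
    (pair 0 1 + 1)
  exact ⟨c, d, (h _ (Num.lt_add_one _)).2 rfl, fun z hz hz' =>
    Or.inl ((h z (Num.lt_add_one_iff.2 hz)).1 hz')⟩

theorem IsPow.succ {k y : M.Num} (hk : IsPow k y) : IsPow (k + 1) (2 * y) := by
  obtain ⟨c, d, h1, h2⟩ := hk
  obtain ⟨c', d', h⟩ := exists_inCode_iff (M := M)
    (A := fun z => (z ≤ pair k y ∧ InCode c d z) ∨ z = pair (k + 1) (2 * y)) inferInstance
    (pair (k + 1) (2 * y) + 1)
  have hle : ∀ i w : M.Num, pair i w ≤ pair (i + 1) (2 * w) := fun i w =>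
    pair_le_pair le_self_add (by rw [two_mul]; exact le_self_add)
  refine ⟨c', d', (h _ (Num.lt_add_one _)).2 (Or.inr rfl), fun z hz hz' => ?_⟩
  rcases (h z (Num.lt_add_one_iff.2 hz)).1 hz' with ⟨hzk, hz⟩ | rfl
  · refine (h2 z hzk hz).imp_right ?_
    rintro ⟨i, hi, w, hw, rfl, hiw⟩
    refine ⟨i, hi, w, hw, rfl, (h _ (Num.lt_add_one_iff.2 ?_)).2 (Or.inl ⟨?_, hiw⟩)⟩
    · exact (hle i w).trans (hzk.trans (hle k y))
    · exact (hle i w).trans hzk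
  · refine Or.inr ⟨k, (hle k y).trans' (left_le_pair _ _), y, (hle k y).trans' (right_le_pair _ _),
      rfl, (h _ (Num.lt_add_one_iff.2 (hle k y))).2 (Or.inl ⟨le_rfl, h1⟩)⟩

theorem IsPow.eq_one {y : M.Num} (h : IsPow 0 y) : y = 1 := by
  obtain ⟨c, d, h1, h2⟩ := h
  rcases h2 _ le_rfl h1 with h | ⟨i, -, w, -, h, -⟩
  · exact (pair_injective h).2
  · exact absurd (pair_injective h).1.symm (hM.out.basic.succ_ne_zero i)

theorem IsPow.exists_half {k y : M.Num} (h : IsPow (k + 1) y) : ∃ w, y = 2 * w ∧ IsPow k w := by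
  obtain ⟨c, d, h1, h2⟩ := h
  rcases h2 _ le_rfl h1 with h | ⟨i, -, w, -, h, hiw⟩
  · exact absurd (pair_injective h).1 (hM.out.basic.succ_ne_zero k)
  · obtain ⟨hki, rfl⟩ := pair_injective h
    obtain rfl := add_right_cancel hki
    refine ⟨w, rfl, c, d, hiw, fun z hz => h2 z (hz.trans ?_)⟩
    exact pair_le_pair le_self_add (by rw [two_mul]; exact le_self_add)

theorem exists_isPow (k : M.Num) : ∃ y, IsPow k y :=
  num_induction (P := fun k => ∃ y, IsPow k y) ⟨1, isPow_zero⟩ (fun _ ⟨y, h⟩ => ⟨2 * y, h.succ⟩) k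

/-- Existence of the power is a `Σ⁰₁` statement, but uniqueness is `Π⁰₁` and needs `pi_induction`.
-/
theorem IsPow.unique {k : M.Num} : ∀ {y y'}, IsPow k y → IsPow k y' → y = y' := by
  have : Sig fun e : M.Env => ¬ ∀ y y', IsPow (e 0) y → IsPow (e 0) y' → y = y' :=
    (inferInstance : Sig fun e : M.Env => ∃ y y', IsPow (e 0) y ∧ IsPow (e 0) y' ∧ ¬ y = y').congr
      fun e => by push Not; rfl
  refine @(pi_induction (P := fun k => ∀ y y', IsPow k y → IsPow k y' → y = y') ?_ ?_ k)
  · intro y y' h h'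
    rw [h.eq_one, h'.eq_one]
  · intro k ih y y' h h'
    obtain ⟨w, rfl, hw⟩ := h.exists_half
    obtain ⟨w', rfl, hw'⟩ := h'.exists_half
    rw [ih w w' hw hw']

/-- The function `k ↦ 2 ^ k`. -/
noncomputable def pow2 (k : M.Num) : M.Num := (exists_isPow k).choose

theorem isPow_iff {k y : M.Num} : IsPow k y ↔ pow2 k = y :=
  ⟨fun h => (exists_isPow k).choose_spec.unique h, fun h => h ▸ (exists_isPow k).choose_spec⟩

instance : SigFun (pow2 (M := M)) :=
  ⟨(inferInstance : Sig fun e : M.Env => IsPow (e 0) (e 1)).congr fun _ => isPow_iff⟩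

theorem pow2_zero : pow2 (0 : M.Num) = 1 := isPow_iff.1 isPow_zero

theorem pow2_succ (k : M.Num) : pow2 (k + 1) = 2 * pow2 k :=
  isPow_iff.1 (isPow_iff.2 rfl : IsPow k (pow2 k)).succ

end

end L2Structure

namespace L2Structure

section

variable {M : L2Structure.{u}} [hM : Fact M.ModelsRCA0]

/-! ### Definability of relations between fractions -/

/-- Fraction-valued functions of the assignment that are given by terms. -/
class FracTm (q : M.Env → M.Frac) : Prop where
  pos : Tm fun e => (q e).pos
  neg : Tm fun e => (q e).neg
  den : Tm fun e => (q e).den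

omit hM in
theorem FracTm.shift {q : M.Env → M.Frac} (hq : FracTm q) :
    FracTm fun e => q fun i => e (i + 1) :=
  ⟨hq.pos.shift, hq.neg.shift, hq.den.shift⟩

section

variable (q r s : M.Env → M.Frac) [hq : FracTm q] [hr : FracTm r] [hs : FracTm s]

instance FracTm.instPos : Tm fun e => (q e).pos := hq.pos
instance FracTm.instNeg : Tm fun e => (q e).neg := hq.neg
instance FracTm.instDen : Tm fun e => (q e).den := hq.den

instance FracTm.instMk (f g h : M.Env → M.Num) [hf : Tm f] [hg : Tm g] [hh : Tm h] :
    FracTm fun e => ⟨f e, g e, h e⟩ where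
  pos := hf
  neg := hg
  den := hh

instance FracTm.instInvSucc (f : M.Env → M.Num) [hf : Tm f] :
    FracTm fun e => Frac.invSucc (f e) where
  pos := inferInstanceAs (Tm fun _ => (1 : M.Num))
  neg := inferInstanceAs (Tm fun _ => (0 : M.Num))
  den := hf

instance FracTm.instAdd : FracTm fun e => (q e).add (r e) where
  pos := inferInstanceAs (Tm fun e => (q e).pos * ((r e).den + 1) + (r e).pos * ((q e).den + 1))
  neg := inferInstanceAs (Tm fun e => (q e).neg * ((r e).den + 1) + (r e).neg * ((q e).den + 1))
  den := inferInstanceAs (Tm fun e => (q e).den * (r e).den + (q e).den + (r e).den)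

instance FracTm.instSub : FracTm fun e => (q e).sub (r e) :=
  inferInstanceAs (FracTm fun e => (q e).add ⟨(r e).neg, (r e).pos, (r e).den⟩)

instance FracTm.instCode : Tm fun e => (q e).code :=
  inferInstanceAs (Tm fun e => pair (q e).pos (pair (q e).neg (q e).den))

instance Frac.Lt.instBdd : Bdd fun e => (q e).Lt (r e) :=
  inferInstanceAs (Bdd fun e => (q e).pos * ((r e).den + 1) + (r e).neg * ((q e).den + 1) <
    (r e).pos * ((q e).den + 1) + (q e).neg * ((r e).den + 1))

instance Frac.Le.instBdd : Bdd fun e => (q e).Le (r e) :=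
  inferInstanceAs (Bdd fun e => ¬ (r e).Lt (q e))

instance Frac.DistLt.instBdd : Bdd fun e => (q e).DistLt (r e) (s e) :=
  inferInstanceAs (Bdd fun e => (q e).Lt ((r e).add (s e)) ∧ (r e).Lt ((q e).add (s e)))

end

instance Term.instBdd (x : Set M.Num) (f : M.Env → M.Num) (q : M.Env → M.Frac) [hx : InSets x]
    [hf : Tm f] [hq : FracTm q] : Bdd fun e => Term x (f e) (q e) :=
  inferInstanceAs (Bdd fun e => pair (f e) (q e).code ∈ x)

theorem Frac.pos_le_code (q : M.Frac) : q.pos ≤ q.code := left_le_pair _ _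

theorem Frac.neg_le_code (q : M.Frac) : q.neg ≤ q.code :=
  (left_le_pair _ _).trans (right_le_pair _ _)

theorem Frac.den_le_code (q : M.Frac) : q.den ≤ q.code :=
  (right_le_pair _ _).trans (right_le_pair _ _)

instance Bdd.instBexFrac (f : M.Env → M.Num) (P : M.Frac → M.Env → Prop) [hf : Tm f]
    [hP : Bdd fun e => P ⟨e 2, e 1, e 0⟩ fun i => e (i + 3)] :
    Bdd fun e => ∃ q : M.Frac, q.code ≤ f e ∧ P q e := by
  have hf₁ := hf.shift
  have hf₂ := hf₁.shift
  have hf₃ := hf₂.shift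
  have : Bdd fun e : M.Env => ∃ p, p ≤ f e ∧ ∃ n, n ≤ f e ∧ ∃ d, d ≤ f e ∧
      ((⟨p, n, d⟩ : M.Frac).code ≤ f e ∧ P ⟨p, n, d⟩ e) := inferInstance
  refine this.congr fun e => ⟨?_, ?_⟩
  · rintro ⟨p, -, n, -, d, -, h⟩
    exact ⟨_, h⟩
  · rintro ⟨q, hq, h⟩
    exact ⟨_, q.pos_le_code.trans hq, _, q.neg_le_code.trans hq, _, q.den_le_code.trans hq, hq, h⟩

instance Sig.instExFrac (P : M.Frac → M.Env → Prop)
    [hP : Sig fun e => P ⟨e 2, e 1, e 0⟩ fun i => e (i + 3)] :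
    Sig fun e => ∃ q : M.Frac, P q e :=
  (inferInstance : Sig fun e => ∃ p n d, P ⟨p, n, d⟩ e).congr fun _ =>
    ⟨fun ⟨_, _, _, h⟩ => ⟨_, h⟩, fun ⟨q, h⟩ => ⟨q.pos, q.neg, q.den, h⟩⟩

/-! ### Real numbers as sequences of rationals -/

/-- The sequence `f` lists the terms of the real `x`. -/
def Lists (f : M.Num → M.Frac) (x : Set M.Num) : Prop := ∀ k q, Term x k q ↔ q = f k

omit hM in
theorem IsReal.exists_lists {x : Set M.Num} (hx : IsReal x) :
    ∃ f : M.Num → M.Frac, Lists f x := by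
  choose f hf hf' using hx.2.1
  exact ⟨f, fun k q => ⟨hf' k q, fun h => h ▸ hf k⟩⟩

theorem one_div_pos (k : M.Num) : (0 : M.RatField) < 1 / (k + 1) := by
  have := Num.coe_add_one_pos k
  positivity

theorem exists_one_div_lt {x : M.RatField} (hx : 0 < x) (m : M.Num) :
    ∃ n, m ≤ n ∧ 1 / ((n : M.RatField) + 1) < x := by
  obtain ⟨n, hn⟩ := Num.exists_inv_lt hx
  refine ⟨m + n, le_self_add, lt_of_le_of_lt ?_ hn⟩
  have h1 := Num.coe_add_one_pos n
  have h2 := Num.coe_nonneg m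
  refine one_div_le_one_div_of_le h1 ?_
  push_cast
  linarith

section

variable {f g h : M.Num → M.Frac} {x y z : Set M.Num}

theorem Lists.dist_le (hf : Lists f x) (hx : IsReal x) (k i : M.Num) :
    |(f k).val - (f (k + i)).val| ≤ 1 / ((k : M.RatField) + 1) := by
  have := hx.2.2 k i (f k) (f (k + i)) ((hf _ _).2 rfl) ((hf _ _).2 rfl)
  rwa [Frac.distLe_iff, Frac.val_invSucc] at this

theorem Lists.dist_le_add (hf : Lists f x) (hx : IsReal x) (j k : M.Num) :
    |(f j).val - (f k).val| ≤ 1 / ((j : M.RatField) + 1) + 1 / ((k : M.RatField) + 1) := by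
  have hj := one_div_pos j
  have hk := one_div_pos k
  rcases le_total j k with h | h
  · obtain ⟨i, rfl⟩ := exists_add_of_le h
    linarith [hf.dist_le hx j i]
  · obtain ⟨i, rfl⟩ := exists_add_of_le h
    rw [abs_sub_comm]
    linarith [hf.dist_le hx k i]

theorem Lists.realRatDistLt_iff (hf : Lists f x) {a r : M.Frac} :
    RealRatDistLt x a r ↔ ∃ k : M.Num, |(f k).val - a.val| < r.val - 1 / ((k : M.RatField) + 1) := by
  constructor
  · rintro ⟨k, q, hq, h⟩
    rw [hf] at hq
    subst hq
    rw [Frac.distLt_iff, Frac.val_sub, Frac.val_invSucc] at h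
    exact ⟨k, h⟩
  · rintro ⟨k, h⟩
    exact ⟨k, f k, (hf _ _).2 rfl, by rwa [Frac.distLt_iff, Frac.val_sub, Frac.val_invSucc]⟩

theorem Lists.realRatDistLe_iff (hf : Lists f x) {a r : M.Frac} :
    RealRatDistLe x a r ↔ ∀ k : M.Num, |(f k).val - a.val| ≤ r.val + 1 / ((k : M.RatField) + 1) := by
  constructor
  · intro h k
    have := h k (f k) ((hf _ _).2 rfl)
    rwa [Frac.distLe_iff, Frac.val_add, Frac.val_invSucc] at this
  · intro h k q hq
    rw [hf] at hq
    subst hq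
    rw [Frac.distLe_iff, Frac.val_add, Frac.val_invSucc]
    exact h k

theorem Lists.realPos_iff (hf : Lists f x) :
    RealPos x ↔ ∃ k : M.Num, 1 / ((k : M.RatField) + 1) < (f k).val := by
  constructor
  · rintro ⟨k, q, hq, h⟩
    rw [hf] at hq
    subst hq
    rw [Frac.lt_iff, Frac.val_invSucc] at h
    exact ⟨k, h⟩
  · rintro ⟨k, h⟩
    exact ⟨k, f k, (hf _ _).2 rfl, by rwa [Frac.lt_iff, Frac.val_invSucc]⟩

theorem Lists.inUnitInterval (hf : Lists f x) (hx : InUnitInterval x) (k : M.Num) :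
    -(1 / ((k : M.RatField) + 1)) ≤ (f k).val ∧ (f k).val ≤ 1 + 1 / ((k : M.RatField) + 1) := by
  have := hx.2 k (f k) ((hf _ _).2 rfl)
  simp only [Frac.le_iff, Frac.val_add, Frac.val_invSucc, Frac.val_zero, Frac.val_one] at this
  exact ⟨by linarith [this.1], this.2⟩

theorem Lists.realLe (hf : Lists f x) (hg : Lists g y) (h : RealLe x y) (k : M.Num) :
    (f k).val ≤ (g k).val + 2 * (1 / ((k : M.RatField) + 1)) := by
  have := h k (f k) (g k) ((hf _ _).2 rfl) ((hg _ _).2 rfl)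
  simp only [Frac.le_iff, Frac.val_add, Frac.val_invSucc] at this
  linarith

theorem Lists.exists_of_realDistLt (hf : Lists f x) (hg : Lists g y) (hh : Lists h z)
    (H : RealDistLt x y z) :
    ∃ k : M.Num, |(f k).val - (g k).val| < (h k).val - 3 * (1 / ((k : M.RatField) + 1)) := by
  obtain ⟨k, q, a, s, hq, ha, hs, H⟩ := H
  rw [hf] at hq
  rw [hg] at ha
  rw [hh] at hs
  subst hq ha hs
  simp only [Frac.distLt_iff, Frac.val_sub, Frac.val_invSucc] at H
  exact ⟨k, by linarith⟩

end

theorem exists_real (f : M.Num → M.Frac) [hf : SigFun fun k => (f k).code]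
    (h : ∀ k i : M.Num, |(f k).val - (f (k + i)).val| ≤ 1 / ((k : M.RatField) + 1)) :
    ∃ y ∈ M.sets, IsReal y ∧ Lists f y := by
  have hl : Lists f {z | ∃ k, z = pair k (f k).code} := by
    intro k q
    constructor
    · rintro ⟨k', h⟩
      obtain ⟨rfl, h⟩ := pair_injective h
      exact Frac.code_injective h
    · rintro rfl
      exact ⟨k, rfl⟩
  refine ⟨_, graph_mem_sets fun k => (f k).code, ⟨?_, ?_, ?_⟩, hl⟩
  · rintro z ⟨k, rfl⟩
    exact ⟨k, f k, rfl⟩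
  · exact fun k => ⟨f k, (hl _ _).2 rfl, fun q hq => (hl _ _).1 hq⟩
  · intro k i q r hq hr
    rw [hl] at hq hr
    subst hq hr
    rw [Frac.distLe_iff, Frac.val_invSucc]
    exact h k i

end

end L2Structure

/-! ### Powers of two as the levels of binary strings -/

namespace L2Structure

section

variable {M : L2Structure.{u}} [hM : Fact M.ModelsRCA0]

@[simp, norm_cast]
theorem Num.coe_two : ((2 : M.Num) : M.RatField) = 2 := by
  rw [← one_add_one_eq_two, Num.coe_add, Num.coe_one, one_add_one_eq_two]

theorem pow2_pos (k : M.Num) : 0 < pow2 k := by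
  refine num_induction (P := fun k => 0 < pow2 k) (hP := ?_) ?_ (fun k h => ?_) k
  -- `pow2` is not a term; formulas reach it through its graph, with the value as a quantified
  -- variable.
  · exact (inferInstance : Sig fun e : M.Env => ∃ u, pow2 (e 0) = u ∧ 0 < u).congr fun e => by simp
  · rw [pow2_zero]
    exact zero_lt_one
  · rw [pow2_succ]
    exact mul_pos two_pos h

theorem pow2_add (j k : M.Num) : pow2 (j + k) = pow2 j * pow2 k := by
  refine num_induction (P := fun k => pow2 (j + k) = pow2 j * pow2 k) (hP := ?_) ?_
    (fun k h => ?_) k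
  · exact (inferInstance : Sig fun e : M.Env =>
      ∃ u v, pow2 (j + e 0) = u ∧ pow2 (e 0) = v ∧ u = pow2 j * v).congr fun e => by simp
  · rw [pow2_zero, add_zero, mul_one]
  · rw [← add_assoc, pow2_succ, pow2_succ, h]
    ring

theorem lt_pow2 (k : M.Num) : k < pow2 k := by
  refine num_induction (P := fun k => k < pow2 k) (hP := ?_) ?_ (fun k h => ?_) k
  · exact (inferInstance : Sig fun e : M.Env => ∃ u, pow2 (e 0) = u ∧ e 0 < u).congr
      fun e => by simp
  · exact pow2_pos 0
  · rw [pow2_succ, two_mul]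
    exact add_lt_add_of_lt_of_le h (Num.add_one_le_iff.2 (pow2_pos k)|>.trans' (by rw [zero_add]))

theorem two_mul_pow2_le {j k : M.Num} (h : j < k) : 2 * pow2 j ≤ pow2 k := by
  obtain ⟨c, rfl⟩ := Num.lt_iff_exists.1 h
  rw [pow2_add, pow2_succ, mul_comm, mul_le_mul_iff_right₀ (pow2_pos j)]
  refine le_mul_of_one_le_right (Num.zero_le 2) ?_
  rw [← zero_add (1 : M.Num)]
  exact Num.add_one_le_iff.2 (pow2_pos c)

variable (M) in
/-- The set of powers of two. -/
def powers : Set M.Num := Set.range pow2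

theorem powers_pos {u : M.Num} (hu : u ∈ M.powers) : 0 < u := by
  obtain ⟨k, rfl⟩ := hu
  exact pow2_pos k

theorem one_mem_powers : (1 : M.Num) ∈ M.powers := ⟨0, pow2_zero⟩

theorem two_mul_mem_powers {u : M.Num} (hu : u ∈ M.powers) : 2 * u ∈ M.powers := by
  obtain ⟨k, rfl⟩ := hu
  exact ⟨k + 1, pow2_succ k⟩

theorem two_mem_powers : (2 : M.Num) ∈ M.powers := by
  have := two_mul_mem_powers (one_mem_powers (M := M))
  rwa [mul_one] at this

theorem mul_mem_powers {u v : M.Num} (hu : u ∈ M.powers) (hv : v ∈ M.powers) :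
    u * v ∈ M.powers := by
  obtain ⟨k, rfl⟩ := hu
  obtain ⟨j, rfl⟩ := hv
  exact ⟨k + j, pow2_add k j⟩

theorem exists_mem_powers_gt (x : M.RatField) : ∃ u ∈ M.powers, x < (u : M.RatField) := by
  obtain ⟨n, hn⟩ := Num.exists_gt x
  exact ⟨pow2 n, ⟨n, rfl⟩, hn.trans (by exact_mod_cast lt_pow2 n)⟩

/-- No power of two lies strictly between `u` and `2 * u`. This turns estimates between rationals
into comparisons of levels. -/
theorem le_of_lt_two_mul {u v : M.Num} (hu : u ∈ M.powers) (hv : v ∈ M.powers)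
    (h : v < 2 * u) : v ≤ u := by
  obtain ⟨k, rfl⟩ := hu
  obtain ⟨j, rfl⟩ := hv
  by_contra! h'
  rcases lt_trichotomy j k with hjk | rfl | hjk
  · refine not_lt.2 (two_mul_pow2_le hjk) (h'.trans_le ?_)
    rw [two_mul]
    exact le_self_add
  · exact lt_irrefl _ h'
  · exact not_lt.2 (two_mul_pow2_le hjk) h

theorem exists_eq_mul_pow2 {u v : M.Num} (hu : u ∈ M.powers) (hv : v ∈ M.powers)
    (h : u ≤ v) : ∃ i, v = u * pow2 i := by
  obtain ⟨k, rfl⟩ := hu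
  obtain ⟨j, rfl⟩ := hv
  rcases lt_or_ge j k with hjk | hjk
  · refine (not_lt.2 h (lt_of_lt_of_le ?_ (two_mul_pow2_le hjk))).elim
    rw [two_mul]
    exact lt_add_of_pos_left (pow2 j) (pow2_pos j)
  · obtain ⟨i, rfl⟩ := exists_add_of_le hjk
    exact ⟨i, pow2_add k i⟩

theorem exists_level {n : M.Num} (hn : n ≠ 0) : ∃ k, pow2 k ≤ n ∧ n < 2 * pow2 k := by
  have key : n = 0 ∨ ∃ k, pow2 k ≤ n ∧ n < 2 * pow2 k := by
    refine num_induction (P := fun n => n = 0 ∨ ∃ k, pow2 k ≤ n ∧ n < 2 * pow2 k) (hP := ?_)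
      (Or.inl rfl) (fun n h => Or.inr ?_) n
    · exact (inferInstance : Sig fun e : M.Env => e 0 = 0 ∨ ∃ k u, pow2 k = u ∧ u ≤ e 0 ∧
        e 0 < 2 * u).congr fun e => by simp
    · rcases h with rfl | ⟨k, h1, h2⟩
      · exact ⟨0, by rw [pow2_zero, zero_add], by simp [pow2_zero]⟩
      · rcases lt_or_ge (n + 1) (2 * pow2 k) with h3 | h3
        · exact ⟨k, h1.trans le_self_add, h3⟩
        · refine ⟨k + 1, by rwa [pow2_succ], ?_⟩
          rw [pow2_succ]
          refine lt_of_le_of_lt (Num.add_one_le_iff.2 h2) ?_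
          exact lt_mul_of_one_lt_left (mul_pos two_pos (pow2_pos k)) one_lt_two
  exact key.resolve_left hn

instance : InSets M.powers := by
  obtain ⟨X, hX, h⟩ := exists_set hM.out (P := fun n => n ∈ M.powers)
    (inferInstance : Sig fun e : M.Env => ∃ k, pow2 k = e 0)
    -- The complement consists of zero and the numbers strictly between two consecutive powers.
    ((inferInstance : Sig fun e : M.Env => e 0 = 0 ∨ ∃ k u, pow2 k = u ∧ u < e 0 ∧
      e 0 < 2 * u).congr fun e => by
        constructor
        · rintro (h | ⟨k, u, rfl, h1, h2⟩) h'
          · exact (powers_pos h').ne' h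
          · exact not_lt.2 (le_of_lt_two_mul ⟨k, rfl⟩ h' h2) h1
        · intro h
          refine or_iff_not_imp_left.2 fun h0 => ?_
          obtain ⟨k, h1, h2⟩ := exists_level h0
          exact ⟨k, _, rfl, h1.lt_of_ne fun h3 => h ⟨k, h3⟩, h2⟩)
  have : M.powers = X := Set.ext fun n => (h n).symm
  exact ⟨this ▸ hX⟩

/-! ### Trees -/

theorem exists_half (n : M.Num) : ∃ m, n = 2 * m ∨ n = 2 * m + 1 := by
  refine num_induction (P := fun n => ∃ m, n = 2 * m ∨ n = 2 * m + 1) ⟨0, by simp⟩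
    (fun n ⟨m, h⟩ => ?_) n
  rcases h with rfl | rfl
  · exact ⟨m, Or.inr rfl⟩
  · exact ⟨m + 1, Or.inl (by ring)⟩

section

variable {T : Set M.Num} (hT : IsBinTree T)

include hT

/-- Deleting the last `i` digits of the string is taking the quotient of `n` by `2 ^ i`. -/
theorem IsBinTree.exists_ancestor [hTs : InSets T] {n : M.Num} (hn : n ∈ T) (i : M.Num)
    (hi : pow2 i ≤ n) : ∃ m ∈ T, m * pow2 i ≤ n ∧ n < (m + 1) * pow2 i := by
  -- The first alternative covers `i` beyond the length of the string, so that the induction runs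
  -- over all `i`.
  have key : n < pow2 i ∨ ∃ m ∈ T, m * pow2 i ≤ n ∧ n < (m + 1) * pow2 i := by
    refine num_induction (P := fun i => n < pow2 i ∨
      ∃ m ∈ T, m * pow2 i ≤ n ∧ n < (m + 1) * pow2 i) (hP := ?_) ?_ (fun i ih => ?_) i
    · exact (inferInstance : Sig fun e : M.Env => ∃ u, pow2 (e 0) = u ∧ (n < u ∨
        ∃ m, m ∈ T ∧ m * u ≤ n ∧ n < (m + 1) * u)).congr fun e => by simp
    · refine Or.inr ⟨n, hn, ?_, ?_⟩
      · rw [pow2_zero, mul_one]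
      · rw [pow2_zero, mul_one]
        exact Num.lt_add_one n
    · refine or_iff_not_imp_left.2 fun hni => ?_
      rw [not_lt, pow2_succ] at hni
      have hlt : pow2 i < 2 * pow2 i := lt_mul_of_one_lt_left (pow2_pos i) one_lt_two
      obtain ⟨m, hm, h1, h2⟩ := ih.resolve_left (not_lt.2 (hlt.le.trans hni))
      obtain ⟨m', hm'⟩ := exists_half m
      have hm0 : m' ≠ 0 := by
        rintro rfl
        refine not_lt.2 hni (h2.trans_le ?_)
        gcongr
        rcases hm' with rfl | rfl
        · rw [mul_zero, zero_add]
          exact one_le_two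
        · rw [mul_zero, zero_add, one_add_one_eq_two]
      refine ⟨m', (hT m hm).2 m' hm0 (by rwa [one_add_one_eq_two]), ?_, ?_⟩
      · rw [pow2_succ]
        refine le_trans ?_ h1
        rw [← mul_assoc, mul_comm m']
        gcongr
        rcases hm' with rfl | rfl
        exacts [le_rfl, le_self_add]
      · rw [pow2_succ]
        refine lt_of_lt_of_le h2 ?_
        rw [← mul_assoc, mul_comm _ (2 : M.Num), mul_add, mul_one]
        refine mul_le_mul_of_nonneg_right ?_ (Num.zero_le _)
        rcases hm' with rfl | rfl
        · exact add_le_add_right one_le_two _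
        · rw [add_assoc, one_add_one_eq_two]
  exact key.resolve_left (not_lt.2 hi)

/-- The ancestor at level `u` of a node at level `u * w`. -/
theorem IsBinTree.exists_ancestor_level [hTs : InSets T] {n u v : M.Num} (hn : n ∈ T)
    (hu : u ∈ M.powers) (hv : v ∈ M.powers) (huv : u ≤ v) (h1 : v ≤ n) (h2 : n < 2 * v) :
    ∃ w ∈ M.powers, v = u * w ∧ ∃ m ∈ T, u ≤ m ∧ m < 2 * u ∧ m * w ≤ n ∧ n < (m + 1) * w := by
  obtain ⟨i, rfl⟩ := exists_eq_mul_pow2 hu hv huv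
  have hw := pow2_pos i
  obtain ⟨m, hm, h3, h4⟩ := hT.exists_ancestor hn i
    ((le_mul_of_one_le_left (Num.zero_le _)
      (by rw [← zero_add (1 : M.Num)]; exact Num.add_one_le_iff.2 (powers_pos hu))).trans h1)
  refine ⟨_, ⟨i, rfl⟩, rfl, m, hm, ?_, ?_, h3, h4⟩
  · exact Num.lt_add_one_iff.1 (lt_of_mul_lt_mul_right (h1.trans_lt h4) hw.le)
  · rw [← mul_assoc] at h2
    exact lt_of_mul_lt_mul_right (h3.trans_lt h2) hw.le

theorem IsBinTree.exists_mem_level [hTs : InSets T] (hinf : IsInfinite T) {u : M.Num}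
    (hu : u ∈ M.powers) : ∃ n ∈ T, u ≤ n ∧ n < 2 * u := by
  -- A node larger than `2 * u` is on level `u` or deeper, and it is cut down to level `u`.
  obtain ⟨n, hn, h⟩ := hinf (2 * u)
  obtain ⟨k, hk1, hk2⟩ := exists_level (hT n hn).1
  have huk : u ≤ pow2 k := by
    by_contra! hlt
    refine not_lt.2 ?_ (h.trans hk2)
    gcongr
  obtain ⟨w, -, -, m, hm, h1, h2, -⟩ := hT.exists_ancestor_level hn hu ⟨k, rfl⟩ huk hk1 hk2
  exact ⟨m, hm, h1, h2⟩

end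

end

end L2Structure

namespace L2Structure

section

variable {M : L2Structure.{u}} [hM : Fact M.ModelsRCA0]

/-! ### The gauge of a tree -/

/-- The point `a` has distance at most `q` from the union of the intervals
`[n / u - 1, (n + 1) / u - 1]` of the nodes `n ∈ T` of level `u`. -/
def Near (T : Set M.Num) (u : M.Num) (a q : M.RatField) : Prop :=
  -- Denominators are cleared to keep the formula bounded. For negative `q` it says that `a` lies at
  -- depth at least `-q` inside one of the intervals.
  ∃ n, n < 2 * u ∧ n ∈ T ∧ u ≤ n ∧ (n : M.RatField) ≤ u * (1 + a + q) ∧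
    (u : M.RatField) * (1 + a - q) ≤ n + 1

/-- The levels `u` and `v` witness that the value of the gauge at `a` is at most `b + s - r` and
more than `b - s + r`. -/
def GaugeRel (T : Set M.Num) (u v : M.Num) (a r b s : M.RatField) : Prop :=
  0 ≤ a ∧ a ≤ 1 ∧ 0 < r ∧ 0 < s ∧
    -- Level `u` bounds the whole supremum at `a`: levels from `2 * u` on contribute at most `1 / (2
    -- * u)`, and nearness at `u` passes to the lower levels. The margin `r` absorbs the variation
    -- of a 1-Lipschitz function on the ball of radius `r`.
    1 ≤ 2 * (u : M.RatField) * (b + s - r) ∧ Near T u a (b + s - r) ∧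
    (v : M.RatField) * (b - s + r) < 1 ∧ ¬ Near T v a (b - s + r)

/-- The code of the gauge `x ↦ sup {min (1 / u) (d (x, K_u))}`, where `K_u` is the union of the
intervals of the nodes of level `u`. -/
def gaugeCode (T : Set M.Num) : Set M.Num :=
  {z | ∃ (n : M.Num) (a r b s : M.Frac), z = quint n a r b s ∧
    ∃ u, u ≤ n ∧ ∃ v, v ≤ n ∧ u ∈ M.powers ∧ v ∈ M.powers ∧ GaugeRel T u v a.val r.val b.val s.val}

theorem quint_injective {n n' : M.Num} {a r b s a' r' b' s' : M.Frac}
    (h : quint n a r b s = quint n' a' r' b' s') :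
    n = n' ∧ a = a' ∧ r = r' ∧ b = b' ∧ s = s' := by
  obtain ⟨h1, h⟩ := pair_injective h
  obtain ⟨h2, h⟩ := pair_injective h
  obtain ⟨h3, h⟩ := pair_injective h
  obtain ⟨h4, h5⟩ := pair_injective h
  exact ⟨h1, Frac.code_injective h2, Frac.code_injective h3, Frac.code_injective h4,
    Frac.code_injective h5⟩

section

variable (q r : M.Env → M.Frac) (f g : M.Env → M.Num) [hq : FracTm q] [hr : FracTm r] [hf : Tm f]
  [hg : Tm g]

instance Bdd.instLeMulVal : Bdd fun e => (f e : M.RatField) ≤ g e * (q e).val :=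
  (inferInstance : Bdd fun e => f e * ((q e).den + 1) + g e * (q e).neg ≤ g e * (q e).pos).congr
    fun e => by
      rw [Frac.val, ← mul_div_assoc, le_div_iff₀ (Num.coe_add_one_pos _), ← Num.coe_le]
      push_cast
      constructor <;> intro h <;> linarith

instance Bdd.instMulValLe : Bdd fun e => (g e : M.RatField) * (q e).val ≤ f e :=
  (inferInstance : Bdd fun e => g e * (q e).pos ≤ f e * ((q e).den + 1) + g e * (q e).neg).congr
    fun e => by
      rw [Frac.val, ← mul_div_assoc, div_le_iff₀ (Num.coe_add_one_pos _), ← Num.coe_le]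
      push_cast
      constructor <;> intro h <;> linarith

instance Near.instBdd (T : Set M.Num) [hT : InSets T] :
    Bdd fun e => Near T (f e) (q e).val (r e).val := by
  have hf₁ := hf.shift
  have hq₁ : FracTm fun e => q fun i => e (i + 1) := ⟨hq.pos.shift, hq.neg.shift, hq.den.shift⟩
  have hr₁ : FracTm fun e => r fun i => e (i + 1) := ⟨hr.pos.shift, hr.neg.shift, hr.den.shift⟩
  have : Bdd fun e => ∃ n, n < 2 * f e ∧ n ∈ T ∧ f e ≤ n ∧
      (n : M.RatField) ≤ f e * ((Frac.one.add (q e)).add (r e)).val ∧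
      (f e : M.RatField) * ((Frac.one.add (q e)).sub (r e)).val ≤ (n + 1 : M.Num) := inferInstance
  simp only [Frac.val_add, Frac.val_sub, Frac.val_one, Num.coe_add, Num.coe_one] at this
  exact this

end

-- The first entry `n` of a quintuple bounds both witnessing levels, and the quintuple bounds the
-- codes of its entries, so membership is a bounded formula.
set_option synthInstance.maxHeartbeats 400000 in
set_option synthInstance.maxSize 1000 in
instance gaugeCode.instInSets (T : Set M.Num) [hT : InSets T] : InSets (gaugeCode T) := by
  have h1 : Bdd fun e : M.Env => ∃ n, n ≤ e 0 ∧ ∃ a : M.Frac, a.code ≤ e 0 ∧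
    ∃ r : M.Frac, r.code ≤ e 0 ∧ ∃ b : M.Frac, b.code ≤ e 0 ∧ ∃ s : M.Frac, s.code ≤ e 0 ∧
      e 0 = pair n (pair a.code (pair r.code (pair b.code s.code))) ∧
      ∃ u, u ≤ n ∧ ∃ v, v ≤ n ∧ u ∈ M.powers ∧ v ∈ M.powers ∧
        Frac.zero.Le a ∧ a.Le Frac.one ∧ Frac.zero.Lt r ∧ Frac.zero.Lt s ∧
        ((1 : M.Num) : M.RatField) ≤ (2 * u : M.Num) * ((b.add s).sub r).val ∧
        Near T u a.val ((b.add s).sub r).val ∧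
        ¬ ((1 : M.Num) : M.RatField) ≤ v * ((b.sub s).add r).val ∧
        ¬ Near T v a.val ((b.sub s).add r).val := inferInstance
  have h2 : Bdd fun e : M.Env => e 0 ∈ gaugeCode T := h1.congr fun e => by
    simp only [Frac.le_iff, Frac.lt_iff, Frac.val_zero, Frac.val_one, Frac.val_add, Frac.val_sub,
      Num.coe_one, Num.coe_mul, Num.coe_two, not_le]
    constructor
    · rintro ⟨n, -, a, -, r, -, b, -, s, -, h, H⟩
      exact ⟨n, a, r, b, s, h, H⟩
    · rintro ⟨n, a, r, b, s, h, H⟩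
      have h1 := right_le_pair n (pair a.code (pair r.code (pair b.code s.code)))
      have h2 := (right_le_pair a.code (pair r.code (pair b.code s.code))).trans h1
      have h3 := (right_le_pair r.code (pair b.code s.code)).trans h2
      rw [h]
      exact ⟨n, left_le_pair _ _, a, (left_le_pair _ _).trans h1, r, (left_le_pair _ _).trans h2,
        b, (left_le_pair _ _).trans h3, s, (right_le_pair _ _).trans h3, rfl, H⟩
  obtain ⟨X, hX, h⟩ := exists_set hM.out (P := fun z => z ∈ gaugeCode T) inferInstance inferInstance
  have : gaugeCode T = X := Set.ext fun n => (h n).symm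
  exact ⟨this ▸ hX⟩

theorem codeRel_gaugeCode {T : Set M.Num} {a r b s : M.Frac} : CodeRel (gaugeCode T) a r b s ↔
    ∃ u ∈ M.powers, ∃ v ∈ M.powers, GaugeRel T u v a.val r.val b.val s.val := by
  constructor
  · rintro ⟨n, n', a', r', b', s', h, u, -, v, -, hu, hv, H⟩
    obtain ⟨-, rfl, rfl, rfl, rfl⟩ := quint_injective h
    exact ⟨u, hu, v, hv, H⟩
  · rintro ⟨u, hu, v, hv, H⟩
    exact ⟨u + v, u + v, a, r, b, s, rfl, u, le_self_add, v, le_add_self, hu, hv, H⟩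

section

variable {T : Set M.Num} {u v : M.Num} {a a' q q' : M.RatField}

theorem Near.mono (h : Near T u a q) (hq : |a - a'| ≤ q' - q) : Near T u a' q' := by
  obtain ⟨n, h1, h2, h3, h4, h5⟩ := h
  rw [abs_le] at hq
  have hu := Num.coe_nonneg u
  refine ⟨n, h1, h2, h3, h4.trans ?_, h5.trans' ?_⟩
  · exact mul_le_mul_of_nonneg_left (by linarith [hq.1]) hu
  · exact mul_le_mul_of_nonneg_left (by linarith [hq.2]) hu

theorem Near.mono_right (h : Near T u a q) (hq : q ≤ q') : Near T u a q' :=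
  h.mono (by simpa using hq)

/-- The interval of a node is contained in the interval of its ancestor. -/
theorem Near.of_le [hTs : InSets T] (hT : IsBinTree T) (hu : u ∈ M.powers) (hv : v ∈ M.powers)
    (huv : u ≤ v) (h : Near T v a q) : Near T u a q := by
  obtain ⟨n, h1, h2, h3, h4, h5⟩ := h
  obtain ⟨w, hw, rfl, m, hm, h6, h7, h8, h9⟩ := hT.exists_ancestor_level h2 hu hv huv h3 h1
  have hw' : (0 : M.RatField) < w := by exact_mod_cast powers_pos hw
  have h8' : (m : M.RatField) * w ≤ n := by exact_mod_cast h8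
  have h9' := Num.coe_add_one_le h9
  push_cast at h4 h5 h9'
  refine ⟨m, h7, hm, h6, ?_, ?_⟩
  · exact le_of_mul_le_mul_right (by linarith) hw'
  · exact le_of_mul_le_mul_right (by linarith) hw'

/-- The gauge has at most one value at each rational. -/
theorem lt_of_near_of_not_near [hTs : InSets T] (hT : IsBinTree T) (hu : u ∈ M.powers)
    (hv : v ∈ M.powers) (h1 : 1 ≤ 2 * (u : M.RatField) * q) (h2 : Near T u a q)
    (h3 : (v : M.RatField) * q' < 1) (h4 : ¬ Near T v a q') : q' < q := by
  by_contra! hq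
  have hu0 := Num.coe_nonneg u
  have hq0 : 0 < q := by
    by_contra! h
    nlinarith
  -- If `q ≤ q'`, then `v * q' < 1 ≤ 2 * u * q'`, so `v < 2 * u` and the nearness at `u` passes down
  -- to `v`.
  have hvu : v ≤ u := by
    refine le_of_lt_two_mul hu hv ?_
    have h5 : (v : M.RatField) * q' < 2 * u * q' :=
      h3.trans_le (h1.trans (mul_le_mul_of_nonneg_left hq (by positivity)))
    exact_mod_cast lt_of_mul_lt_mul_right h5 (hq0.le.trans hq)
  exact h4 ((h2.mono_right hq).of_le hT hv hu hvu)

end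

/-- This makes a precise value come with a small ball: a small `s` forces a small `r`. -/
theorem GaugeRel.radius_lt {T : Set M.Num} [hTs : InSets T] (hT : IsBinTree T) {u v : M.Num}
    (hu : u ∈ M.powers) (hv : v ∈ M.powers) {a r b s : M.RatField} (h : GaugeRel T u v a r b s) :
    r < s := by
  obtain ⟨-, -, -, -, h1, h2, h3, h4⟩ := h
  linarith [lt_of_near_of_not_near hT hu hv h1 h2 h3 h4]

/-- Consistency compares the upper witness of one value with the lower witness of the other. Under
monotonicity the witnessing levels are kept; for a smaller ball, moving the centre is paid for by
the decrease of the radius. -/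
theorem isContCode_gaugeCode {T : Set M.Num} [hTs : InSets T] (hT : IsBinTree T) :
    IsContCode (gaugeCode T) where
  subset := by
    rintro z ⟨n, a, r, b, s, hz, u, -, v, -, hu, hv, h⟩
    refine ⟨n, a, r, b, s, hz, Frac.inUnit_iff.2 ⟨h.1, h.2.1⟩, ?_, ?_⟩
    · rw [Frac.lt_iff, Frac.val_zero]
      exact h.2.2.1
    · rw [Frac.lt_iff, Frac.val_zero]
      exact h.2.2.2.1
  consistent := by
    intro a r b s b' s' h h'
    obtain ⟨u, hu, v, hv, -, -, hr, -, h1, h2, h3, h4⟩ := codeRel_gaugeCode.1 h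
    obtain ⟨u', hu', v', hv', -, -, -, -, h1', h2', h3', h4'⟩ := codeRel_gaugeCode.1 h'
    rw [Frac.distLe_iff, Frac.val_add, abs_le]
    have h5 := lt_of_near_of_not_near hT hu hv' h1 h2 h3' h4'
    have h6 := lt_of_near_of_not_near hT hu' hv h1' h2' h3 h4
    constructor <;> linarith
  mono_left := by
    intro a r b s a' r' h ha' hr' hd
    obtain ⟨u, hu, v, hv, -, -, hr, hs, h1, h2, h3, h4⟩ := codeRel_gaugeCode.1 h
    rw [Frac.distLt_iff, Frac.val_sub] at hd
    rw [Frac.lt_iff, Frac.val_zero] at hr'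
    obtain ⟨ha0, ha1⟩ := Frac.inUnit_iff.1 ha'
    have hu0 := Num.coe_nonneg u
    have hv0 := Num.coe_nonneg v
    have hd0 := (abs_nonneg _).trans_lt hd
    refine codeRel_gaugeCode.2 ⟨u, hu, v, hv, ha0, ha1, hr', hs, h1.trans ?_, h2.mono ?_,
      lt_of_le_of_lt ?_ h3, fun h => h4 (h.mono ?_)⟩
    · exact mul_le_mul_of_nonneg_left (by linarith) (by positivity)
    · linarith
    · exact mul_le_mul_of_nonneg_left (by linarith) hv0
    · rw [abs_sub_comm]
      linarith
  mono_right := by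
    intro a r b s b' s' h hs' hd
    obtain ⟨u, hu, v, hv, ha0, ha1, hr, hs, h1, h2, h3, h4⟩ := codeRel_gaugeCode.1 h
    rw [Frac.distLt_iff, Frac.val_sub, abs_lt] at hd
    rw [Frac.lt_iff, Frac.val_zero] at hs'
    have hu0 := Num.coe_nonneg u
    have hv0 := Num.coe_nonneg v
    refine codeRel_gaugeCode.2 ⟨u, hu, v, hv, ha0, ha1, hr, hs', h1.trans ?_,
      h2.mono_right (by linarith [hd.2]), lt_of_le_of_lt ?_ h3,
      fun h => h4 (h.mono_right (by linarith [hd.1]))⟩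
    · exact mul_le_mul_of_nonneg_left (by linarith [hd.2]) (by positivity)
    · exact mul_le_mul_of_nonneg_left (by linarith [hd.1]) hv0

end

end L2Structure

namespace L2Structure

section

variable {M : L2Structure.{u}} [hM : Fact M.ModelsRCA0]

/-! ### Approximation of reals by rationals -/

/-- The real listed by `f` has distance less than `r` from `a`. -/
def Within (f : M.Num → M.Frac) (a r : M.RatField) : Prop :=
  ∃ k : M.Num, |(f k).val - a| < r - 1 / ((k : M.RatField) + 1)

section

variable {f : M.Num → M.Frac} {x : Set M.Num}

theorem Within.mono {a r r' : M.RatField} (h : Within f a r) (hr : r ≤ r') : Within f a r' :=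
  h.imp fun _ hk => hk.trans_le (by linarith)

/-- All sufficiently small balls around the real lie inside the given ball, in the form required by
`IsContCode.mono_left`. Half of the slack at one index `k` suffices. -/
theorem Within.exists_margin (hf : Lists f x) (hx : IsReal x) {a r : M.RatField}
    (h : Within f a r) : ∃ η > 0, ∀ a' r', Within f a' r' → r' ≤ η → |a - a'| < r - r' := by
  obtain ⟨k, hk⟩ := h
  refine ⟨(r - 1 / ((k : M.RatField) + 1) - |(f k).val - a|) / 2, by linarith,
    fun a' r' ⟨j, hj⟩ hr' => ?_⟩
  have h1 := hf.dist_le_add hx k j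
  have h2 : |a - a'| ≤ |(f k).val - a| + |(f k).val - (f j).val| + |(f j).val - a'| := by
    rw [abs_sub_comm (f k).val a]
    have := abs_sub_le a (f k).val a'
    have := abs_sub_le (f k).val (f j).val a'
    linarith
  linarith

theorem Lists.exists_within (hf : Lists f x) (hx : InUnitInterval x) {r : M.RatField}
    (hr : 0 < r) : ∃ a : M.Frac, a.InUnit ∧ Within f a.val r := by
  obtain ⟨k, hk⟩ := Num.exists_inv_lt (half_pos hr)
  obtain ⟨h1, h2⟩ := hf.inUnitInterval hx k
  have h3 := one_div_pos k
  -- Terms of a real in `[0, 1]` may lie slightly outside, but centres of balls may not; the term is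
  -- truncated.
  obtain ⟨a, ha⟩ := Frac.exists_val (max 0 (min 1 (f k).val))
  refine ⟨a, Frac.inUnit_iff.2 ?_, k, ?_⟩
  · rw [ha]
    exact ⟨le_max_left _ _, max_le zero_le_one (min_le_left _ _)⟩
  · rw [ha]
    refine lt_of_le_of_lt (b := 1 / ((k : M.RatField) + 1)) ?_ (by linarith)
    rw [abs_le]
    rcases le_total (f k).val 1 with h | h
    · rw [min_eq_right h]
      rcases le_total 0 (f k).val with h' | h'
      · rw [max_eq_right h']
        constructor <;> linarith
      · rw [max_eq_left h']
        constructor <;> linarith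
    · rw [min_eq_left h, max_eq_right zero_le_one]
      constructor <;> linarith

end

/-! ### Values of coded functions -/

section

variable {f : M.Num → M.Frac} {x Φ : Set M.Num}

/-- Consistency of a code concerns one ball only, so both pieces of information are first restricted
to a common smaller ball containing `x`. -/
theorem IsContCode.dist_le (hΦ : IsContCode Φ) (hf : Lists f x) (hx : InUnitInterval x)
    {a r b s a' r' b' s' : M.Frac} (h : CodeRel Φ a r b s) (ha : RealRatDistLt x a r)
    (h' : CodeRel Φ a' r' b' s') (ha' : RealRatDistLt x a' r') :
    |b.val - b'.val| ≤ s.val + s'.val := by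
  obtain ⟨η, hη, H⟩ := Within.exists_margin hf hx.1 (hf.realRatDistLt_iff.1 ha)
  obtain ⟨η', hη', H'⟩ := Within.exists_margin hf hx.1 (hf.realRatDistLt_iff.1 ha')
  obtain ⟨r'', hr''⟩ := Frac.exists_val (min η η')
  have hpos : 0 < r''.val := hr'' ▸ lt_min hη hη'
  obtain ⟨a'', hu, hw⟩ := hf.exists_within hx hpos
  have h1 := hΦ.mono_left _ _ _ _ a'' r'' h hu (by rwa [Frac.lt_iff, Frac.val_zero]) (by
    rw [Frac.distLt_iff, Frac.val_sub]
    exact H _ _ hw (hr'' ▸ min_le_left _ _))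
  have h2 := hΦ.mono_left _ _ _ _ a'' r'' h' hu (by rwa [Frac.lt_iff, Frac.val_zero]) (by
    rw [Frac.distLt_iff, Frac.val_sub]
    exact H' _ _ hw (hr'' ▸ min_le_right _ _))
  have h3 := hΦ.consistent _ _ _ _ _ _ h1 h2
  rwa [Frac.distLe_iff, Frac.val_add] at h3

instance CodeRel.instSig (a r b s : M.Env → M.Frac) [hΦ : InSets Φ] [ha : FracTm a]
    [hr : FracTm r] [hb : FracTm b] [hs : FracTm s] :
    Sig fun e => CodeRel Φ (a e) (r e) (b e) (s e) := by
  have ha' := ha.instCode.shift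
  have hr' := hr.instCode.shift
  have hb' := hb.instCode.shift
  have hs' := hs.instCode.shift
  exact (inferInstance : Sig fun e => ∃ n, pair n (pair (a e).code (pair (r e).code
    (pair (b e).code (s e).code))) ∈ Φ)

instance RealRatDistLt.instSig (a r : M.Env → M.Frac) [hx : InSets x] [ha : FracTm a]
    [hr : FracTm r] : Sig fun e => RealRatDistLt x (a e) (r e) := by
  have ha' := ha.shift.shift.shift.shift
  have hr' := hr.shift.shift.shift.shift
  exact (inferInstance : Sig fun e => ∃ (k : M.Num) (q : M.Frac), Term x k q ∧
    q.DistLt (a e) ((r e).sub (.invSucc k)))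

/-- A coded continuous function has a value at each real in its domain. -/
theorem IsContCode.exists_hasValue (hΦ : IsContCode Φ) [hΦs : InSets Φ] [hxs : InSets x]
    (hx : InUnitInterval x) (hdom : InDomain Φ x) : ∃ y ∈ M.sets, HasValue Φ x y := by
  obtain ⟨f, hf⟩ := hx.1.exists_lists
  -- Approximations with error below half of `1 / (k + 1)` form a sequence with the convergence rate
  -- required of a real.
  have hval : ∀ k : M.Num, (⟨1, 0, 2 * k + 1⟩ : M.Frac).val = 1 / ((k : M.RatField) + 1) / 2 := by
    intro k
    have := (Num.coe_add_one_pos k).ne'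
    simp only [Frac.val]
    push_cast
    have h : 2 * (k : M.RatField) + 1 + 1 = ((k : M.RatField) + 1) * 2 := by ring
    rw [h, sub_zero, div_div]
  have hR : Sig fun e : M.Env => ∃ a r b s : M.Frac, CodeRel Φ a r b s ∧ RealRatDistLt x a r ∧
    s.Lt ⟨1, 0, 2 * e 0 + 1⟩ ∧ e 1 = b.code := inferInstance
  obtain ⟨F, hF, H⟩ := exists_sigFun (R := fun k c => ∃ a r b s : M.Frac, CodeRel Φ a r b s ∧
    RealRatDistLt x a r ∧ s.Lt ⟨1, 0, 2 * k + 1⟩ ∧ c = b.code) hR fun k => by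
      obtain ⟨a, r, b, s, h1, h2, h3⟩ := hdom ⟨1, 0, 2 * k + 1⟩ (by
        rw [Frac.lt_iff, Frac.val_zero, hval]
        exact half_pos (one_div_pos k))
      exact ⟨b.code, a, r, b, s, h1, h2, h3, rfl⟩
  choose a r b s h1 h2 h3 h4 using H
  obtain rfl : F = fun k => (b k).code := funext h4
  have h5 : ∀ k, (s k).val < 1 / ((k : M.RatField) + 1) / 2 := fun k => by
    have := h3 k
    rwa [Frac.lt_iff, hval] at this
  obtain ⟨y, hy, hyr, hl⟩ := exists_real b fun k i => by
    have h6 := hΦ.dist_le hf hx (h1 k) (h2 k) (h1 (k + i)) (h2 (k + i))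
    have h7 : 1 / (((k + i : M.Num) : M.RatField) + 1) ≤ 1 / ((k : M.RatField) + 1) := by
      refine one_div_le_one_div_of_le (Num.coe_add_one_pos k) ?_
      push_cast
      linarith [Num.coe_nonneg i]
    linarith [h5 k, h5 (k + i)]
  refine ⟨y, hy, hdom, hyr, fun a' r' b' s' h h' => hl.realRatDistLe_iff.2 fun k => ?_⟩
  linarith [hΦ.dist_le hf hx (h1 k) (h2 k) h h', h5 k, one_div_pos k]

end

/-! ### The domain of the gauge -/

section

variable {T : Set M.Num} [hTs : InSets T] (hT : IsBinTree T) (hinf : IsInfinite T)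

include hT hinf

theorem near_one {a q : M.RatField} (ha : 0 ≤ a) (ha' : a ≤ 1) (hq : 0 ≤ q) : Near T 1 a q := by
  obtain ⟨n, hn, h1, h2⟩ := hT.exists_mem_level hinf (one_mem_powers (M := M))
  obtain rfl : n = 1 := by
    rw [mul_one, ← one_add_one_eq_two, Num.lt_add_one_iff] at h2
    exact le_antisymm h2 h1
  refine ⟨1, by rwa [mul_one] at h2 ⊢, hn, le_rfl, ?_, ?_⟩
  · push_cast
    linarith
  · push_cast
    linarith

/-- The first level `u` with `1 ≤ 2 * u * q` decides. If `a` is not near there, minimality gives `u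
* q < 1`; level `1` cannot fail, since the root has the interval `[0, 1]`. -/
theorem near_or_not_near {a q : M.RatField} (ha : 0 ≤ a) (ha' : a ≤ 1) (hq : 0 < q) :
    (∃ u ∈ M.powers, 1 ≤ 2 * (u : M.RatField) * q ∧ Near T u a q) ∨
      ∃ v ∈ M.powers, (v : M.RatField) * q < 1 ∧ ¬ Near T v a q := by
  obtain ⟨q, rfl⟩ := Frac.exists_val q
  have hS : Sig fun e : M.Env => ((1 : M.Num) : M.RatField) ≤ (2 * pow2 (e 0) : M.Num) * q.val :=
    (inferInstance : Sig fun e : M.Env => ∃ u, pow2 (e 0) = u ∧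
      ((1 : M.Num) : M.RatField) ≤ (2 * u : M.Num) * q.val).congr fun e => by
        simp only [exists_eq_left']
  obtain ⟨k, h1, h2⟩ := exists_least_of_sig
    (P := fun k => ((1 : M.Num) : M.RatField) ≤ (2 * pow2 k : M.Num) * q.val) hS (by
      obtain ⟨u, ⟨k, rfl⟩, h⟩ := exists_mem_powers_gt (1 / q.val)
      refine ⟨k, ?_⟩
      rw [div_lt_iff₀ hq] at h
      push_cast
      linarith)
  push_cast at h1
  by_cases hn : Near T (pow2 k) a q.val
  · exact Or.inl ⟨_, ⟨k, rfl⟩, h1, hn⟩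
  · refine Or.inr ⟨_, ⟨k, rfl⟩, ?_, hn⟩
    rcases Arith.eq_zero_or_succ k with rfl | ⟨j, rfl⟩
    · rw [pow2_zero] at hn
      exact (hn (near_one hT hinf ha ha' hq.le)).elim
    · have := h2 j (Num.lt_add_one j)
      rw [not_le] at this
      rw [pow2_succ]
      exact_mod_cast this

/-- Approximation of the value of the gauge at a rational. -/
theorem exists_near_not_near {a : M.RatField} (ha : 0 ≤ a) (ha' : a ≤ 1) (m : M.Num) :
    ∃ b : M.RatField, ∃ u ∈ M.powers, ∃ v ∈ M.powers,
      1 ≤ 2 * (u : M.RatField) * (b + 1 / (m + 1)) ∧ Near T u a (b + 1 / (m + 1)) ∧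
      (v : M.RatField) * (b - 1 / (m + 1)) < 1 ∧ ¬ Near T v a (b - 1 / (m + 1)) := by
  obtain ⟨a, rfl⟩ := Frac.exists_val a
  have hm := Num.coe_add_one_pos m
  have hval : ∀ i : M.Num, (⟨i + 1, 0, m⟩ : M.Frac).val = (i + 1) / (m + 1) := by
    intro i
    simp [Frac.val]
  have hS : Sig fun e : M.Env => ∃ u, u ∈ M.powers ∧
    ((1 : M.Num) : M.RatField) ≤ (2 * u : M.Num) * (⟨e 0 + 1, 0, m⟩ : M.Frac).val ∧
    Near T u a.val (⟨e 0 + 1, 0, m⟩ : M.Frac).val := inferInstance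
  -- On the grid of mesh `1 / (m + 1)`, take the first point `(i + 1) / (m + 1)` verified as an
  -- upper bound, and `b = i / (m + 1)`. The grid point `1` is always verified, by level `1`.
  obtain ⟨i, ⟨u, hu, h1, h2⟩, h3⟩ := exists_least_of_sig
    (P := fun i => ∃ u, u ∈ M.powers ∧
      ((1 : M.Num) : M.RatField) ≤ (2 * u : M.Num) * (⟨i + 1, 0, m⟩ : M.Frac).val ∧
      Near T u a.val (⟨i + 1, 0, m⟩ : M.Frac).val) hS
    ⟨m, 1, one_mem_powers, by
      rw [hval, div_self hm.ne']
      push_cast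
      norm_num, near_one hT hinf ha ha' (by rw [hval]; positivity)⟩
  rw [hval] at h1 h2
  push_cast at h1
  have hadd : (i : M.RatField) / (m + 1) + 1 / (m + 1) = (i + 1) / (m + 1) := by rw [← add_div]
  have hlow : ∃ v ∈ M.powers, (v : M.RatField) * (i / (m + 1) - 1 / (m + 1)) < 1 ∧
      ¬ Near T v a.val (i / (m + 1) - 1 / (m + 1)) := by
    have h0 := one_div_pos m
    rcases Arith.eq_zero_or_succ i with rfl | ⟨j, rfl⟩
    -- Here the lower bound is negative. On a level with `v > m + 1` the intervals are too short to
    -- contain a point at depth `1 / (m + 1)`.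
    · obtain ⟨v, hv, hvm⟩ := exists_mem_powers_gt ((m : M.RatField) + 1)
      refine ⟨v, hv, ?_, ?_⟩
      · have : (0 : M.RatField) ≤ v * (1 / (m + 1)) := mul_nonneg (Num.coe_nonneg v) h0.le
        push_cast
        rw [zero_div, zero_sub]
        linarith
      · rintro ⟨n, -, -, -, h4, h5⟩
        have h6 : (1 : M.RatField) < v * (1 / (m + 1)) := by
          rw [mul_one_div, lt_div_iff₀ hm]
          linarith
        push_cast at h4 h5
        rw [zero_div, zero_sub] at h4 h5
        linarith
    · have h4 : ¬ ∃ u ∈ M.powers, 1 ≤ 2 * (u : M.RatField) * ((j + 1) / (m + 1)) ∧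
          Near T u a.val ((j + 1) / (m + 1)) := by
        rintro ⟨u, hu, h5, h6⟩
        refine h3 j (Num.lt_add_one j) ⟨u, hu, ?_, ?_⟩
        · rw [hval]
          push_cast
          exact h5
        · rwa [hval]
      obtain ⟨v, hv, h5, h6⟩ := (near_or_not_near hT hinf ha ha'
        (div_pos (Num.coe_add_one_pos j) hm)).resolve_left h4
      push_cast
      refine ⟨v, hv, lt_of_le_of_lt ?_ h5, fun h => h6 (h.mono_right ?_)⟩
      · exact mul_le_mul_of_nonneg_left (by linarith) (Num.coe_nonneg v)
      · linarith
  obtain ⟨v, hv, h4, h5⟩ := hlow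
  exact ⟨i / (m + 1), u, hu, v, hv, hadd ▸ h1, hadd ▸ h2, h4, h5⟩

theorem inDomain_gaugeCode {x : Set M.Num} (hx : InUnitInterval x) :
    InDomain (gaugeCode T) x := by
  intro ε hε
  rw [Frac.lt_iff, Frac.val_zero] at hε
  obtain ⟨f, hf⟩ := hx.1.exists_lists
  obtain ⟨m, hm⟩ := Num.exists_inv_lt (half_pos hε)
  have hm0 := one_div_pos m
  obtain ⟨a, hau, haw⟩ := hf.exists_within hx hm0
  obtain ⟨ha0, ha1⟩ := Frac.inUnit_iff.1 hau
  obtain ⟨b, u, hu, v, hv, h1, h2, h3, h4⟩ := exists_near_not_near hT hinf ha0 ha1 m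
  obtain ⟨b, rfl⟩ := Frac.exists_val b
  -- One half of `s` pays for the error of `b`, the other for the radius of the ball.
  obtain ⟨s, hs⟩ := Frac.exists_val (2 * (1 / ((m : M.RatField) + 1)))
  have e1 : b.val + s.val - (Frac.invSucc m).val = b.val + 1 / ((m : M.RatField) + 1) := by
    rw [hs, Frac.val_invSucc]
    ring
  have e2 : b.val - s.val + (Frac.invSucc m).val = b.val - 1 / ((m : M.RatField) + 1) := by
    rw [hs, Frac.val_invSucc]
    ring
  refine ⟨a, .invSucc m, b, s, codeRel_gaugeCode.2 ⟨u, hu, v, hv, ha0, ha1, ?_, ?_, ?_⟩, ?_, ?_⟩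
  · rwa [Frac.val_invSucc]
  · rw [hs]
    linarith
  · rw [e1, e2]
    exact ⟨h1, h2, h3, h4⟩
  · rw [hf.realRatDistLt_iff, Frac.val_invSucc]
    exact haw
  · rw [Frac.lt_iff, hs]
    linarith

omit hinf in
/-- The gauge is positive at a real that has positive distance from some level of the tree. -/
theorem realPos_of_not_near {x y : Set M.Num} {f : M.Num → M.Frac} (hf : Lists f x)
    (hy : HasValue (gaugeCode T) x y) {u : M.Num} (hu : u ∈ M.powers) {q : M.RatField} (hq : 0 < q)
    (h : ∀ a, Within f a q → ¬ Near T u a q) : RealPos y := by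
  -- Level `u` is a witness for values above `q'` only if the cap `1 / u` exceeds `q'`.
  obtain ⟨q', hq', hqq, huq⟩ : ∃ q' > 0, q' ≤ q ∧ (u : M.RatField) * q' < 1 := by
    have hu0 : (0 : M.RatField) < u := by exact_mod_cast powers_pos hu
    refine ⟨min q (1 / u / 2), lt_min hq (by positivity), min_le_left _ _, ?_⟩
    calc (u : M.RatField) * min q (1 / u / 2) ≤ u * (1 / u / 2) :=
          mul_le_mul_of_nonneg_left (min_le_right _ _) hu0.le
      _ < 1 := by
        field_simp
        norm_num
  obtain ⟨g, hg⟩ := hy.2.1.exists_lists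
  obtain ⟨ε, hε⟩ := Frac.exists_val (q' / 4)
  obtain ⟨a, r, b, s, h1, h2, h3⟩ := hy.1 ε (by
    rw [Frac.lt_iff, hε, Frac.val_zero]
    positivity)
  rw [Frac.lt_iff, hε] at h3
  obtain ⟨k, hk⟩ := Num.exists_inv_lt (show 0 < q' / 4 by positivity)
  have h4 := hg.realRatDistLe_iff.1 (hy.2.2 a r b s h1 h2) k
  obtain ⟨u', hu', v', hv', H⟩ := codeRel_gaugeCode.1 h1
  have hrs := H.radius_lt hT hu' hv'
  obtain ⟨ha0, ha1, hr, hs, h5, h6, h7, h8⟩ := H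
  have hw : Within f a.val q' := Within.mono (hf.realRatDistLt_iff.1 h2) (by linarith)
  have h9 := lt_of_near_of_not_near hT hu' hu h5 h6 huq
    fun h' => h a.val (hw.mono hqq) (h'.mono_right hqq)
  rw [abs_le] at h4
  exact hg.realPos_iff.2 ⟨k, by linarith⟩

end

end

end L2Structure

namespace L2Structure

section

variable {M : L2Structure.{u}} [hM : Fact M.ModelsRCA0]

/-! ### Paths -/

/-- A binary tree with exactly one node on each level gives a path. -/
theorem exists_isPath_of_unique {T S : Set M.Num} [hSs : InSets S] (hS : IsBinTree S) (hST : S ⊆ T)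
    (h : ∀ u ∈ M.powers, ∃ n ∈ S, u ≤ n ∧ n < 2 * u)
    (h' : ∀ u ∈ M.powers, ∀ n n', n ∈ S → n' ∈ S → u ≤ n → n < 2 * u → u ≤ n' → n' < 2 * u → n = n') :
    ∃ X ∈ M.sets, M.IsPath T X := by
  choose G hGS hG1 hG2 using fun k : M.Num => h (pow2 k) ⟨k, rfl⟩
  -- Uniqueness of the node on each level gives the chosen function a `Σ⁰₁` graph.
  have hG : SigFun G := ⟨(inferInstance : Sig fun e : M.Env =>
      ∃ u, pow2 (e 0) = u ∧ e 1 ∈ S ∧ u ≤ e 1 ∧ e 1 < 2 * u).congr fun e => by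
    constructor
    · rintro ⟨u, rfl, h1, h2, h3⟩
      exact h' _ ⟨e 0, rfl⟩ _ _ (hGS _) h1 (hG1 _) (hG2 _) h2 h3
    · rintro h
      rw [← h]
      exact ⟨_, rfl, hGS _, hG1 _, hG2 _⟩⟩
  have hG0 : G 0 = 1 := by
    have h1 := hG1 0
    have h2 := hG2 0
    rw [pow2_zero] at h1 h2
    rw [mul_one, ← one_add_one_eq_two, Num.lt_add_one_iff] at h2
    exact le_antisymm h2 h1
  have hGs : ∀ k, G (k + 1) = 2 * G k ∨ G (k + 1) = 2 * G k + 1 := by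
    intro k
    obtain ⟨m, hm⟩ := exists_half (G (k + 1))
    have h1 := hG1 (k + 1)
    have h2 := hG2 (k + 1)
    rw [pow2_succ] at h1 h2
    have hle : 2 * m ≤ G (k + 1) := by
      rcases hm with h | h <;> rw [h]
      exact le_self_add
    have hlt : G (k + 1) < 2 * (m + 1) := by
      rcases hm with h | h <;> rw [h, mul_add]
      · exact lt_add_of_pos_right _ (by rw [mul_one]; exact two_pos)
      · rw [mul_one]
        exact add_lt_add_right one_lt_two _
    have h3 : pow2 k ≤ m := Num.lt_add_one_iff.1 (lt_of_mul_lt_mul_left (h1.trans_lt hlt)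
      (Num.zero_le 2))
    have h4 : m < 2 * pow2 k := lt_of_mul_lt_mul_left (hle.trans_lt h2) (Num.zero_le 2)
    have hmS : m ∈ S := (hS _ (hGS (k + 1))).2 m ((pow2_pos k).trans_le h3).ne'
      (by rwa [one_add_one_eq_two])
    rwa [h' _ ⟨k, rfl⟩ _ _ hmS (hGS k) h3 h4 (hG1 k) (hG2 k)] at hm
  obtain ⟨X, hX, hXG⟩ := exists_set hM.out (P := fun k => G (k + 1) = 2 * G k + 1)
    ((inferInstance : Sig fun e : M.Env => ∃ a b, G (e 0 + 1) = a ∧ G (e 0) = b ∧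
      a = 2 * b + 1).congr fun e => by simp)
    ((inferInstance : Sig fun e : M.Env => ∃ a b, G (e 0 + 1) = a ∧ G (e 0) = b ∧
      ¬ a = 2 * b + 1).congr fun e => by simp)
  have hmem : ∀ k n, pair k n ∈ {z | ∃ k, z = pair k (G k)} ↔ n = G k := by
    intro k n
    constructor
    · rintro ⟨k', h⟩
      obtain ⟨rfl, h⟩ := pair_injective h
      exact h
    · rintro rfl
      exact ⟨k, rfl⟩
  refine ⟨X, hX, _, graph_mem_sets G, ⟨⟨?_, ?_⟩, ?_, ?_⟩, ?_⟩
  · rintro z ⟨k, rfl⟩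
    exact ⟨k, G k, rfl⟩
  · exact fun k => ⟨G k, (hmem _ _).2 rfl, fun n hn => (hmem _ _).1 hn⟩
  · rw [hmem, hG0]
  · intro k n hn
    rw [hmem] at hn
    subst hn
    rw [hmem, hmem, one_add_one_eq_two, hXG]
    exact ⟨fun h => ((hGs k).resolve_right h).symm, fun h => h.symm⟩
  · intro k n hn
    rw [hmem] at hn
    exact hn ▸ hST (hGS k)

theorem exists_mem_powers_half {u : M.Num} (hu : u ∈ M.powers) (h : u ≠ 1) :
    ∃ v ∈ M.powers, u = 2 * v := by
  obtain ⟨k, rfl⟩ := hu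
  rcases Arith.eq_zero_or_succ k with rfl | ⟨j, rfl⟩
  · exact (h pow2_zero).elim
  · exact ⟨pow2 j, ⟨j, rfl⟩, pow2_succ j⟩

/-- A cut of the dyadic rationals: `A n u` says that `n / u` lies below the cut. -/
structure IsCut (A : M.Num → M.Num → Prop) : Prop where
  anti : ∀ n n' u, n' ≤ n → A n u → A n' u
  scale : ∀ n, ∀ u ∈ M.powers, ∀ w ∈ M.powers, (A (n * w) (u * w) ↔ A n u)
  sig : Sig fun e : M.Env => A (e 0) (e 1)
  sig_not : Sig fun e : M.Env => ¬ A (e 0) (e 1)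

/-- Some node of `T` on level `u` is the initial segment of the cut `A`. -/
def MeetsCut (T : Set M.Num) (A : M.Num → M.Num → Prop) (u : M.Num) : Prop :=
  ∃ n ∈ T, u ≤ n ∧ n < 2 * u ∧ A n u ∧ ¬ A (n + 1) u

section

variable {T : Set M.Num} {A : M.Num → M.Num → Prop}

theorem IsCut.meetsCut_of_le [hTs : InSets T] (hT : IsBinTree T) (hA : IsCut A) {u v : M.Num} (hu : u ∈ M.powers)
    (hv : v ∈ M.powers) (huv : u ≤ v) (h : MeetsCut T A v) : MeetsCut T A u := by
  obtain ⟨n, hn, h1, h2, h3, h4⟩ := h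
  obtain ⟨w, hw, rfl, m, hm, h5, h6, h7, h8⟩ := hT.exists_ancestor_level hn hu hv huv h1 h2
  refine ⟨m, hm, h5, h6, ?_, fun h => h4 ?_⟩
  · exact (hA.scale _ _ hu w hw).1 (hA.anti _ _ _ h7 h3)
  · exact hA.anti _ _ _ (Num.add_one_le_iff.2 h8) ((hA.scale _ _ hu w hw).2 h)

/-- The strings that are initial segments of the cut form a `Δ⁰₁` set with one node on each level.
On each level this node is the one provided by `MeetsCut`, so it lies in `T`. -/
theorem IsCut.exists_isPath (hA : IsCut A) (h : ∀ u ∈ M.powers, MeetsCut T A u) :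
    ∃ X ∈ M.sets, M.IsPath T X := by
  have huniq : ∀ u n n', A n u → ¬ A (n + 1) u → A n' u → ¬ A (n' + 1) u → n = n' := by
    intro u n n' h1 h2 h3 h4
    refine le_antisymm (not_lt.1 fun h => h4 ?_) (not_lt.1 fun h => h2 ?_)
    · exact hA.anti _ _ _ (Num.add_one_le_iff.2 h) h1
    · exact hA.anti _ _ _ (Num.add_one_le_iff.2 h) h3
  have hlevel : ∀ u ∈ M.powers, ∀ v ∈ M.powers, ∀ n : M.Num, u ≤ n → n < 2 * u → v ≤ n →
      n < 2 * v → u = v := fun u hu v hv n h1 h2 h3 h4 =>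
    le_antisymm (le_of_lt_two_mul hv hu (h1.trans_lt h4)) (le_of_lt_two_mul hu hv (h3.trans_lt h2))
  have h₁ : ∀ f g : M.Env → M.Num, [Tm f] → [Tm g] → Sig fun e => A (f e) (g e) :=
    fun f g => hA.sig.comp₂ f g
  have h₂ : ∀ f g : M.Env → M.Num, [Tm f] → [Tm g] → Sig fun e => ¬ A (f e) (g e) :=
    fun f g => hA.sig_not.comp₂ (R := fun a b => ¬ A a b) f g
  obtain ⟨S, hS, hSA⟩ := exists_set hM.out
    (P := fun n => ∃ u, u ∈ M.powers ∧ u ≤ n ∧ n < 2 * u ∧ A n u ∧ ¬ A (n + 1) u) inferInstance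
    ((inferInstance : Sig fun e : M.Env => e 0 = 0 ∨ ∃ u, u ∈ M.powers ∧ u ≤ e 0 ∧ e 0 < 2 * u ∧
      (¬ A (e 0) u ∨ A (e 0 + 1) u)).congr fun e => by
        constructor
        · rintro (h | ⟨u, hu, h1, h2, h3⟩) ⟨v, hv, h4, h5, h6, h7⟩
          · exact ((powers_pos hv).trans_le h4).ne' h
          · obtain rfl := hlevel u hu v hv _ h1 h2 h4 h5
            exact h3.elim (fun h => h h6) h7
        · intro h
          refine or_iff_not_imp_left.2 fun h0 => ?_
          obtain ⟨k, h1, h2⟩ := exists_level h0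
          refine ⟨_, ⟨k, rfl⟩, h1, h2, ?_⟩
          by_contra! h3
          exact h ⟨_, ⟨k, rfl⟩, h1, h2, h3⟩)
  have : InSets S := ⟨hS⟩
  refine exists_isPath_of_unique (S := S) (fun n hn => ?_) (fun n hn => ?_) (fun u hu => ?_)
    fun u hu n n' hn hn' h1 h2 h3 h4 => ?_
  · obtain ⟨u, hu, h1, h2, h3, h4⟩ := (hSA n).1 hn
    refine ⟨((powers_pos hu).trans_le h1).ne', fun m hm0 hm => ?_⟩
    rw [one_add_one_eq_two] at hm
    have hle : 2 * m ≤ n := by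
      rcases hm with h | h <;> rw [h]
      exact le_self_add
    have hlt : n < 2 * (m + 1) := by
      rcases hm with h | h <;> rw [h, mul_add]
      · exact lt_add_of_pos_right _ (by rw [mul_one]; exact two_pos)
      · rw [mul_one]
        exact add_lt_add_right one_lt_two _
    have hu1 : u ≠ 1 := by
      rintro rfl
      have h5 : 1 ≤ m := by
        rw [← zero_add (1 : M.Num)]
        exact Num.add_one_le_iff.2 (Num.pos_of_ne_zero hm0)
      refine not_lt.2 (le_trans ?_ hle) h2
      gcongr
    obtain ⟨v, hv, rfl⟩ := exists_mem_powers_half hu hu1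
    refine (hSA m).2 ⟨v, hv, ?_, ?_, ?_, fun h => h4 ?_⟩
    · exact Num.lt_add_one_iff.1 (lt_of_mul_lt_mul_left (h1.trans_lt hlt) (Num.zero_le 2))
    · exact lt_of_mul_lt_mul_left (hle.trans_lt h2) (Num.zero_le 2)
    · rw [← hA.scale _ _ hv 2 two_mem_powers, mul_comm m, mul_comm v]
      exact hA.anti _ _ _ hle h3
    · rw [← hA.scale _ _ hv 2 two_mem_powers, mul_comm _ (2 : M.Num), mul_comm v] at h
      exact hA.anti _ _ _ (Num.add_one_le_iff.2 hlt) h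
  · obtain ⟨u, hu, h1, h2, h3, h4⟩ := (hSA n).1 hn
    obtain ⟨n', hn', -, -, h5, h6⟩ := h u hu
    rwa [huniq u n n' h3 h4 h5 h6]
  · obtain ⟨n, -, h1, h2, h3, h4⟩ := h u hu
    exact ⟨n, (hSA n).2 ⟨u, hu, h1, h2, h3, h4⟩, h1, h2⟩
  · obtain ⟨v, hv, h5, h6, h7, h8⟩ := (hSA n).1 hn
    obtain ⟨v', hv', h5', h6', h7', h8'⟩ := (hSA n').1 hn'
    obtain rfl := hlevel u hu v hv n h1 h2 h5 h6
    obtain rfl := hlevel u hu v' hv' n' h3 h4 h5' h6'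
    exact huniq u n n' h7 h8 h7' h8'

end

/-- `m / u < 1 + x` for the real `x` listed by `f`. -/
def Below (f : M.Num → M.Frac) (m u : M.Num) : Prop :=
  ∃ k : M.Num, (m : M.RatField) < u * ((f k).val + 1 - 1 / ((k : M.RatField) + 1))

/-- `1 + x < m / u` for the real `x` listed by `f`. -/
def Above (f : M.Num → M.Frac) (m u : M.Num) : Prop :=
  ∃ k : M.Num, (u : M.RatField) * ((f k).val + 1 + 1 / ((k : M.RatField) + 1)) < m

section

variable {f : M.Num → M.Frac} {x : Set M.Num}

theorem Below.sig [hx : InSets x] (hf : Lists f x) : Sig fun e : M.Env => Below f (e 0) (e 1) :=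
  (inferInstance : Sig fun e : M.Env => ∃ (k : M.Num) (q : M.Frac), Term x k q ∧
    ¬ (e 1 : M.RatField) * ((q.add .one).sub (.invSucc k)).val ≤ e 0).congr fun e => by
      simp only [hf _ _, exists_eq_left, not_le, Frac.val_sub, Frac.val_add, Frac.val_one,
        Frac.val_invSucc]
      rfl

theorem Above.sig [hx : InSets x] (hf : Lists f x) : Sig fun e : M.Env => Above f (e 0) (e 1) :=
  (inferInstance : Sig fun e : M.Env => ∃ (k : M.Num) (q : M.Frac), Term x k q ∧
    ¬ (e 0 : M.RatField) ≤ e 1 * ((q.add .one).add (.invSucc k)).val).congr fun e => by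
      simp only [hf _ _, exists_eq_left, not_le, Frac.val_add, Frac.val_one, Frac.val_invSucc]
      rfl

theorem Below.lt_of_above (hf : Lists f x) (hx : IsReal x) {m m' u : M.Num} (h : Below f m u)
    (h' : Above f m' u) : m < m' := by
  obtain ⟨k, hk⟩ := h
  obtain ⟨j, hj⟩ := h'
  have h1 := abs_le.1 (hf.dist_le_add hx k j)
  have h2 : (u : M.RatField) * ((f k).val + 1 - 1 / ((k : M.RatField) + 1)) ≤
      u * ((f j).val + 1 + 1 / ((j : M.RatField) + 1)) :=
    mul_le_mul_of_nonneg_left (by linarith [h1.2]) (Num.coe_nonneg u)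
  exact_mod_cast hk.trans_le (h2.trans hj.le)

theorem Within.bounds (hf : Lists f x) (hx : IsReal x) {a q : M.RatField} (h : Within f a q)
    (k : M.Num) : (f k).val - 1 / ((k : M.RatField) + 1) - q < a ∧
      a < (f k).val + 1 / ((k : M.RatField) + 1) + q := by
  obtain ⟨j, hj⟩ := h
  have h1 := abs_le.1 (hf.dist_le_add hx k j)
  have h2 := abs_lt.1 hj
  constructor <;> linarith [h1.1, h1.2, h2.1, h2.2]

/-- A strict comparison with the real persists for every rational point that is close enough, even
after subtracting the tolerance of `Near`. -/
theorem Below.exists_margin (hf : Lists f x) (hx : IsReal x) {m u : M.Num} (h : Below f m u) :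
    ∃ η > 0, ∀ a q, q ≤ η → Within f a q → (m : M.RatField) < u * (1 + a - q) := by
  obtain ⟨k, hk⟩ := h
  have hu0 : (0 : M.RatField) < u := by
    refine (Num.coe_nonneg u).lt_of_ne fun h0 => ?_
    rw [← h0, zero_mul] at hk
    exact not_lt.2 (Num.coe_nonneg m) hk
  refine ⟨((f k).val + 1 - 1 / ((k : M.RatField) + 1) - m / u) / 2, ?_, fun a q hq h => ?_⟩
  · rw [← div_lt_iff₀' hu0] at hk
    linarith
  · rw [← div_lt_iff₀' hu0]
    linarith [(h.bounds hf hx k).1]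

theorem Above.exists_margin (hf : Lists f x) (hx : IsReal x) {m u : M.Num} (hu : 0 < u)
    (h : Above f m u) :
    ∃ η > 0, ∀ a q, q ≤ η → Within f a q → (u : M.RatField) * (1 + a + q) < m := by
  obtain ⟨k, hk⟩ := h
  have hu0 : (0 : M.RatField) < u := by exact_mod_cast hu
  refine ⟨(m / u - ((f k).val + 1 + 1 / ((k : M.RatField) + 1))) / 2, ?_, fun a q hq h => ?_⟩
  · rw [← lt_div_iff₀' hu0] at hk
    linarith
  · rw [← lt_div_iff₀' hu0]
    linarith [(h.bounds hf hx k).2]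

variable {T : Set M.Num}

/-- A real that is near every level of the tree and is not a dyadic rational gives a path. -/
theorem exists_isPath_of_not_dyadic [hxs : InSets x] (hf : Lists f x) (hx : InUnitInterval x)
    (hnear : ∀ u ∈ M.powers, ∀ q > 0, ∃ a, Within f a q ∧ Near T u a q)
    (hnd : ∀ m, ∀ u ∈ M.powers, Below f m u ∨ Above f m u) :
    ∃ X ∈ M.sets, M.IsPath T X := by
  -- `Above` is known to be the complement of `Below` only at powers of two; elsewhere the cut is
  -- made trivially true, so that it stays `Δ⁰₁`.
  have hcut : IsCut fun n u => u ∉ M.powers ∨ Below f n u := by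
    refine ⟨fun n n' u h => Or.imp_right ?_, fun n u hu w hw => ?_, ?_, ?_⟩
    · rintro ⟨k, hk⟩
      exact ⟨k, lt_of_le_of_lt (by exact_mod_cast h) hk⟩
    · refine or_congr (iff_of_false (fun h => h (mul_mem_powers hu hw)) fun h => h hu)
        (exists_congr fun k => ?_)
      have hw' : (0 : M.RatField) < w := by exact_mod_cast powers_pos hw
      push_cast
      rw [mul_right_comm]
      exact mul_lt_mul_iff_left₀ hw'
    · have := Below.sig hf
      infer_instance
    · have : Sig fun e : M.Env => Above f (e 0) (e 1) := Above.sig hf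
      refine (inferInstance : Sig fun e : M.Env => e 1 ∈ M.powers ∧ Above f (e 0) (e 1)).congr
        fun e => ?_
      rw [not_or, not_not]
      exact and_congr_right fun h => ⟨fun h1 h2 => lt_irrefl _ (h2.lt_of_above hf hx.1 h1),
        (hnd _ _ h).resolve_left⟩
  refine hcut.exists_isPath fun u hu => ?_
  have hu0 := powers_pos hu
  have hu0' : (0 : M.RatField) < u := by exact_mod_cast hu0
  obtain ⟨n', h1, h2⟩ := exists_least_of_sig (P := fun m => Above f m u)
    ((Above.sig hf).comp₂ (R := fun a b => Above f a b) (fun e => e 0) fun _ => u) (by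
      obtain ⟨m, hm⟩ := Num.exists_gt ((u : M.RatField) * ((f 0).val + 1 + 1 / (((0 : M.Num) : M.RatField) + 1)))
      exact ⟨m, 0, hm⟩)
  have hge : ∀ m, Above f m u → u < m := by
    rintro m ⟨k, hk⟩
    have h3 := (hf.inUnitInterval hx k).1
    have h4 : (u : M.RatField) < m := by
      refine lt_of_le_of_lt ?_ hk
      refine le_mul_of_one_le_right hu0'.le ?_
      linarith
    exact_mod_cast h4
  rcases Arith.eq_zero_or_succ n' with rfl | ⟨n, rfl⟩
  · exact (Arith.not_lt_zero _ (hge 0 h1)).elim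
  have h3 : Below f n u := (hnd n u hu).resolve_right (h2 n (Num.lt_add_one n))
  obtain ⟨η, hη, H⟩ := h3.exists_margin hf hx.1
  obtain ⟨η', hη', H'⟩ := h1.exists_margin hf hx.1 hu0
  -- `1 + x` lies strictly between `n / u` and `(n + 1) / u`. With a tolerance below both margins,
  -- the only node that can be near is `n`.
  obtain ⟨a, ha, m, h4, h5, h6, h7, h8⟩ := hnear u hu (min η η') (lt_min hη hη')
  have h9 := (H _ _ (min_le_left _ _) ha).trans_le h8
  have h10 := h7.trans_lt (H' _ _ (min_le_right _ _) ha)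
  have h11 : n < m + 1 := by exact_mod_cast h9
  have h12 : m < n + 1 := by exact_mod_cast h10
  obtain rfl : n = m := le_antisymm (Num.lt_add_one_iff.1 h11) (Num.lt_add_one_iff.1 h12)
  refine ⟨n, h5, h6, h4, Or.inr h3, ?_⟩
  rintro (h | h)
  · exact h hu
  · exact lt_irrefl _ (h.lt_of_above hf hx.1 h1)

variable [hTs : InSets T] (hT : IsBinTree T)

include hT

/-- A dyadic rational that is near every level of the tree gives a path. -/
theorem exists_isPath_of_dyadic {m v : M.Num} (hv : v ∈ M.powers)
    (hnear : ∀ u ∈ M.powers, ∀ q > 0, ∃ a : M.RatField, |1 + a - m / v| ≤ q ∧ Near T u a q) :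
    ∃ X ∈ M.sets, M.IsPath T X := by
  have hv0 := powers_pos hv
  have hcut₁ : IsCut fun n u => n * v ≤ u * m := by
    refine ⟨fun n n' u h h' => le_trans ?_ h', fun n u _ w hw => ?_, inferInstance, inferInstance⟩
    · gcongr
    · rw [mul_right_comm, mul_right_comm u]
      exact mul_le_mul_iff_left₀ (powers_pos hw)
  have hcut₂ : IsCut fun n u => n * v < u * m := by
    refine ⟨fun n n' u h h' => lt_of_le_of_lt ?_ h', fun n u _ w hw => ?_, inferInstance,
      inferInstance⟩
    · gcongr
    · rw [mul_right_comm, mul_right_comm u]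
      exact mul_lt_mul_iff_left₀ (powers_pos hw)
  -- The two cuts are the two binary expansions of `m / v`. From level `v` on, `m / v` is a multiple
  -- of `1 / u`; with tolerance `1 / (4 * u)` a near node must have it as an end point.
  have hor : ∀ u ∈ M.powers, v ≤ u → MeetsCut T (fun n u => n * v ≤ u * m) u ∨
      MeetsCut T (fun n u => n * v < u * m) u := by
    intro u hu hvu
    obtain ⟨i, rfl⟩ := exists_eq_mul_pow2 hv hu hvu
    have hu0 : (0 : M.RatField) < (v * pow2 i : M.Num) := by exact_mod_cast powers_pos hu
    obtain ⟨a, ha, n, h1, h2, h3, h4, h5⟩ := hnear _ hu (1 / (4 * (v * pow2 i : M.Num)))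
      (by positivity)
    have hv0' : (0 : M.RatField) < v := by exact_mod_cast hv0
    have he : ((v * pow2 i : M.Num) : M.RatField) * (m / v) = (pow2 i * m : M.Num) := by
      push_cast
      field_simp
    have hq : ((v * pow2 i : M.Num) : M.RatField) * (1 / (4 * (v * pow2 i : M.Num))) = 1 / 4 := by
      field_simp
    rw [abs_le] at ha
    have h6 := mul_le_mul_of_nonneg_left ha.1 hu0.le
    have h7 := mul_le_mul_of_nonneg_left ha.2 hu0.le
    rw [mul_neg, hq, mul_sub, he] at h6
    rw [hq, mul_sub, he] at h7
    rw [mul_add, hq] at h4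
    rw [mul_sub, hq] at h5
    have h8 : n < pow2 i * m + 1 := by
      have : (n : M.RatField) < (pow2 i * m + 1 : M.Num) := by
        rw [Num.coe_add, Num.coe_one]
        linarith
      exact_mod_cast this
    have h9 : pow2 i * m < n + 1 + 1 := by
      have : ((pow2 i * m : M.Num) : M.RatField) < (n + 1 + 1 : M.Num) := by
        rw [Num.coe_add, Num.coe_add, Num.coe_one]
        linarith
      exact_mod_cast this
    rw [Num.lt_add_one_iff] at h8 h9
    have hcomm : v * pow2 i * m = pow2 i * m * v := by ring
    rcases h9.lt_or_eq with h9 | h9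
    · refine Or.inl ⟨n, h2, h3, h1, ?_, ?_⟩
      · show n * v ≤ v * pow2 i * m
        rw [hcomm]
        gcongr
      · show ¬ (n + 1) * v ≤ v * pow2 i * m
        rw [hcomm, not_le]
        exact mul_lt_mul_of_pos_right h9 hv0
    · refine Or.inr ⟨n, h2, h3, h1, ?_, ?_⟩
      · show n * v < v * pow2 i * m
        rw [hcomm, h9]
        exact mul_lt_mul_of_pos_right (Num.lt_add_one n) hv0
      · show ¬ (n + 1) * v < v * pow2 i * m
        rw [hcomm, h9]
        exact lt_irrefl _
  -- If the first expansion leaves the tree at level `u₀`, the second is met at every level past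
  -- `u₀` and `v`, and therefore at all levels.
  by_cases H : ∀ u ∈ M.powers, MeetsCut T (fun n u => n * v ≤ u * m) u
  · exact hcut₁.exists_isPath H
  · push Not at H
    obtain ⟨u₀, hu₀, h₀⟩ := H
    refine hcut₂.exists_isPath fun u hu => ?_
    obtain ⟨w, hw, h1⟩ := exists_mem_powers_gt ((u₀ + u + v : M.Num) : M.RatField)
    have h2 : u₀ + u + v < w := by exact_mod_cast h1
    have h3 : u₀ ≤ w := (le_self_add.trans le_self_add).trans h2.le
    have h4 : u ≤ w := (le_add_self.trans le_self_add).trans h2.le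
    rcases hor w hw (le_add_self.trans h2.le) with h | h
    · exact (h₀ (hcut₁.meetsCut_of_le hT hu₀ hw h3 h)).elim
    · exact hcut₂.meetsCut_of_le hT hu hw h4 h

/-- If the tree has no path, then each real has positive distance from some level of the tree. -/
theorem exists_not_near [hxs : InSets x] (hf : Lists f x) (hx : InUnitInterval x)
    (hpath : ¬ ∃ X ∈ M.sets, M.IsPath T X) :
    ∃ u ∈ M.powers, ∃ q > 0, ∀ a, Within f a q → ¬ Near T u a q := by
  by_contra! H
  by_cases hd : ∀ m, ∀ u ∈ M.powers, Below f m u ∨ Above f m u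
  · exact hpath (exists_isPath_of_not_dyadic hf hx H hd)
  -- A real that is neither below nor above `m / v` satisfies `1 + x = m / v`.
  · push Not at hd
    obtain ⟨m, v, hv, h1, h2⟩ := hd
    have hv0 : (0 : M.RatField) < v := by exact_mod_cast powers_pos hv
    refine hpath (exists_isPath_of_dyadic hT (m := m) hv fun u hu q hq => ?_)
    obtain ⟨a, ⟨k, hk⟩, ha⟩ := H u hu q hq
    refine ⟨a, ?_, ha⟩
    have h3 : ((f k).val + 1 - 1 / ((k : M.RatField) + 1)) ≤ m / v := by
      rw [le_div_iff₀' hv0]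
      exact not_lt.1 fun h => h1 ⟨k, h⟩
    have h4 : m / v ≤ ((f k).val + 1 + 1 / ((k : M.RatField) + 1)) := by
      rw [div_le_iff₀' hv0]
      exact not_lt.1 fun h => h2 ⟨k, h⟩
    rw [abs_lt] at hk
    rw [abs_le]
    constructor <;> linarith

end

end

end L2Structure

namespace L2Structure

section

variable {M : L2Structure.{u}} [hM : Fact M.ModelsRCA0]

/-! ### Fine covers -/

variable {T : Set M.Num} [hTs : InSets T] (hT : IsBinTree T)

include hT

theorem isContGauge_gaugeCode (hinf : IsInfinite T)
    (hpath : ¬ ∃ X ∈ M.sets, M.IsPath T X) : M.IsContGauge (gaugeCode T) := by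
  refine ⟨(gaugeCode.instInSets T).mem, isContCode_gaugeCode hT, fun x hxs hx => ?_⟩
  have : InSets x := ⟨hxs⟩
  obtain ⟨y, hys, hy⟩ := (isContCode_gaugeCode hT).exists_hasValue hx
    (inDomain_gaugeCode hT hinf hx)
  obtain ⟨f, hf⟩ := hx.1.exists_lists
  obtain ⟨u, hu, q, hq, h⟩ := exists_not_near hT hf hx hpath
  exact ⟨y, hys, hy, realPos_of_not_near hT hf hy hu hq h⟩

/-- A ball whose radius is at most the value of the gauge at its centre contains no left end point
of an interval of a level that is large compared to the radius. -/
theorem radius_le_dist {p y r : Set M.Num} {f g h : M.Num → M.Frac} (hp : IsReal p) (hr : IsReal r)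
    (hf : Lists f p) (hg : Lists g y) (hh : Lists h r) (hy : HasValue (gaugeCode T) p y)
    (hle : RealLe r y) {w n k : M.Num} (hw : w ∈ M.powers)
    (hwk : 2 / (w : M.RatField) < (h k).val - 1 / ((k : M.RatField) + 1))
    (hn : n ∈ T) (hn1 : w ≤ n) (hn2 : n < 2 * w) (k₀ : M.Num) :
    (h k₀).val - 3 * (1 / ((k₀ : M.RatField) + 1)) ≤ |(n : M.RatField) / w - 1 - (f k₀).val| := by
  by_contra! hlt
  have hw0 : (0 : M.RatField) < w := by exact_mod_cast powers_pos hw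
  have hk₀ := one_div_pos k₀
  -- The total error is below `3 * ε`: two errors `s < ε` and four terms `1 / (j + 1) < ε / 4`.
  obtain ⟨ε, hε, hε1, hε2⟩ : ∃ ε : M.RatField, 0 < ε ∧ 3 * ε ≤ 1 / (w : M.RatField) ∧
      3 * ε ≤ 1 / ((k₀ : M.RatField) + 1) := by
    refine ⟨min (1 / (w : M.RatField)) (1 / ((k₀ : M.RatField) + 1)) / 3, by positivity, ?_, ?_⟩
    · rw [mul_div_cancel₀ _ (by norm_num)]
      exact min_le_left _ _
    · rw [mul_div_cancel₀ _ (by norm_num)]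
      exact min_le_right _ _
  obtain ⟨j, hj⟩ := Num.exists_inv_lt (show 0 < ε / 4 by positivity)
  obtain ⟨ε', hε'⟩ := Frac.exists_val ε
  obtain ⟨a, r', b, s, h1, h2, h3⟩ := hy.1 ε' (by rwa [Frac.lt_iff, hε', Frac.val_zero])
  rw [Frac.lt_iff, hε'] at h3
  have h4 := abs_le.1 (hg.realRatDistLe_iff.1 (hy.2.2 a r' b s h1 h2) j)
  obtain ⟨k', hk'⟩ := hf.realRatDistLt_iff.1 h2
  obtain ⟨u, hu, v, hv, -, -, hr', -, -, -, h5, h6⟩ := codeRel_gaugeCode.1 h1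
  have h7 := hh.realLe hg hle j
  have h8 := abs_le.1 (hh.dist_le_add hr k j)
  have h9 := abs_le.1 (hh.dist_le_add hr k₀ j)
  have hw2 : 2 / (w : M.RatField) = 1 / w + 1 / w := by ring
  have h10 : 1 / (w : M.RatField) < b.val - s.val + r'.val := by linarith
  -- The lower bound for the gauge exceeds `1 / w`, so its witnessing level is not deeper than `w`,
  -- and nearness of the node `n` at level `w` passes down to it.
  have hvw : v ≤ w := by
    have h11 : (v : M.RatField) < w := by
      by_contra! h
      have h12 : (w : M.RatField) * (b.val - s.val + r'.val) ≤ v * (b.val - s.val + r'.val) :=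
        mul_le_mul_of_nonneg_right h ((by positivity : 0 ≤ 1 / (w : M.RatField)).trans h10.le)
      rw [div_lt_iff₀' hw0] at h10
      linarith
    exact_mod_cast h11.le
  have h13 : b.val - s.val + r'.val < |(n : M.RatField) / w - 1 - a.val| := by
    by_contra! h
    rw [abs_le] at h
    refine h6 (Near.of_le hT hv hw hvw ⟨n, hn2, hn, hn1, ?_, ?_⟩)
    · rw [← div_le_iff₀' hw0]
      linarith [h.2]
    · have h14 : (1 + a.val - (b.val - s.val + r'.val)) ≤ n / w := by linarith [h.1]
      rw [le_div_iff₀' hw0] at h14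
      linarith
  have h15 := abs_sub_le ((n : M.RatField) / w - 1) (f k').val a.val
  have h16 := abs_sub_le ((n : M.RatField) / w - 1) (f k₀).val (f k').val
  have h17 := hf.dist_le_add hp k₀ k'
  linarith [h4.1, h4.2, h8.1, h8.2, h9.1, h9.2]

omit hTs hT

/-- Finitely many positive reals have a common positive lower bound. -/
theorem exists_common_bound {R : Set M.Num} [hRs : InSets R] (l : M.Num)
    (h : ∀ i < l, IsReal (row R i) ∧ RealPos (row R i)) :
    ∃ w ∈ M.powers, ∀ i < l, ∀ f : M.Num → M.Frac, Lists f (row R i) →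
      ∃ k, 2 / (w : M.RatField) < (f k).val - 1 / ((k : M.RatField) + 1) := by
  have hB : Bdd fun e : M.Env => ∃ k, k ≤ e 1 ∧ ∃ q : M.Frac, q.code ≤ e 1 ∧
    (pair (e 0) (pair k q.code) ∈ R ∧ ((Frac.invSucc (e 1)).add (.invSucc k)).Lt q) := inferInstance
  obtain ⟨b, hb⟩ := exists_bound (R := fun i m => ∃ k, k ≤ m ∧ ∃ q : M.Frac, q.code ≤ m ∧
    (pair i (pair k q.code) ∈ R ∧ ((Frac.invSucc m).add (.invSucc k)).Lt q)) hB l fun i hi => by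
      obtain ⟨k, q, hq, hk⟩ := (h i hi).2
      rw [Frac.lt_iff, Frac.val_invSucc] at hk
      -- One number `m` bounds the index, the code of the term and the inverse of the slack. The
      -- length `l` may be nonstandard, so the maximum over `i < l` comes from `exists_bound`.
      obtain ⟨m, hm, hm'⟩ := exists_one_div_lt (sub_pos.2 hk) (k + q.code)
      refine ⟨m, k, le_self_add.trans hm, q, le_add_self.trans hm, hq, ?_⟩
      rw [Frac.lt_iff, Frac.val_add, Frac.val_invSucc, Frac.val_invSucc]
      linarith
  obtain ⟨w, hw, hwb⟩ := exists_mem_powers_gt (2 * ((b : M.RatField) + 1))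
  refine ⟨w, hw, fun i hi f hf => ?_⟩
  obtain ⟨m, hmb, k, -, q, -, hq, hk⟩ := hb i hi
  obtain rfl := (hf k q).1 hq
  rw [Frac.lt_iff, Frac.val_add, Frac.val_invSucc, Frac.val_invSucc] at hk
  refine ⟨k, ?_⟩
  have hw0 : (0 : M.RatField) < w := by exact_mod_cast powers_pos hw
  have hm0 := Num.coe_add_one_pos m
  have hmb' : (m : M.RatField) < b := by exact_mod_cast hmb
  have h1 : 2 / (w : M.RatField) < 1 / ((m : M.RatField) + 1) := by
    rw [div_lt_div_iff₀ hw0 hm0]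
    linarith
  linarith

include hT hTs

/-- The constant real `n / w - 1`, for a node `n` on a level `w` fine enough for all the radii,
escapes every ball by `radius_le_dist`. -/
theorem not_isFineCover_gaugeCode (hinf : IsInfinite T) {P R : Set M.Num} {l : M.Num}
    (hR : R ∈ M.sets) : ¬ M.IsFineCover (gaugeCode T) P R l := by
  intro hc
  have : InSets R := ⟨hR⟩
  obtain ⟨w, hw, hwR⟩ := exists_common_bound l hc.radius
  obtain ⟨n, hn, hn1, hn2⟩ := hT.exists_mem_level hinf hw
  have hw0 : (0 : M.RatField) < w := by exact_mod_cast powers_pos hw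
  obtain ⟨q, hq⟩ := Frac.exists_val ((n : M.RatField) / (w : M.RatField) - 1)
  have hq0 : 0 ≤ q.val := by
    rw [hq, sub_nonneg, one_le_div hw0]
    exact_mod_cast hn1
  have hq1 : q.val ≤ 1 := by
    rw [hq, sub_le_iff_le_add, div_le_iff₀ hw0, one_add_one_eq_two]
    exact_mod_cast hn2.le
  have hS : SigFun fun _ : M.Num => q.code :=
    ⟨(inferInstance : Sig fun e : M.Env => q.code = e 1)⟩
  obtain ⟨z, hz, hzr, hzl⟩ := exists_real (fun _ => q) fun k i => by
    rw [sub_self, abs_zero]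
    exact (one_div_pos k).le
  obtain ⟨i, hi, hlt⟩ := hc.covers z hz ⟨hzr, fun k q' hq' => by
    obtain rfl := (hzl k q').1 hq'
    have := one_div_pos k
    simp only [Frac.le_iff, Frac.val_add, Frac.val_invSucc, Frac.val_zero, Frac.val_one]
    constructor <;> linarith⟩
  have hp := hc.mem_unit i hi
  have hr := hc.radius i hi
  obtain ⟨y, -, hy, hle⟩ := hc.fine i hi
  obtain ⟨f, hf⟩ := hp.1.exists_lists
  obtain ⟨g, hg⟩ := hy.2.1.exists_lists
  obtain ⟨h, hh⟩ := hr.1.exists_lists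
  obtain ⟨k, hk⟩ := hwR i hi h hh
  obtain ⟨k₀, hk₀⟩ := hzl.exists_of_realDistLt hf hh hlt
  rw [hq] at hk₀
  exact not_le.2 hk₀ (radius_le_dist hT hp.1 hr.1 hf hg hh hy hle hw hk hn hn1 hn2 k₀)

end

end L2Structure

theorem mainTheorem5 (M : L2Structure.{u}) (hM : M.ModelsRCA0) (hCL : M.CousinContinuous) :
    M.ModelsWKL0 := by
  refine ⟨hM, fun T hTs hT hinf => ?_⟩
  have : Fact M.ModelsRCA0 := ⟨hM⟩
  have : L2Structure.InSets T := ⟨hTs⟩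
  by_contra hpath
  obtain ⟨P, -, R, hR, l, hc⟩ := hCL _ (L2Structure.isContGauge_gaugeCode hT hinf hpath)
  exact L2Structure.not_isFineCover_gaugeCode hT hinf hR hc
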